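/- Write $\mathfrak S_m$ for the set of permutations $\pi=\pi_1\cdots\pi_m$ of $[m]=\{1,\dots,m\}$. For $\pi\in\mathfrak S_m$ let $P(\pi)$ be its Robinson--Schensted (row) insertion tableau, and for a standard Young tableau $T$ with $m$ cells let $K(T)=\{\pi\in\mathfrak S_m : P(\pi)=T\}$ be its Knuth class. Let $\mathrm{Des}\,\pi=\{i : \pi_i>\pi_{i+1}\}\subseteq[m-1]$. For a set $\Pi\subseteq\mathfrak S_n$: * $\Pi$ is *pattern-Knuth closed* if for every $m\ge 0$ the set $\mathfrak S_m(\Pi)$ of those $\sigma\in\mathfrak S_m$ that avoid every $\pi\in\Pi$ (no subsequence of $\sigma$ is in the same relative order as $\pi$) is a union of Knuth classes. * $\Pi$ is *swap closed* if it is closed under every swap, that is, under interchanging two adjacent entries $\pi_i,\pi_{i+1}$ with $|\pi_i-\pi_{i+1}|>1$ (and hence under sequences of swaps). * For $J\subseteq[n-1]$, $D_J^{-1}=\{\pi^{-1} : \pi\in\mathfrak S_n,\ \mathrm{Des}\,\pi=J\}$. A standard Young tableau is *superstandard* if it is obtained by filling the rows, from top to bottom, one after another with $1,2,\dots,n$,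 or by filling the columns, from left to right, one after another with $1,2,\dots,n$; a *superstandard hook* is a superstandard tableau each of whose cells lies in the first row or in the first column. **Theorem.** Let $S$ be a standard Young tableau with $n$ cells and let $\Pi=K(S)$. The following are equivalent: 1. $\Pi$ is pattern-Knuth closed; 2. $\Pi$ is swap closed; 3. $\Pi=D_J^{-1}$ for some $J\subseteq[n-1]$ of the form $J=\{1,\dots,k\}$ or $J=\{k,k+1,\dots,n-1\}$ for some $k$ (such an interval may be empty); 4. $S$ is a superstandard hook. -/

import Mathlib

namespace PatternKnuth

/-! ### Standard Young tableaux

Diagrams are in English notation; rows and columns are numbered from `0`, entries are `1, …, n`.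
Permutations of `[n]` are elements of `Equiv.Perm (Fin n)`; the one-line notation of `π` is
`π 0 + 1, π 1 + 1, …, π (n-1) + 1`. -/

/-- A standard Young tableau with `n` cells: a filling of a Young diagram in which each of
`1, …, n` is used exactly once and rows and columns increase. (Rows of a semistandard tableau are
weakly increasing, so they are strictly increasing as soon as the entries are distinct.) -/
structure StandardYoungTableau (n : ℕ) where
  /-- the shape -/
  shape : YoungDiagram
  /-- the filling -/
  filling : SemistandardYoungTableau shape
  /-- the entries are `1, …, n`, each used exactly once -/
  bijOn : Set.BijOn (fun c : ℕ × ℕ => filling c.1 c.2) {c | c ∈ shape} (Set.Icc 1 n)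

/-- The list of rows of a standard Young tableau, from top to bottom. -/
def StandardYoungTableau.rows {n : ℕ} (S : StandardYoungTableau n) : List (List ℕ) :=
  (List.range (S.shape.colLen 0)).map fun i =>
    (List.range (S.shape.rowLen i)).map fun j => S.filling i j

/-- Row superstandard: the rows are filled one after another with `1, …, n`. -/
def StandardYoungTableau.IsRowSuperstandard {n : ℕ} (S : StandardYoungTableau n) : Prop :=
  ∀ i j : ℕ, (i, j) ∈ S.shape →
    S.filling i j = (∑ a ∈ Finset.range i, S.shape.rowLen a) + j + 1

/-- Column superstandard: the columns are filled one after another with `1, …, n`. -/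
def StandardYoungTableau.IsColSuperstandard {n : ℕ} (S : StandardYoungTableau n) : Prop :=
  ∀ i j : ℕ, (i, j) ∈ S.shape →
    S.filling i j = (∑ b ∈ Finset.range j, S.shape.colLen b) + i + 1

/-- Hook shape: every cell is in the first row or in the first column. -/
def StandardYoungTableau.IsHook {n : ℕ} (S : StandardYoungTableau n) : Prop :=
  ∀ i j : ℕ, (i, j) ∈ S.shape → i = 0 ∨ j = 0

/-- A superstandard hook: a (row or column) superstandard tableau of hook shape. -/
def StandardYoungTableau.IsSuperstandardHook {n : ℕ} (S : StandardYoungTableau n) : Prop :=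
  (S.IsRowSuperstandard ∨ S.IsColSuperstandard) ∧ S.IsHook

/-! ### Robinson–Schensted insertion and Knuth classes -/

/-- Insert `x` into a row: `x` replaces the leftmost entry greater than `x`, which is returned as
the bumped entry; if there is no such entry, `x` is appended at the end. -/
def rowInsert : List ℕ → ℕ → List ℕ × Option ℕ
  | [], x => ([x], none)
  | y :: r, x =>
    if x < y then (x :: r, some y) else (y :: (rowInsert r x).1, (rowInsert r x).2)

/-- Insert `x` into a tableau (a list of rows): insert `x` into the first row, and insert the
bumped entry, if there is one, into the tableau formed by the remaining rows. -/
def tableauInsert : List (List ℕ) → ℕ → List (List ℕ)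
  | [], x => [[x]]
  | r :: rs, x =>
    match rowInsert r x with
    | (r', none) => r' :: rs
    | (r', some y) => r' :: tableauInsert rs y

/-- The one-line notation `π₁ π₂ … πₙ` of a permutation, with values in `1, …, n`. -/
def oneLine {n : ℕ} (π : Equiv.Perm (Fin n)) : List ℕ :=
  List.ofFn fun i => (π i : ℕ) + 1

/-- The insertion tableau `P(π)`, as its list of rows: `π₁, π₂, …, πₙ` are inserted in this order
into the empty tableau. -/
def insertionTableau {n : ℕ} (π : Equiv.Perm (Fin n)) : List (List ℕ) :=
  (oneLine π).foldl tableauInsert []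

/-- The Knuth class `K(S) = {π | P(π) = S}`. -/
def knuthClass {n : ℕ} (S : StandardYoungTableau n) : Set (Equiv.Perm (Fin n)) :=
  {π | insertionTableau π = S.rows}

/-- `A` is a union of (possibly no) Knuth classes. -/
def IsUnionOfKnuthClasses {n : ℕ} (A : Set (Equiv.Perm (Fin n))) : Prop :=
  ∃ 𝒯 : Set (StandardYoungTableau n), A = ⋃ T ∈ 𝒯, knuthClass T

/-! ### Pattern avoidance -/

/-- `σ` contains `π` as a pattern: some subsequence of `σ` is in the same relative order as `π`,
i.e. has standardization `π`. -/
def Contains {m n : ℕ} (σ : Equiv.Perm (Fin m)) (π : Equiv.Perm (Fin n)) : Prop :=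
  ∃ f : Fin n ↪o Fin m, ∀ i j : Fin n, σ (f i) < σ (f j) ↔ π i < π j

/-- The set `𝔖ₘ(A)` of the permutations of `[m]` that avoid every element of `A`. -/
def avoiders {n : ℕ} (A : Set (Equiv.Perm (Fin n))) (m : ℕ) : Set (Equiv.Perm (Fin m)) :=
  {σ | ∀ π ∈ A, ¬ Contains σ π}

/-- `A` is pattern-Knuth closed: `𝔖ₘ(A)` is a union of Knuth classes for all `m`. -/
def PatternKnuthClosed {n : ℕ} (A : Set (Equiv.Perm (Fin n))) : Prop :=
  ∀ m : ℕ, IsUnionOfKnuthClasses (avoiders A m)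

/-! ### Swaps -/

/-- `σ` is obtained from `π` by a swap: interchanging two entries in adjacent positions whose
values differ by more than `1`. -/
def IsSwap {n : ℕ} (π σ : Equiv.Perm (Fin n)) : Prop :=
  ∃ i j : Fin n, (i : ℕ) + 1 = j ∧ 1 < |((π i : ℕ) : ℤ) - ((π j : ℕ) : ℤ)| ∧
    σ = π * Equiv.swap i j

/-- `σ` can be obtained from `π` by a (possibly empty) sequence of swaps. -/
def SwapEquivalent {n : ℕ} (π σ : Equiv.Perm (Fin n)) : Prop :=
  Relation.ReflTransGen IsSwap π σ

/-- `A` is closed under swap equivalence. -/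
def SwapClosed {n : ℕ} (A : Set (Equiv.Perm (Fin n))) : Prop :=
  ∀ π ∈ A, ∀ σ, SwapEquivalent π σ → σ ∈ A

/-! ### Descents -/

/-- The descent set `Des π = {d | π_d > π_{d+1}} ⊆ [n-1]`, with positions numbered from `1`. -/
def descentSet {n : ℕ} (π : Equiv.Perm (Fin n)) : Set ℕ :=
  {d | ∃ i j : Fin n, (i : ℕ) + 1 = d ∧ (j : ℕ) + 1 = d + 1 ∧ π j < π i}

/-- `D_J`, the set of the permutations of `[n]` with descent set `J`. -/
def descentClass (n : ℕ) (J : Set ℕ) : Set (Equiv.Perm (Fin n)) :=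
  {π | descentSet π = J}

/-- `D_J⁻¹`, the set of the inverses of the elements of `D_J`. -/
def invDescentClass (n : ℕ) (J : Set ℕ) : Set (Equiv.Perm (Fin n)) :=
  (fun π => π⁻¹) '' descentClass n J

end PatternKnuth

namespace PatternKnuth

/-! ### Row insertion of words -/

/-! The implications run 1 → 4 → 3 → 2 → 1, with 3 → 4 in addition. By Knuth's theorem
(`wordTableau_eq_iff`) a Knuth class is an equivalence class of words under the two elementary
relations, in each of which letters x and z change places beside a letter y with x < y < z.

3 → 2: a swap exchanges neighbouring entries with non-consecutive values, so it never changes the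
relative position of d and d + 1, and the descent set of the inverse is preserved
(`descentSet_inv_subset_of_isSwap`).

2 → 1: let a subsequence of a word form a pattern in the set, and let a Knuth move exchange x and z
with witness y. If the subsequence uses both x and z and has a letter of value strictly between
them, the move acts on the pattern as a swap. If it has none, then x or z can be replaced by y
without changing the pattern, and one of the two replacements survives the move
(`IsPatternOf.swap_or_replace`).

4 → 3: the order in which d and d + 1 occur in a word is a Knuth invariant. Prescribing the inverse
descents to be k, …, n - 1 forces 1, …, k into the first row and all larger letters into rows of
length one, so the insertion tableau is the row superstandard hook (`finalWord_iff`). Reversing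
words exchanges the two kinds of hooks and complements the inverse descent set.

1 → 4: pattern-Knuth closure gives that containment of the class of S is invariant under Knuth
equivalence of arbitrary words (`ContainmentInvariant`). After a reversal, 2 may be assumed to lie
in the first row. The labels are doubled, so that there is room for one new odd letter. Let r and s
be the first two rows, and slide s to the right below r as far as the columns stay increasing.
Unless s is a single cell exceeding all of r, the place where the next slide fails determines a word
with one letter more than S that contains the class, together with a Knuth equivalent word that does
not. There are two such constructions: `not_containmentInvariant_of_shift` and
`not_containmentInvariant_of_lt`. If s is a single cell exceeding all of r, the tableau is a row
superstandard hook. -/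

/-- Insert a word into a row, letter by letter; returns the final row and the word of bumped
letters. -/
def rowPass : List ℕ → List ℕ → List ℕ × List ℕ
  | R, [] => (R, [])
  | R, x :: W =>
    ((rowPass (rowInsert R x).1 W).1, (rowInsert R x).2.toList ++ (rowPass (rowInsert R x).1 W).2)

/-- The first row acts as a transducer: it consumes a word and emits the bumped word, which is all
that the lower rows see. Statements about tableau insertion thereby reduce to one row and induction
on the number of rows. -/
theorem foldl_tableauInsert_cons (W R : List ℕ) (T : List (List ℕ)) :
    W.foldl tableauInsert (R :: T) =
      (rowPass R W).1 :: (rowPass R W).2.foldl tableauInsert T := by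
  induction W generalizing R T with
  | nil => rfl
  | cons x W ih =>
    rcases h : rowInsert R x with ⟨r', _ | y⟩ <;> simp [tableauInsert, rowPass, h, ih]

theorem foldl_tableauInsert_nil {W : List ℕ} (hW : W ≠ []) :
    W.foldl tableauInsert [] = (rowPass [] W).1 :: (rowPass [] W).2.foldl tableauInsert [] := by
  cases W with
  | nil => exact absurd rfl hW
  | cons x W => simp [tableauInsert, rowPass, rowInsert, foldl_tableauInsert_cons]

theorem rowPass_append (R V W : List ℕ) :
    rowPass R (V ++ W) = ((rowPass (rowPass R V).1 W).1,
      (rowPass R V).2 ++ (rowPass (rowPass R V).1 W).2) := by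
  induction V generalizing R with
  | nil => rfl
  | cons x V ih => simp [rowPass, ih]

theorem rowInsert_perm (R : List ℕ) (x : ℕ) :
    ((rowInsert R x).2.toList ++ (rowInsert R x).1).Perm (x :: R) := by
  induction R with
  | nil => simp [rowInsert]
  | cons h t ih =>
    unfold rowInsert
    split_ifs with hx
    · simpa using List.Perm.swap x h t
    · simp only
      refine List.perm_middle.trans ?_
      exact (ih.cons h).trans (List.Perm.swap _ _ _)

theorem rowPass_perm (R W : List ℕ) : ((rowPass R W).2 ++ (rowPass R W).1).Perm (W ++ R) := by
  induction W generalizing R with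
  | nil => simp [rowPass]
  | cons x W ih =>
    simp only [rowPass, List.append_assoc, List.cons_append]
    refine ((ih _).append_left _).trans ?_
    refine (List.perm_append_comm_assoc _ _ _).trans ?_
    exact ((rowInsert_perm R x).append_left W).trans List.perm_middle

theorem lt_and_mem_of_rowInsert {R : List ℕ} {x b : ℕ} (h : (rowInsert R x).2 = some b) :
    x < b ∧ b ∈ R := by
  induction R with
  | nil => simp [rowInsert] at h
  | cons a t ih =>
    unfold rowInsert at h
    split_ifs at h with hx
    · simp at h; subst h; exact ⟨hx, by simp⟩
    · exact ⟨(ih h).1, List.mem_cons_of_mem _ (ih h).2⟩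

theorem mem_rowInsert {R : List ℕ} {x v : ℕ} (h : v ∈ (rowInsert R x).1) : v = x ∨ v ∈ R := by
  have := (rowInsert_perm R x).mem_iff (a := v)
  simp only [List.mem_append, List.mem_cons] at this
  exact this.1 (Or.inr h)

theorem rowInsert_pairwise {R : List ℕ} {x : ℕ} (hR : R.Pairwise (· < ·)) (hx : x ∉ R) :
    (rowInsert R x).1.Pairwise (· < ·) := by
  induction R with
  | nil => simp [rowInsert]
  | cons a t ih =>
    rw [List.pairwise_cons] at hR
    simp only [List.mem_cons, not_or] at hx
    unfold rowInsert
    split_ifs with h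
    · exact List.pairwise_cons.2 ⟨fun b hb => h.trans (hR.1 b hb), hR.2⟩
    · refine List.pairwise_cons.2 ⟨fun b hb => ?_, ih hR.2 hx.2⟩
      rcases mem_rowInsert hb with rfl | hb
      · omega
      · exact hR.1 b hb

/-- The row bumping lemma for increasing letters: the larger letter, inserted second, acts strictly
to the right of the first. So if it bumps something, the first one did too. -/
theorem bump_lt_bump_of_lt {R : List ℕ} (hR : R.Pairwise (· < ·)) {y z b : ℕ} (hyz : y < z)
    (h : (rowInsert (rowInsert R y).1 z).2 = some b) :
    ∃ a, (rowInsert R y).2 = some a ∧ a < b := by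
  induction R with
  | nil => simp [rowInsert, hyz.not_gt] at h
  | cons a t ih =>
    rw [List.pairwise_cons] at hR
    by_cases hy : y < a
    · refine ⟨a, by simp [rowInsert, hy], ?_⟩
      simp only [rowInsert, hy, if_true, hyz.not_gt, if_false] at h
      exact hR.1 b (lt_and_mem_of_rowInsert h).2
    · have hz : ¬ z < a := by omega
      simp only [rowInsert, hy, if_false, hz] at h ⊢
      exact ih hR.2 h

/-- The row bumping lemma for decreasing letters: after z is inserted, z itself is an entry greater
than y, so y bumps at z or to its left. -/
theorem exists_bump_of_gt (R : List ℕ) {y z : ℕ} (hyz : y < z) :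
    ∃ b, (rowInsert (rowInsert R z).1 y).2 = some b ∧ b ≤ z := by
  induction R with
  | nil => simp [rowInsert, hyz]
  | cons a t ih =>
    by_cases hz : z < a
    · exact ⟨z, by simp [rowInsert, hz, hyz], le_rfl⟩
    · by_cases hy : y < a
      · exact ⟨a, by simp [rowInsert, hy, hz], by omega⟩
      · simpa [rowInsert, hy, hz] using ih

/-! ### Knuth equivalence -/

/-- The elementary Knuth relations on three letters. -/
inductive KnuthTriple : List ℕ → List ℕ → Prop
  | left {x y z : ℕ} (hxy : x < y) (hyz : y < z) : KnuthTriple [y, x, z] [y, z, x]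
  | right {x y z : ℕ} (hxy : x < y) (hyz : y < z) : KnuthTriple [x, z, y] [z, x, y]

/-- An elementary Knuth move inside a word. -/
def KnuthStep (w w' : List ℕ) : Prop :=
  ∃ u v a b, KnuthTriple a b ∧ w = u ++ a ++ v ∧ w' = u ++ b ++ v

/-- Knuth equivalence of words. -/
def KnuthEquiv : List ℕ → List ℕ → Prop := Relation.EqvGen KnuthStep

/-- Entries below x are skipped by all three letters, so induction reduces to the case where x bumps
the first entry h. If h < y, the letters y and z act to the right of h independently of x, and the
bumped letters form a triple with h smallest. Otherwise y bumps h and x bumps y. -/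
theorem KnuthTriple.rowPass_left {R : List ℕ} (hR : R.Pairwise (· < ·)) {x y z : ℕ}
    (hxy : x < y) (hyz : y < z) (hx : x ∉ R) (hy : y ∉ R) (hz : z ∉ R) :
    (rowPass R [y, x, z]).1 = (rowPass R [y, z, x]).1 ∧
      ((rowPass R [y, x, z]).2 = (rowPass R [y, z, x]).2 ∨
        KnuthTriple (rowPass R [y, x, z]).2 (rowPass R [y, z, x]).2) := by
  induction R with
  | nil =>
    simp [rowPass, rowInsert, hxy, hyz.not_gt, (hxy.trans hyz).not_gt]
  | cons h t ih =>
    rw [List.pairwise_cons] at hR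
    simp only [List.mem_cons, not_or] at hx hy hz
    have hxz := hxy.trans hyz
    by_cases h1 : h < x
    · have := ih hR.2 hx.2 hy.2 hz.2
      simp only [rowPass, rowInsert, h1.not_gt, (h1.trans hxy).not_gt,
        (h1.trans hxz).not_gt, if_false] at this ⊢
      exact ⟨by rw [this.1], this.2⟩
    · have h1 : x < h := by omega
      by_cases h2 : h < y
      · have h3 := h2.trans hyz
        simp only [rowPass, rowInsert, h1, h2.not_gt, h3.not_gt, if_false, if_true, hxz.not_gt]
        refine ⟨trivial, ?_⟩
        rcases e : (rowInsert (rowInsert t y).1 z).2 with _ | b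
        · left; simp
        · obtain ⟨a, ha, hab⟩ := bump_lt_bump_of_lt hR.2 hyz e
          right
          rw [ha]
          exact KnuthTriple.left (h2.trans (lt_and_mem_of_rowInsert ha).1) hab
      · have h2 : y < h := by omega
        simp only [rowPass, rowInsert, hxy, h2, hyz.not_gt, if_false, if_true, hxz.not_gt]
        refine ⟨trivial, ?_⟩
        rcases e : (rowInsert t z).2 with _ | b
        · left; simp
        · right
          exact KnuthTriple.left h2 (hR.1 b (lt_and_mem_of_rowInsert e).2)

/-- The same reduction to the case where x meets the first entry. Here the bumped triple may change
its type and direction, which is why the conclusion is symmetric in the two words. -/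
theorem KnuthTriple.rowPass_right {R : List ℕ} (hR : R.Pairwise (· < ·)) {x y z : ℕ}
    (hxy : x < y) (hyz : y < z) (hx : x ∉ R) (hy : y ∉ R) (hz : z ∉ R) :
    (rowPass R [x, z, y]).1 = (rowPass R [z, x, y]).1 ∧
      ((rowPass R [x, z, y]).2 = (rowPass R [z, x, y]).2 ∨
        KnuthTriple (rowPass R [x, z, y]).2 (rowPass R [z, x, y]).2 ∨
        KnuthTriple (rowPass R [z, x, y]).2 (rowPass R [x, z, y]).2) := by
  induction R with
  | nil =>
    simp [rowPass, rowInsert, hxy.not_gt, hyz, (hxy.trans hyz), (hxy.trans hyz).not_gt]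
  | cons h t ih =>
    rw [List.pairwise_cons] at hR
    simp only [List.mem_cons, not_or] at hx hy hz
    have hxz := hxy.trans hyz
    by_cases h1 : h < x
    · have := ih hR.2 hx.2 hy.2 hz.2
      simp only [rowPass, rowInsert, h1.not_gt, (h1.trans hxy).not_gt,
        (h1.trans hxz).not_gt, if_false] at this ⊢
      exact ⟨by rw [this.1], this.2⟩
    · have h1 : x < h := by omega
      by_cases h2 : h < z
      · simp only [rowPass, rowInsert, h1, h2.not_gt, if_false, if_true, hxz.not_gt, hxy.not_gt]
        refine ⟨trivial, ?_⟩
        rcases e : (rowInsert t z).2 with _ | b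
        · left; simp
        · obtain ⟨a, ha, haz⟩ := exists_bump_of_gt t hyz
          right; left
          rw [ha]
          refine KnuthTriple.right ?_ (haz.trans_lt (lt_and_mem_of_rowInsert e).1)
          rcases mem_rowInsert (lt_and_mem_of_rowInsert ha).2 with rfl | hm
          · exact h2
          · exact hR.1 _ hm
      · have h2 : z < h := by omega
        cases t with
        | nil =>
          simp [rowPass, rowInsert, hxz, h1, h2, hyz, hxy.not_gt, hxz.not_gt]
        | cons g t =>
          have hg : h < g := hR.1 g (by simp)
          simp only [rowPass, rowInsert, h1, h2, hxz, hyz, hxy.not_gt, hxz.not_gt, if_false,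
            if_true, h2.trans hg, hyz.trans (h2.trans hg)]
          -- The bumped words are h g z and h z g with z < h < g: a triple of the other type, in the
          -- opposite direction.
          refine ⟨trivial, Or.inr (Or.inr ?_)⟩
          exact KnuthTriple.left h2 hg

theorem KnuthTriple.perm {a b : List ℕ} (h : KnuthTriple a b) : a.Perm b := by
  cases h with
  | left => exact (List.Perm.swap _ _ _).cons _
  | right => exact List.Perm.swap _ _ _

/-- Elementary Knuth relations do not change the result of insertion. -/
theorem KnuthTriple.foldl_eq {a b : List ℕ} (h : KnuthTriple a b) (T : List (List ℕ))
    (hs : ∀ R ∈ T, R.Pairwise (· < ·)) (hn : (a ++ T.flatten).Nodup) :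
    a.foldl tableauInsert T = b.foldl tableauInsert T := by
  induction T generalizing a b with
  | nil =>
    cases h with
    | left hxy hyz =>
      simp [tableauInsert, rowInsert, hxy, hyz.not_gt, (hxy.trans hyz).not_gt]
    | right hxy hyz =>
      simp [tableauInsert, rowInsert, hxy.not_gt, hyz, (hxy.trans hyz), (hxy.trans hyz).not_gt]
  | cons R T ih =>
    have hR := hs R (by simp)
    have hT : ∀ Q ∈ T, Q.Pairwise (· < ·) := fun Q hQ => hs Q (by simp [hQ])
    -- The first rows agree, and the words passed to the lower rows are equal or again form a triple
    -- in one of the two directions, so the induction on rows continues.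
    have key : (rowPass R a).1 = (rowPass R b).1 ∧ ((rowPass R a).2 = (rowPass R b).2 ∨
        KnuthTriple (rowPass R a).2 (rowPass R b).2 ∨
        KnuthTriple (rowPass R b).2 (rowPass R a).2) := by
      have hd : ∀ v ∈ a, v ∉ R := fun v hv hvR =>
        (List.nodup_append.1 hn).2.2 v hv v (by simp [hvR]) rfl
      cases h with
      | left hxy hyz =>
        have := KnuthTriple.rowPass_left hR hxy hyz (hd _ (by simp)) (hd _ (by simp))
          (hd _ (by simp))
        tauto
      | right hxy hyz =>
        exact KnuthTriple.rowPass_right hR hxy hyz (hd _ (by simp)) (hd _ (by simp))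
          (hd _ (by simp))
    have hnd : ∀ c : List ℕ, c.Perm a → ((rowPass R c).2 ++ T.flatten).Nodup := by
      intro c hc
      have h1 : (((rowPass R c).2 ++ (rowPass R c).1) ++ T.flatten).Nodup := by
        refine (List.Perm.nodup_iff (((rowPass_perm R c).trans
          (hc.append_right R)).append_right T.flatten)).2 ?_
        simpa using hn
      refine h1.sublist ?_
      rw [List.append_assoc]
      exact (List.Sublist.refl _).append (List.sublist_append_right _ _)
    rw [foldl_tableauInsert_cons, foldl_tableauInsert_cons, key.1]
    congr 1
    rcases key.2 with e | e | e
    · rw [e]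
    · exact ih e hT (hnd a (List.Perm.refl _))
    · exact (ih e hT (hnd b h.perm.symm)).symm

theorem KnuthStep.perm {w w' : List ℕ} (h : KnuthStep w w') : w.Perm w' := by
  obtain ⟨u, v, a, b, hab, rfl, rfl⟩ := h
  exact (hab.perm.append_left u).append_right v

theorem KnuthEquiv.perm {w w' : List ℕ} (h : KnuthEquiv w w') : w.Perm w' := by
  induction h with
  | rel _ _ h => exact h.perm
  | refl _ => exact List.Perm.refl _
  | symm _ _ _ ih => exact ih.symm
  | trans _ _ _ _ _ ih1 ih2 => exact ih1.trans ih2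

theorem KnuthEquiv.refl (w : List ℕ) : KnuthEquiv w w := Relation.EqvGen.refl w

theorem KnuthEquiv.symm {w w' : List ℕ} (h : KnuthEquiv w w') : KnuthEquiv w' w :=
  Relation.EqvGen.symm _ _ h

theorem KnuthEquiv.trans {w w' w'' : List ℕ} (h : KnuthEquiv w w') (h' : KnuthEquiv w' w'') :
    KnuthEquiv w w'' :=
  Relation.EqvGen.trans _ _ _ h h'

/-- A property that elementary Knuth moves leave unchanged is invariant under Knuth equivalence. -/
theorem KnuthEquiv.iff_of_step {p : List ℕ → Prop}
    (hp : ∀ w w', w.Nodup → KnuthStep w w' → (p w ↔ p w')) {w w' : List ℕ}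
    (h : KnuthEquiv w w') (hw : w.Nodup) : p w ↔ p w' := by
  induction h with
  | rel _ _ h => exact hp _ _ hw h
  | refl _ => exact Iff.rfl
  | symm _ _ h ih => exact (ih ((KnuthEquiv.perm h).nodup_iff.2 hw)).symm
  | trans _ _ _ h _ ih1 ih2 => exact (ih1 hw).trans (ih2 ((KnuthEquiv.perm h).nodup_iff.1 hw))

theorem KnuthEquiv.lift {g : List ℕ → List ℕ} {w w' : List ℕ}
    (hg : ∀ w w', KnuthStep w w' → KnuthEquiv (g w) (g w'))
    (h : KnuthEquiv w w') : KnuthEquiv (g w) (g w') := by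
  induction h with
  | rel _ _ h => exact hg _ _ h
  | refl _ => exact KnuthEquiv.refl _
  | symm _ _ _ ih => exact ih.symm
  | trans _ _ _ _ _ ih1 ih2 => exact ih1.trans ih2

theorem KnuthStep.equiv {w w' : List ℕ} (h : KnuthStep w w') : KnuthEquiv w w' :=
  Relation.EqvGen.rel _ _ h

theorem KnuthEquiv.append_left (u : List ℕ) {w w' : List ℕ} (h : KnuthEquiv w w') :
    KnuthEquiv (u ++ w) (u ++ w') := by
  refine h.lift (g := fun w => u ++ w) fun w w' ⟨p, q, a, b, hab, hw, hw'⟩ => KnuthStep.equiv ?_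
  exact ⟨u ++ p, q, a, b, hab, by simp [hw], by simp [hw']⟩

theorem KnuthEquiv.append_right (u : List ℕ) {w w' : List ℕ} (h : KnuthEquiv w w') :
    KnuthEquiv (w ++ u) (w' ++ u) := by
  refine h.lift (g := fun w => w ++ u) fun w w' ⟨p, q, a, b, hab, hw, hw'⟩ => KnuthStep.equiv ?_
  exact ⟨p, q ++ u, a, b, hab, by simp [hw], by simp [hw']⟩

/-- Reversal exchanges the two elementary relations. This takes the place of transposing tableaux
throughout. -/
theorem KnuthEquiv.reverse {w w' : List ℕ} (h : KnuthEquiv w w') :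
    KnuthEquiv w.reverse w'.reverse := by
  refine h.lift fun w w' ⟨p, q, a, b, hab, hw, hw'⟩ => ?_
  subst hw hw'
  cases hab with
  | left hxy hyz =>
    refine KnuthEquiv.symm (KnuthStep.equiv ⟨q.reverse, p.reverse, _, _, .right hxy hyz, ?_, ?_⟩)
      <;> simp
  | right hxy hyz =>
    refine KnuthEquiv.symm (KnuthStep.equiv ⟨q.reverse, p.reverse, _, _, .left hxy hyz, ?_, ?_⟩)
      <;> simp

theorem KnuthEquiv.map {w w' : List ℕ} (h : KnuthEquiv w w') {f : ℕ → ℕ}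
    (hf : StrictMonoOn f {v | v ∈ w}) : KnuthEquiv (w.map f) (w'.map f) := by
  induction h with
  | rel w w' h =>
    obtain ⟨p, q, a, b, hab, rfl, rfl⟩ := h
    cases hab with
    | left hxy hyz =>
      refine KnuthStep.equiv ⟨p.map f, q.map f, _, _,
        .left (hf ?_ ?_ hxy) (hf ?_ ?_ hyz), ?_, ?_⟩ <;> simp
    | right hxy hyz =>
      refine KnuthStep.equiv ⟨p.map f, q.map f, _, _,
        .right (hf ?_ ?_ hxy) (hf ?_ ?_ hyz), ?_, ?_⟩ <;> simp
  | refl _ => exact KnuthEquiv.refl _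
  | symm _ _ h ih =>
    refine (ih ?_).symm
    convert hf using 3
    exact (KnuthEquiv.perm h).mem_iff
  | trans _ _ _ h _ ih1 ih2 =>
    refine (ih1 hf).trans (ih2 ?_)
    convert hf using 3
    exact (KnuthEquiv.perm h).mem_iff.symm

/-! ### Reading words and Knuth's theorem -/

/-- The row reading word of a list of rows: the rows from bottom to top. -/
def readingWord : List (List ℕ) → List ℕ
  | [] => []
  | R :: T => readingWord T ++ R

theorem readingWord_perm (T : List (List ℕ)) : (readingWord T).Perm T.flatten := by
  induction T with
  | nil => simp [readingWord]
  | cons R T ih => simpa [readingWord] using List.perm_append_comm.trans (ih.append_left R)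

theorem tableauInsert_perm (T : List (List ℕ)) (x : ℕ) :
    (tableauInsert T x).flatten.Perm (x :: T.flatten) := by
  induction T generalizing x with
  | nil => simp [tableauInsert]
  | cons R T ih =>
    have h := rowInsert_perm R x
    rcases e : rowInsert R x with ⟨r', _ | y⟩
    · simp only [e, Option.toList_none, List.nil_append] at h
      simp only [tableauInsert, e, List.flatten_cons]
      exact h.append_right _
    · simp only [e, Option.toList_some, List.singleton_append] at h
      simp only [tableauInsert, e, List.flatten_cons]
      refine ((ih y).append_left r').trans (List.perm_middle.trans ?_)
      exact h.append_right T.flatten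

theorem foldl_tableauInsert_perm (W : List ℕ) (T : List (List ℕ)) :
    (W.foldl tableauInsert T).flatten.Perm (W ++ T.flatten) := by
  induction W generalizing T with
  | nil => simp
  | cons x W ih =>
    exact (ih _).trans (((tableauInsert_perm T x).append_left W).trans List.perm_middle)

theorem tableauInsert_pairwise {T : List (List ℕ)} {x : ℕ} (hT : ∀ R ∈ T, R.Pairwise (· < ·))
    (hn : (x :: T.flatten).Nodup) : ∀ R ∈ tableauInsert T x, R.Pairwise (· < ·) := by
  induction T generalizing x with
  | nil => simp [tableauInsert]
  | cons R T ih =>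
    have h := rowInsert_perm R x
    have hx : x ∉ R := fun hx => (List.nodup_cons.1 hn).1 (by simp [hx])
    have h1 := rowInsert_pairwise (hT R (by simp)) hx
    have hT' : ∀ Q ∈ T, Q.Pairwise (· < ·) := fun Q hQ => hT Q (by simp [hQ])
    rcases e : rowInsert R x with ⟨r', _ | y⟩
    · simp only [e] at h1
      simpa [tableauInsert, e, h1] using hT'
    · simp only [e, Option.toList_some, List.singleton_append] at h h1
      have hn' : (y :: T.flatten).Nodup := by
        have : ((y :: r') ++ T.flatten).Nodup := by
          refine (h.append_right T.flatten).nodup_iff.2 ?_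
          simpa using hn
        refine this.sublist ?_
        simp
      simpa [tableauInsert, e, h1] using ih hT' hn'

theorem foldl_tableauInsert_pairwise {W : List ℕ} {T : List (List ℕ)}
    (hT : ∀ R ∈ T, R.Pairwise (· < ·)) (hn : (W ++ T.flatten).Nodup) :
    ∀ R ∈ W.foldl tableauInsert T, R.Pairwise (· < ·) := by
  induction W generalizing T with
  | nil => exact hT
  | cons x W ih =>
    refine ih (tableauInsert_pairwise hT (hn.sublist ?_)) ?_
    · simp
    · exact (((tableauInsert_perm T x).append_left W).trans List.perm_middle).nodup_iff.2 hn

/-- The letter x moves left across B one letter at a time; the witness for each exchange is the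
letter just before the one being crossed. Together with `KnuthEquiv.move_right` this realises one
bump by Knuth moves. -/
theorem KnuthEquiv.move_left {x y : ℕ} {B : List ℕ} (hB : (y :: B).Pairwise (· < ·)) (hxy : x < y) :
    KnuthEquiv (y :: B ++ [x]) (y :: x :: B) := by
  induction B generalizing y with
  | nil => exact KnuthEquiv.refl _
  | cons b B ih =>
    rw [List.pairwise_cons] at hB
    have hyb := hB.1 b (by simp)
    refine ((ih hB.2 (hxy.trans hyb)).append_left [y]).trans ?_
    exact KnuthEquiv.symm (KnuthStep.equiv ⟨[], B, _, _, .left hxy hyb, by simp, by simp⟩)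

/-- The bumped letter y moves left across A; the witness for crossing a is the letter that follows a
in A ++ [x]. -/
theorem KnuthEquiv.move_right {x y : ℕ} {A : List ℕ} (hA : (A ++ [x]).Pairwise (· < ·))
    (hxy : x < y) : KnuthEquiv (A ++ [y, x]) (y :: A ++ [x]) := by
  induction A with
  | nil => exact KnuthEquiv.refl _
  | cons a A ih =>
    rw [List.cons_append, List.pairwise_cons] at hA
    refine ((ih hA.2).append_left [a]).trans ?_
    obtain ⟨c, C, e⟩ : ∃ c C, A ++ [x] = c :: C := List.exists_cons_of_ne_nil (by simp)
    have hac := hA.1 c (by simp [e])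
    have hcy : c < y := by
      have : c ∈ A ++ [x] := by simp [e]
      rcases List.mem_append.1 this with h | h
      · exact ((List.pairwise_append.1 hA.2).2.2 c h x (by simp)).trans hxy
      · simp at h; omega
    refine KnuthStep.equiv ⟨[], C, _, _, .right hac hcy, ?_, ?_⟩ <;> simp [e]

theorem rowInsert_cases {R : List ℕ} {x : ℕ} (hR : R.Pairwise (· < ·)) (hx : x ∉ R) :
    (rowInsert R x = (R ++ [x], none) ∧ ∀ v ∈ R, v < x) ∨
    ∃ A y B, R = A ++ y :: B ∧ rowInsert R x = (A ++ x :: B, some y) ∧ x < y ∧ ∀ v ∈ A, v < x := by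
  induction R with
  | nil => simp [rowInsert]
  | cons h t ih =>
    rw [List.pairwise_cons] at hR
    simp only [List.mem_cons, not_or] at hx
    by_cases hxh : x < h
    · exact Or.inr ⟨[], h, t, rfl, by simp [rowInsert, hxh], hxh, by simp⟩
    · have hhx : h < x := by omega
      rcases ih hR.2 hx.2 with ⟨e, hv⟩ | ⟨A, y, B, rfl, e, hxy, hv⟩
      · refine Or.inl ⟨by simp [rowInsert, hxh, e], ?_⟩
        simpa [hhx] using hv
      · refine Or.inr ⟨h :: A, y, B, rfl, by simp [rowInsert, hxh, e], hxy, ?_⟩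
        simpa [hhx] using hv

/-- If x bumps y from the row A y B, then A y B x is equivalent to y A x B, which places y directly
after the reading word of the lower rows, ready for their insertion. -/
theorem knuthEquiv_tableauInsert {T : List (List ℕ)} {x : ℕ} (hT : ∀ R ∈ T, R.Pairwise (· < ·))
    (hn : (x :: T.flatten).Nodup) :
    KnuthEquiv (readingWord T ++ [x]) (readingWord (tableauInsert T x)) := by
  induction T generalizing x with
  | nil => exact KnuthEquiv.refl _
  | cons R T ih =>
    have hx : x ∉ R := fun hx => (List.nodup_cons.1 hn).1 (by simp [hx])
    have hR := hT R (by simp)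
    have hT' : ∀ Q ∈ T, Q.Pairwise (· < ·) := fun Q hQ => hT Q (by simp [hQ])
    rcases rowInsert_cases hR hx with ⟨e, -⟩ | ⟨A, y, B, rfl, e, hxy, hv⟩
    · simp only [tableauInsert, e, readingWord, List.append_assoc]
      exact KnuthEquiv.refl _
    · simp only [tableauInsert, e, readingWord]
      have hn' : (y :: T.flatten).Nodup := by
        refine hn.sublist ?_
        simp only [List.flatten_cons, List.append_assoc]
        refine List.Sublist.trans ?_ (List.sublist_cons_self _ _)
        refine List.Sublist.trans ?_ (List.sublist_append_right _ _)
        simp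
      rw [List.pairwise_append] at hR
      have h1 : KnuthEquiv (A ++ y :: B ++ [x]) (A ++ y :: x :: B) := by
        simpa using (KnuthEquiv.move_left hR.2.1 hxy).append_left A
      have h2 : KnuthEquiv (A ++ y :: x :: B) (y :: (A ++ x :: B)) := by
        have hA : (A ++ [x]).Pairwise (· < ·) := by
          rw [List.pairwise_append]
          exact ⟨hR.1, by simp, by simpa using hv⟩
        simpa using (KnuthEquiv.move_right hA hxy).append_right B
      have h3 : KnuthEquiv (readingWord T ++ (A ++ y :: B) ++ [x])
          (readingWord T ++ [y] ++ (A ++ x :: B)) := by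
        simpa using (h1.trans h2).append_left (readingWord T)
      exact h3.trans ((ih hT' hn').append_right _)

theorem knuthEquiv_foldl {W : List ℕ} {T : List (List ℕ)} (hT : ∀ R ∈ T, R.Pairwise (· < ·))
    (hn : (W ++ T.flatten).Nodup) :
    KnuthEquiv (readingWord T ++ W) (readingWord (W.foldl tableauInsert T)) := by
  induction W generalizing T with
  | nil => simpa using KnuthEquiv.refl _
  | cons x W ih =>
    have h1 : (x :: T.flatten).Nodup := hn.sublist (by simp)
    have h2 := ih (tableauInsert_pairwise hT h1)
      ((((tableauInsert_perm T x).append_left W).trans List.perm_middle).nodup_iff.2 hn)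
    have h3 := (knuthEquiv_tableauInsert hT h1).append_right W
    simpa using h3.trans h2

/-- The insertion tableau of a word. -/
def wordTableau (w : List ℕ) : List (List ℕ) := w.foldl tableauInsert []

theorem knuthEquiv_readingWord_wordTableau {w : List ℕ} (hw : w.Nodup) :
    KnuthEquiv w (readingWord (wordTableau w)) := by
  simpa [readingWord, wordTableau] using knuthEquiv_foldl (W := w) (T := []) (by simp) (by simpa using hw)

/-- A triple inside a word is inserted into the tableau of the letters before it, where
`KnuthTriple.foldl_eq` applies; the letters after it then meet the same tableau. -/
theorem KnuthEquiv.wordTableau_eq {w w' : List ℕ} (h : KnuthEquiv w w') (hw : w.Nodup) :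
    wordTableau w = wordTableau w' := by
  refine ((h.iff_of_step (p := fun v => wordTableau v = wordTableau w) ?_ hw).1 rfl).symm
  rintro v v' hv ⟨p, q, a, b, hab, rfl, rfl⟩
  suffices wordTableau (p ++ a ++ q) = wordTableau (p ++ b ++ q) by rw [this]
  unfold wordTableau
  rw [List.foldl_append, List.foldl_append, List.foldl_append, List.foldl_append]
  congr 1
  have hpa : (p ++ a).Nodup := hv.sublist (by simp)
  refine hab.foldl_eq _ (foldl_tableauInsert_pairwise (by simp) ?_) ?_
  · simpa using hpa.sublist (List.sublist_append_left p a)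
  · have := (foldl_tableauInsert_perm p []).append_left a
    refine this.nodup_iff.2 ?_
    simpa using List.perm_append_comm.nodup_iff.1 hpa

/-- **Knuth's theorem**: two words without repeated letters have the same insertion tableau if and
only if they are Knuth equivalent. -/
theorem wordTableau_eq_iff {w w' : List ℕ} (hw : w.Nodup) (hw' : w'.Nodup) :
    wordTableau w = wordTableau w' ↔ KnuthEquiv w w' := by
  refine ⟨fun h => ?_, fun h => h.wordTableau_eq hw⟩
  have := knuthEquiv_readingWord_wordTableau hw
  rw [h] at this
  exact this.trans (knuthEquiv_readingWord_wordTableau hw').symm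


/-! ### Tableaux as lists of rows -/

/-- `Above R S`: the row `S` may stand below the row `R` in a tableau. -/
inductive Above : List ℕ → List ℕ → Prop
  | nil (R : List ℕ) : Above R []
  | cons {a b : ℕ} {R S : List ℕ} (hab : a < b) (h : Above R S) : Above (a :: R) (b :: S)

theorem Above.length_le {R S : List ℕ} (h : Above R S) : S.length ≤ R.length := by
  induction h with
  | nil => simp
  | cons _ _ ih => simpa using ih

theorem Above.getD_lt {R S : List ℕ} (h : Above R S) :
    ∀ i, i < S.length → R.getD i 0 < S.getD i 0 := by
  induction h with
  | nil => simp
  | cons hab _ ih =>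
    rintro (_ | i) hi
    · simpa using hab
    · simpa using ih i (by simpa using hi)

theorem Above.of_getD_lt {R S : List ℕ} (hl : S.length ≤ R.length)
    (h : ∀ i, i < S.length → R.getD i 0 < S.getD i 0) : Above R S := by
  induction S generalizing R with
  | nil => exact .nil R
  | cons b S ih =>
    cases R with
    | nil => simp at hl
    | cons a R =>
      refine .cons (by simpa using h 0 (by simp)) (ih (by simpa using hl) fun i hi => ?_)
      simpa using h (i + 1) (by simpa using hi)

theorem Above.map {R S : List ℕ} (h : Above R S) {f : ℕ → ℕ}
    (hf : StrictMonoOn f {v | v ∈ R ∨ v ∈ S}) : Above (R.map f) (S.map f) := by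
  induction h with
  | nil => exact .nil _
  | cons hab _ ih =>
    refine .cons (hf (by simp) (by simp) hab) (ih (hf.mono ?_))
    rintro v (hv | hv) <;> simp [hv]

/-- A list of rows is a tableau: its rows are nonempty and increasing and its columns increase. -/
def IsTableau : List (List ℕ) → Prop
  | [] => True
  | R :: T => R ≠ [] ∧ R.Pairwise (· < ·) ∧ Above R (T.headD []) ∧ IsTableau T

theorem IsTableau.pairwise {T : List (List ℕ)} (h : IsTableau T) :
    ∀ R ∈ T, R.Pairwise (· < ·) := by
  induction T with
  | nil => simp
  | cons R T ih =>
    rintro Q hQ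
    rcases List.mem_cons.1 hQ with rfl | hQ
    · exact h.2.1
    · exact ih h.2.2.2 Q hQ

theorem IsTableau.ne_nil {T : List (List ℕ)} (h : IsTableau T) : ∀ R ∈ T, R ≠ [] := by
  induction T with
  | nil => simp
  | cons R T ih =>
    rintro Q hQ
    rcases List.mem_cons.1 hQ with rfl | hQ
    · exact h.1
    · exact ih h.2.2.2 Q hQ

theorem IsTableau.map {T : List (List ℕ)} (h : IsTableau T) {f : ℕ → ℕ}
    (hf : StrictMonoOn f {v | v ∈ T.flatten}) : IsTableau (T.map (List.map f)) := by
  induction T with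
  | nil => trivial
  | cons R T ih =>
    obtain ⟨h1, h2, h3, h4⟩ := h
    refine ⟨by simpa using h1, ?_, ?_, ih h4 (hf.mono fun v hv => ?_)⟩
    · rw [List.pairwise_map]
      refine h2.imp_of_mem fun ha hb hab => hf ?_ ?_ hab
      · simp [ha]
      · simp [hb]
    · cases T with
      | nil => exact .nil _
      | cons S T =>
        refine Above.map h3 (hf.mono ?_)
        rintro v (hv | hv)
        · simp [hv]
        · have : v ∈ S := hv
          simp [this]
    · simp only [List.flatten_cons, Set.mem_ofPred_eq, List.mem_append] at hv ⊢
      exact Or.inr hv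

theorem readingWord_map (T : List (List ℕ)) (f : ℕ → ℕ) :
    readingWord (T.map (List.map f)) = (readingWord T).map f := by
  induction T with
  | nil => rfl
  | cons R T ih => simp [readingWord, ih]

/-! ### Inserting increasing words -/

theorem rowInsert_append {A R : List ℕ} {x : ℕ} (hA : ∀ a ∈ A, a < x) :
    rowInsert (A ++ R) x = (A ++ (rowInsert R x).1, (rowInsert R x).2) := by
  induction A with
  | nil => rfl
  | cons a A ih =>
    have ha := hA a (by simp)
    simp [rowInsert, ha.not_gt, ih fun b hb => hA b (by simp [hb])]

theorem rowPass_prefix {A R W : List ℕ} (hA : ∀ a ∈ A, ∀ x ∈ W, a < x) :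
    rowPass (A ++ R) W = (A ++ (rowPass R W).1, (rowPass R W).2) := by
  induction W generalizing R with
  | nil => rfl
  | cons x W ih =>
    have h1 := rowInsert_append (A := A) (R := R) fun a ha => hA a ha x (by simp)
    have h2 := fun R => ih (R := R) fun a ha y hy => hA a ha y (by simp [hy])
    simp [rowPass, h1, h2]

/-- Each letter of c exceeds all earlier ones, so those are skipped and the i-th letter lands in
cell i: it replaces the entry there, or is appended once the row is exhausted. -/
theorem rowPass_of_lt {c l : List ℕ} (hc : c.Pairwise (· < ·))
    (h : ∀ i, i < c.length → i < l.length → c.getD i 0 < l.getD i 0) :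
    rowPass l c = (c ++ l.drop c.length, l.take c.length) := by
  induction c generalizing l with
  | nil => simp [rowPass]
  | cons x c ih =>
    rw [List.pairwise_cons] at hc
    have hx : ∀ a ∈ [x], ∀ y ∈ c, a < y := by simpa using hc.1
    cases l with
    | nil =>
      have h1 := rowPass_prefix (R := []) hx
      simp only [List.singleton_append] at h1
      simp [rowPass, rowInsert, h1, ih (l := []) hc.2 (by simp)]
    | cons a t =>
      have hxa : x < a := by simpa using h 0 (by simp) (by simp)
      have h1 := rowPass_prefix (R := t) hx
      simp only [List.singleton_append] at h1
      have h2 := ih (l := t) hc.2 fun i hi hj => by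
        simpa using h (i + 1) (by simpa using hi) (by simpa using hj)
      simp [rowPass, rowInsert, hxa, h1, h2]

theorem rowPass_of_gt {R W : List ℕ} (hW : W.Pairwise (· < ·)) (h : ∀ a ∈ R, ∀ x ∈ W, a < x) :
    rowPass R W = (R ++ W, []) := by
  have h1 := rowPass_prefix (R := []) h
  rw [List.append_nil] at h1
  simp [h1, rowPass_of_lt (l := []) hW]

/-- Inserting R into the first row S below it replaces S by R entirely and emits S, by the column
condition. Thus every row moves down by one. -/
theorem IsTableau.foldl_eq {R : List ℕ} {T : List (List ℕ)} (h : IsTableau (R :: T)) :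
    R.foldl tableauInsert T = R :: T := by
  induction T generalizing R with
  | nil =>
    rw [foldl_tableauInsert_nil h.1, rowPass_of_lt (l := []) h.2.1 (by simp)]
    simp
  | cons S T ih =>
    have hl : S.length ≤ R.length := h.2.2.1.length_le
    have hp := rowPass_of_lt (l := S) h.2.1 fun i _ hi => h.2.2.1.getD_lt i hi
    rw [foldl_tableauInsert_cons, hp]
    simp [List.drop_eq_nil_of_le hl, List.take_of_length_le hl, ih h.2.2.2]

theorem IsTableau.wordTableau_readingWord {T : List (List ℕ)} (h : IsTableau T) :
    wordTableau (readingWord T) = T := by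
  induction T with
  | nil => rfl
  | cons R T ih =>
    have := ih h.2.2.2
    unfold wordTableau at this ⊢
    rw [readingWord, List.foldl_append, this, h.foldl_eq]

/-! ### Row insertion preserves tableaux -/

theorem Above.rowInsert_left {R S : List ℕ} (h : Above R S) (x : ℕ) :
    Above (rowInsert R x).1 S := by
  induction h with
  | nil => exact .nil _
  | cons hab h ih =>
    unfold rowInsert
    split_ifs with hx
    · exact .cons (hx.trans hab) h
    · exact .cons hab ih

/-- The bumped letter y was smaller than the entry below it, if there was one, so in the lower row
it lands weakly to the left of the column it came from. The entries above it there are smaller than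
y. -/
theorem Above.rowInsert_rowInsert {R S : List ℕ} (h : Above R S) {x y : ℕ}
    (hy : (rowInsert R x).2 = some y) : Above (rowInsert R x).1 (rowInsert S y).1 := by
  induction h with
  | nil R =>
    cases R with
    | nil => simp [rowInsert] at hy
    | cons a R =>
      unfold rowInsert at hy ⊢
      split_ifs at hy ⊢ with hx
      · simp only [Option.some.injEq] at hy
        subst hy
        exact .cons hx (.nil _)
      · exact .cons (by have := (lt_and_mem_of_rowInsert hy).1; omega) (.nil _)
  | @cons a b R S hab h ih =>
    by_cases hx : x < a
    · simp only [rowInsert, hx, if_true, Option.some.injEq] at hy ⊢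
      subst hy
      simp only [hab, if_true]
      exact .cons hx h
    · simp only [rowInsert, hx, if_false] at hy ⊢
      have hay : a < y := by have := (lt_and_mem_of_rowInsert hy).1; omega
      split_ifs with hyb
      · exact .cons hay (h.rowInsert_left x)
      · exact .cons hab (ih hy)

theorem headD_tableauInsert (T : List (List ℕ)) (x : ℕ) :
    (tableauInsert T x).headD [] = (rowInsert (T.headD []) x).1 := by
  cases T with
  | nil => rfl
  | cons R T => rcases e : rowInsert R x with ⟨r', _ | y⟩ <;> simp [tableauInsert, e]

theorem rowInsert_ne_nil (R : List ℕ) (x : ℕ) : (rowInsert R x).1 ≠ [] := by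
  cases R with
  | nil => simp [rowInsert]
  | cons a R => unfold rowInsert; split_ifs <;> simp

theorem IsTableau.tableauInsert {T : List (List ℕ)} (h : IsTableau T) {x : ℕ}
    (hn : (x :: T.flatten).Nodup) : IsTableau (tableauInsert T x) := by
  induction T generalizing x with
  | nil => simpa [PatternKnuth.tableauInsert, IsTableau] using Above.nil _
  | cons R T ih =>
    obtain ⟨-, h2, h3, h4⟩ := h
    have hp := tableauInsert_pairwise (T := R :: T) (x := x)
      (fun Q hQ => by
        rcases List.mem_cons.1 hQ with rfl | hQ
        · exact h2
        · exact h4.pairwise Q hQ) hn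
    have hne := rowInsert_ne_nil R x
    have h5 := rowInsert_perm R x
    have h6 := h3.rowInsert_left x
    rcases e : rowInsert R x with ⟨r', _ | y⟩
    · simp only [e, PatternKnuth.tableauInsert] at hp hne h6 ⊢
      exact ⟨hne, hp r' (by simp), h6, h4⟩
    · have h7 := h3.rowInsert_rowInsert (x := x) (y := y) (by rw [e])
      simp only [e, PatternKnuth.tableauInsert] at hp hne h5 h7 ⊢
      refine ⟨hne, hp r' (by simp), by rwa [headD_tableauInsert], ih h4 ?_⟩
      have h8 : ((y :: r') ++ T.flatten).Nodup :=
        (h5.append_right T.flatten).nodup_iff.2 (by simpa using hn)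
      exact h8.sublist (by simp)

theorem IsTableau.foldl {T : List (List ℕ)} (h : IsTableau T) {W : List ℕ}
    (hn : (W ++ T.flatten).Nodup) : IsTableau (W.foldl PatternKnuth.tableauInsert T) := by
  induction W generalizing T with
  | nil => exact h
  | cons x W ih =>
    refine ih (h.tableauInsert (hn.sublist (by simp))) ?_
    exact (((tableauInsert_perm T x).append_left W).trans List.perm_middle).nodup_iff.2 hn

theorem isTableau_wordTableau {w : List ℕ} (hw : w.Nodup) : IsTableau (wordTableau w) :=
  IsTableau.foldl (T := []) trivial (by simpa using hw)

theorem wordTableau_perm (w : List ℕ) : (wordTableau w).flatten.Perm w := by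
  simpa [wordTableau] using foldl_tableauInsert_perm w []

/-- Insertion depends only on comparisons of letters. Knuth equivalence gives a short proof: relabel
the equivalence of w with its reading word and insert. -/
theorem wordTableau_map {w : List ℕ} (hw : w.Nodup) {f : ℕ → ℕ}
    (hf : StrictMonoOn f {v | v ∈ w}) :
    wordTableau (w.map f) = (wordTableau w).map (List.map f) := by
  have h1 : IsTableau ((wordTableau w).map (List.map f)) := by
    refine (isTableau_wordTableau hw).map (hf.mono fun v hv => ?_)
    exact (wordTableau_perm w).mem_iff.1 hv
  have h2 := (knuthEquiv_readingWord_wordTableau hw).map hf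
  rw [← readingWord_map] at h2
  have h3 : (w.map f).Nodup := hw.map_on fun a ha b hb hab => hf.injOn ha hb hab
  rw [h2.wordTableau_eq h3, h1.wordTableau_readingWord]

/-- No letter of an increasing word v is bumped by a later one, so all of v survives in the row. If
the row is no longer than v, nothing else survives, and R has been bumped out from left to right. -/
theorem length_le_rowPass {R v : List ℕ} (hR : R.Pairwise (· < ·)) (hv : v.Pairwise (· < ·))
    (hd : ∀ x ∈ v, x ∉ R) : v.length ≤ (rowPass R v).1.length ∧
      ((rowPass R v).1.length = v.length → rowPass R v = (v, R)) := by
  induction v generalizing R with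
  | nil => simp [rowPass]
  | cons x v ih =>
    rw [List.pairwise_cons] at hv
    have hxv : ∀ A : List ℕ, (∀ a ∈ A, a < x) → ∀ a ∈ A ++ [x], ∀ y ∈ v, a < y := by
      intro A hA a ha y hy
      have := hv.1 y hy
      rcases List.mem_append.1 ha with ha | ha
      · exact (hA a ha).trans this
      · simp at ha; omega
    rcases rowInsert_cases hR (hd x (by simp)) with ⟨e, hA⟩ | ⟨A, y, B, rfl, e, hxy, hA⟩
    · have h1 := rowPass_prefix (R := []) (hxv R hA)
      rw [rowPass_of_lt (l := []) hv.2 (by simp)] at h1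
      simp only [List.append_assoc, List.append_nil, List.singleton_append,
        List.drop_nil, List.take_nil] at h1
      simp only [rowPass, e, h1, List.length_append, List.length_cons, Option.toList_none,
        List.nil_append]
      refine ⟨by omega, fun h2 => ?_⟩
      have : R = [] := List.length_eq_zero_iff.1 (by omega)
      simp [this]
    · have h1 := rowPass_prefix (R := B) (hxv A hA)
      simp only [List.append_assoc, List.singleton_append] at h1
      rw [List.pairwise_append, List.pairwise_cons] at hR
      obtain ⟨h2, h3⟩ := ih (R := B) hR.2.1.2 hv.2 fun z hz hzB => hd z (by simp [hz]) (by simp [hzB])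
      simp only [rowPass, e, h1, List.length_append, List.length_cons, Option.toList_some,
        List.singleton_append]
      refine ⟨by omega, fun h4 => ?_⟩
      have h6 : A = [] := List.length_eq_zero_iff.1 (by omega)
      subst h6
      simp [h3 (by simpa using h4)]

/-- An increasing suffix of a word is no longer than the first row of its tableau, and if the
lengths agree it is the first row and the rest of the word determines the other rows. -/
theorem wordTableau_append {u v : List ℕ} (hn : (u ++ v).Nodup) (hv : v.Pairwise (· < ·))
    (hne : v ≠ []) {R : List ℕ} {T : List (List ℕ)} (h : wordTableau (u ++ v) = R :: T) :
    v.length ≤ R.length ∧ (R.length = v.length → R = v ∧ T = wordTableau u) := by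
  rw [List.nodup_append] at hn
  have hu := isTableau_wordTableau hn.1
  have hm : ∀ a, a ∈ (wordTableau u).flatten ↔ a ∈ u := fun a => (wordTableau_perm u).mem_iff
  have e : wordTableau (u ++ v) = v.foldl tableauInsert (wordTableau u) := by
    simp [wordTableau, List.foldl_append]
  rw [e] at h
  clear e
  revert hu hm h
  generalize wordTableau u = U
  intro h hu hm
  cases U with
  | nil =>
    rw [foldl_tableauInsert_nil hne, rowPass_of_lt (l := []) hv (by simp)] at h
    simp at h
    simp [h]
  | cons Q U =>
    rw [foldl_tableauInsert_cons] at h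
    have hd : ∀ x ∈ v, x ∉ Q := fun x hx hxQ => hn.2.2 x ((hm x).1 (by simp [hxQ])) x hx rfl
    obtain ⟨h1, h2⟩ := length_le_rowPass hu.2.1 hv hd
    simp only [List.cons.injEq] at h
    refine ⟨by rwa [← h.1], fun h3 => ?_⟩
    have h6 := h2 (by rw [h.1, h3])
    rw [← h.1, ← h.2, h6]
    exact ⟨rfl, hu.foldl_eq⟩


/-! ### Containment of a Knuth class in a word -/

/-- The word `w` contains, up to an order-preserving relabelling, a word Knuth equivalent to `c`. -/
def ContainsClass (c w : List ℕ) : Prop :=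
  ∃ l : List ℕ, l.Sublist w ∧ ∃ f : ℕ → ℕ, StrictMonoOn f {v | v ∈ l} ∧ KnuthEquiv (l.map f) c

/-- Containment of the Knuth class of `c` is invariant under Knuth equivalence. -/
def ContainmentInvariant (c : List ℕ) : Prop :=
  ∀ w w' : List ℕ, w.Nodup → KnuthEquiv w w' → ContainsClass c w → ContainsClass c w'

theorem ContainsClass.reverse {c w : List ℕ} (h : ContainsClass c w) :
    ContainsClass c.reverse w.reverse := by
  obtain ⟨l, hl, f, hf, hk⟩ := h
  refine ⟨l.reverse, hl.reverse, f, by simpa using hf, ?_⟩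
  rw [List.map_reverse]
  exact hk.reverse

theorem ContainmentInvariant.reverse {c : List ℕ} (h : ContainmentInvariant c) :
    ContainmentInvariant c.reverse := by
  intro w w' hw hk hc
  have := (h _ _ (List.nodup_reverse.2 hw) hk.reverse (by simpa using hc.reverse)).reverse
  simpa using this

theorem ContainmentInvariant.congr {c c' : List ℕ} (h : ContainmentInvariant c)
    (hc : KnuthEquiv c c') : ContainmentInvariant c' := by
  rintro w w' hw hk ⟨l, hl, f, hf, hlc⟩
  obtain ⟨l', hl', f', hf', hlc'⟩ := h w w' hw hk ⟨l, hl, f, hf, hlc.trans hc.symm⟩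
  exact ⟨l', hl', f', hf', hlc'.trans hc⟩

/-- Doubling the labels leaves the order unchanged and makes the odd numbers available as new
letters. -/
theorem containsClass_map_two_mul_iff {c w : List ℕ} :
    ContainsClass (c.map (2 * ·)) w ↔ ContainsClass c w := by
  constructor
  · rintro ⟨l, hl, f, hf, hk⟩
    have heven : ∀ v ∈ l.map f, v % 2 = 0 := by
      intro v hv
      have := hk.perm.mem_iff.1 hv
      simp only [List.mem_map] at this
      obtain ⟨a, -, rfl⟩ := this
      omega
    have hmono : StrictMonoOn (· / 2) {v | v ∈ l.map f} := by
      intro a ha b hb hab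
      have := heven a ha
      have := heven b hb
      simp only
      omega
    refine ⟨l, hl, (· / 2) ∘ f, ?_, ?_⟩
    · intro a ha b hb hab
      exact hmono (List.mem_map_of_mem ha) (List.mem_map_of_mem hb) (hf ha hb hab)
    · have := hk.map hmono
      simpa [Function.comp_def] using this
  · rintro ⟨l, hl, f, hf, hk⟩
    refine ⟨l, hl, (2 * ·) ∘ f, fun a ha b hb hab => ?_, ?_⟩
    · have := hf ha hb hab
      simp only [Function.comp]
      omega
    · have := hk.map (f := (2 * ·)) (fun a _ b _ hab => by simp only; omega)
      simpa using this

theorem ContainmentInvariant.map_two_mul {c : List ℕ} (h : ContainmentInvariant c) :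
    ContainmentInvariant (c.map (2 * ·)) := fun w w' hw hk hc =>
  containsClass_map_two_mul_iff.2 (h w w' hw hk (containsClass_map_two_mul_iff.1 hc))

/-! ### Relative order of two letters -/

theorem pair_sublist_iff {w : List ℕ} (hw : w.Nodup) {a b : ℕ} :
    [a, b].Sublist w ↔ w.filter (fun v => v = a ∨ v = b) = [a, b] := by
  constructor
  · intro h
    have h1 := h.filter (fun v => decide (v = a ∨ v = b))
    simp only [List.filter_cons, true_or, or_true, decide_true, if_true, List.filter_nil] at h1
    refine (h1.eq_of_length_le ?_).symm
    have h2 : (w.filter (fun v => decide (v = a ∨ v = b))).Subperm [a, b] := by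
      refine List.subperm_of_subset (hw.filter _) fun v hv => ?_
      simpa using (List.mem_filter.1 hv).2
    exact h2.length_le
  · intro h
    rw [← h]
    exact List.filter_sublist

theorem pair_sublist_asymm {w : List ℕ} (hw : w.Nodup) {a b : ℕ} (hab : a ≠ b)
    (h : [a, b].Sublist w) : ¬ [b, a].Sublist w := by
  intro h'
  rw [pair_sublist_iff hw] at h
  rw [pair_sublist_iff hw] at h'
  have : w.filter (fun v => decide (v = a ∨ v = b)) = w.filter (fun v => v = b ∨ v = a) := by
    simp only [or_comm]
  rw [this, h'] at h
  simp only [List.cons.injEq] at h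
  exact hab h.1.symm

/-- Knuth equivalence does not change the relative order of two letters between which there is no
other letter. -/
theorem KnuthEquiv.pair_sublist_iff {w w' : List ℕ} (h : KnuthEquiv w w') (hw : w.Nodup) {a b : ℕ}
    (hgap : ∀ v ∈ w, v ≤ min a b ∨ max a b ≤ v) :
    [a, b].Sublist w ↔ [a, b].Sublist w' := by
  refine ((h.iff_of_step (p := fun w₁ => (∀ v ∈ w₁, v ≤ min a b ∨ max a b ≤ v) ∧
    ([a, b].Sublist w ↔ [a, b].Sublist w₁)) ?_ hw).1 ⟨hgap, Iff.rfl⟩).2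
  intro w₁ w₂ hw₁ hs
  have h1 : (∀ v ∈ w₁, v ≤ min a b ∨ max a b ≤ v) ↔ ∀ v ∈ w₂, v ≤ min a b ∨ max a b ≤ v :=
    ⟨fun h v hv => h v (hs.perm.mem_iff.2 hv), fun h v hv => h v (hs.perm.mem_iff.1 hv)⟩
  rw [← h1]
  refine and_congr_right fun hg => ?_
  rw [PatternKnuth.pair_sublist_iff hw₁,
    PatternKnuth.pair_sublist_iff (hs.perm.nodup_iff.1 hw₁)]
  suffices w₁.filter (fun v => v = a ∨ v = b) = w₂.filter (fun v => v = a ∨ v = b) by rw [this]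
  obtain ⟨u, v, l, m, hlm, rfl, rfl⟩ := hs
  rw [List.filter_append, List.filter_append, List.filter_append, List.filter_append]
  congr 2
  cases hlm with
  -- The exchanged letters x and z have y strictly between them, so the gap hypothesis prevents them
  -- from being the pair a, b; the filtered words therefore agree.
  | @left x y z hxy hyz =>
    have hy := hg y (by simp)
    by_cases hx : x = a ∨ x = b <;> by_cases hz : z = a ∨ z = b <;>
      simp only [List.filter_cons, hx, hz, decide_true, decide_false, if_true] <;> simp
    rcases hx with rfl | rfl <;> rcases hz with rfl | rfl <;> simp at hy hxy <;> omega
  | @right x y z hxy hyz =>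
    have hy := hg y (by simp)
    by_cases hx : x = a ∨ x = b <;> by_cases hz : z = a ∨ z = b <;>
      simp only [List.filter_cons, hx, hz, decide_true, decide_false, if_true] <;> simp
    rcases hx with rfl | rfl <;> rcases hz with rfl | rfl <;> simp at hy hxy <;> omega

/-- An order-preserving relabelling preserves ranks. This identifies the image of a letter from the
number of letters below it. -/
theorem countP_le_of_map_perm {l m : List ℕ} {f : ℕ → ℕ} (hf : StrictMonoOn f {v | v ∈ l})
    (h : (l.map f).Perm m) {a : ℕ} (ha : a ∈ l) :
    m.countP (· ≤ f a) = l.countP (· ≤ a) := by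
  rw [← h.countP_eq, List.countP_map]
  refine List.countP_congr fun x hx => ?_
  simpa using hf.le_iff_le hx ha

/-- A Knuth equivalence with the reading word of D amounts to an equality of the relabelled
insertion tableau with D, whose rows can be compared one by one. -/
theorem ContainsClass.exists_of_readingWord {D : List (List ℕ)} (hD : IsTableau D)
    (hn : D.flatten.Nodup) {w : List ℕ} (hw : w.Nodup) (h : ContainsClass (readingWord D) w) :
    ∃ l : List ℕ, l.Sublist w ∧ ∃ f : ℕ → ℕ, StrictMonoOn f {v | v ∈ l} ∧
      KnuthEquiv (l.map f) (readingWord D) ∧ (wordTableau l).map (List.map f) = D := by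
  obtain ⟨l, hl, f, hf, hk⟩ := h
  refine ⟨l, hl, f, hf, hk, ?_⟩
  have hk' := hk.symm.wordTableau_eq ((readingWord_perm D).nodup_iff.2 hn)
  rw [← wordTableau_map (hw.sublist hl) hf, ← hk', hD.wordTableau_readingWord]

theorem wordTableau_of_pairwise {w : List ℕ} (hw : w.Pairwise (· < ·)) (hne : w ≠ []) :
    wordTableau w = [w] := by
  rw [wordTableau, foldl_tableauInsert_nil hne, rowPass_of_lt (l := []) hw (by simp)]
  simp


/-! ### Tableaux whose Knuth class is containment invariant -/

/-- The first row pass for the word of `not_containmentInvariant_of_shift` with its extra letter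
removed: c pushes out e, and later z d pushes out p b, so the word is equivalent to the reading word
of the two rows. -/
theorem rowPass_shuffle {e b c d d₂ : List ℕ} {p z : ℕ}
    (he : e.Pairwise (· < ·)) (hr : (c ++ z :: (d ++ d₂)).Pairwise (· < ·))
    (hs : (p :: b).Pairwise (· < ·)) (hzp : z < p) (hec : e.length ≤ c.length)
    (hce : ∀ i, i < e.length → c.getD i 0 < e.getD i 0) (hdl : d.length = b.length)
    (hdb : ∀ i, i < d.length → d.getD i 0 < b.getD i 0) :
    rowPass [] (e ++ c ++ (p :: b) ++ (z :: d) ++ d₂) = (c ++ z :: (d ++ d₂), e ++ (p :: b)) := by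
  rw [List.pairwise_append, List.pairwise_cons, List.pairwise_append] at hr
  obtain ⟨hc, ⟨hz, hd, hd₂, hdd⟩, hcz⟩ := hr
  have hcp : ∀ x ∈ c, ∀ y ∈ p :: b, x < y := by
    intro x hx y hy
    have h1 := hcz x hx z (by simp)
    rcases List.mem_cons.1 hy with rfl | hy
    · omega
    · have := (List.pairwise_cons.1 hs).1 y hy
      omega
  have e1 : rowPass [] e = (e, []) := by simpa using rowPass_of_lt (l := []) he (by simp)
  have e2 : rowPass e c = (c, e) := by
    rw [rowPass_of_lt hc fun i _ hi => hce i hi]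
    simp [List.drop_eq_nil_of_le hec, List.take_of_length_le hec]
  have e3 : rowPass c (p :: b) = (c ++ p :: b, []) := rowPass_of_gt hs hcp
  have e4 : rowPass (c ++ p :: b) (z :: d) = (c ++ z :: d, p :: b) := by
    rw [rowPass_prefix fun x hx y hy => hcz x hx y (by
        rcases List.mem_cons.1 hy with rfl | hy
        · simp
        · simp [hy])]
    rw [rowPass_of_lt]
    · simp [hdl, List.take_of_length_le]
    · exact List.pairwise_cons.2 ⟨fun y hy => hz y (by simp [hy]), hd⟩
    · rintro (_ | i) hi hj
      · simpa using hzp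
      · simpa using hdb i (by simpa using hi)
  have e5 : rowPass (c ++ z :: d) d₂ = (c ++ z :: (d ++ d₂), []) := by
    rw [rowPass_of_gt hd₂]
    · simp
    · intro x hx y hy
      rcases List.mem_append.1 hx with hx | hx
      · exact hcz x hx y (by simp [hy])
      · rcases List.mem_cons.1 hx with rfl | hx
        · exact hz y (by simp [hy])
        · exact hdd x hx y hy
  simp only [rowPass_append, e1, e2, e3, e4, e5, List.nil_append, List.append_nil]

/-- The same pass with the extra letter y before p. Now z bumps y instead of p, so p stays in the
first row and y takes its place in the emitted word. -/
theorem rowPass_shuffle_insert {e b c d d₂ : List ℕ} {p y z : ℕ}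
    (he : e.Pairwise (· < ·)) (hr : (c ++ z :: p :: (d ++ d₂)).Pairwise (· < ·))
    (hs : (p :: b).Pairwise (· < ·)) (hzy : z < y) (hyp : y < p) (hec : e.length ≤ c.length)
    (hce : ∀ i, i < e.length → c.getD i 0 < e.getD i 0) (hdl : d.length = b.length)
    (hdb : ∀ i, i < d.length → d.getD i 0 < b.getD i 0) :
    rowPass [] (e ++ c ++ (y :: p :: b) ++ (z :: d) ++ d₂) =
      (c ++ z :: p :: (d ++ d₂), e ++ (y :: b)) := by
  have hr' := hr
  rw [List.pairwise_append, List.pairwise_cons, List.pairwise_cons, List.pairwise_append] at hr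
  obtain ⟨hc, ⟨hz, hp, hd, hd₂, hdd⟩, hcz⟩ := hr
  have hcy : ∀ x ∈ c, ∀ v ∈ y :: p :: b, x < v := by
    intro x hx v hv
    have h1 := hcz x hx z (by simp)
    simp only [List.mem_cons] at hv
    rcases hv with rfl | rfl | hv
    · omega
    · omega
    · have := (List.pairwise_cons.1 hs).1 v hv
      omega
  have e1 : rowPass [] e = (e, []) := by simpa using rowPass_of_lt (l := []) he (by simp)
  have e2 : rowPass e c = (c, e) := by
    rw [rowPass_of_lt hc fun i _ hi => hce i hi]
    simp [List.drop_eq_nil_of_le hec, List.take_of_length_le hec]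
  have e3 : rowPass c (y :: p :: b) = (c ++ y :: p :: b, []) := by
    refine rowPass_of_gt (List.pairwise_cons.2 ⟨fun v hv => ?_, hs⟩) hcy
    rcases List.mem_cons.1 hv with rfl | hv
    · exact hyp
    · exact hyp.trans ((List.pairwise_cons.1 hs).1 v hv)
  have e4 : rowPass (c ++ y :: p :: b) (z :: d) = (c ++ z :: p :: d, y :: b) := by
    have h1 : ∀ x ∈ c, x < z := fun x hx => hcz x hx z (by simp)
    have h2 : rowPass ((c ++ [z, p]) ++ b) d = ((c ++ [z, p]) ++ d, b) := by
      rw [rowPass_prefix]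
      · rw [rowPass_of_lt hd fun i hi _ => hdb i hi]
        simp [hdl, List.take_of_length_le]
      · intro x hx v hv
        simp only [List.mem_append, List.mem_cons, List.not_mem_nil, or_false] at hx
        rcases hx with hx | rfl | rfl
        · exact hcz x hx v (by simp [hv])
        · exact hz v (by simp [hv])
        · exact hp v (by simp [hv])
    simp only [List.append_assoc, List.cons_append, List.nil_append] at h2
    simp [rowPass, rowInsert_append h1, rowInsert, hzy, h2]
  have e5 : rowPass (c ++ z :: p :: d) d₂ = (c ++ z :: p :: (d ++ d₂), []) := by
    rw [rowPass_of_gt hd₂]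
    · simp
    · have : c ++ z :: p :: (d ++ d₂) = (c ++ z :: p :: d) ++ d₂ := by simp
      rw [this, List.pairwise_append] at hr'
      exact hr'.2.2
  simp only [rowPass_append, e1, e2, e3, e4, e5, List.nil_append, List.append_nil]

/-- The first row of the insertion tableau of the reading word of `q :: rest` followed by a word
that is not empty. -/
theorem wordTableau_readingWord_append {T : List (List ℕ)} (hT : IsTableau T) {W : List ℕ}
    (hW : W ≠ []) :
    wordTableau (readingWord T ++ W) =
      (rowPass (T.headD []) W).1 :: (rowPass (T.headD []) W).2.foldl tableauInsert T.tail := by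
  have := hT.wordTableau_readingWord
  unfold wordTableau at this ⊢
  rw [List.foldl_append, this]
  cases T with
  | nil => simp [foldl_tableauInsert_nil hW]
  | cons R T => simp [foldl_tableauInsert_cons]

/-- Replacing `x` by a smaller letter `y` in the increasing word `a ++ x :: p :: b`, omitting `p`
and starting with `x`, pushes the entry in the column of `p` above `p`. -/
theorem exists_rowPass_eq {a b q : List ℕ} {x y p : ℕ}
    (hs : (a ++ x :: p :: b).Pairwise (· < ·)) (hq : q.Pairwise (· < ·))
    (hsq : Above (a ++ x :: p :: b) q) (hay : ∀ v ∈ a, v < y) (hyx : y < x) (hxq : x ∉ q) :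
    ∃ ρ, (rowPass q (x :: (a ++ y :: b))).1 = a ++ y :: ρ ∧ ∀ v ∈ ρ, p < v := by
  set s := a ++ x :: p :: b with hs_def
  have hsg : ∀ i < a.length, s.getD i 0 = a.getD i 0 := fun i hi => by
    rw [hs_def, List.getD_append _ _ _ _ hi]
  have hsx : s.getD a.length 0 = x := by
    rw [hs_def, List.getD_append_right _ _ _ _ le_rfl]; simp
  have hsp : ∀ i < s.length, a.length + 1 ≤ i → p ≤ s.getD i 0 := by
    intro i hi hai
    rw [hs_def, List.getD_append_right _ _ _ _ (by omega)]
    obtain ⟨j, rfl⟩ : ∃ j, i = a.length + 1 + j := ⟨i - (a.length + 1), by omega⟩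
    have h1 : a.length + 1 + j - a.length = j + 1 := by omega
    rw [h1]
    rw [List.pairwise_append, List.pairwise_cons, List.pairwise_cons] at hs
    rcases j with _ | j
    · simp
    · have hj : j < b.length := by simp [hs_def] at hi; omega
      have : (x :: p :: b).getD (j + 1 + 1) 0 = b[j] := by simp [hj]
      rw [this]
      exact (hs.2.1.2.1 _ (List.getElem_mem hj)).le
  have hax : ∀ v ∈ a, v < x := fun v hv => (hay v hv).trans hyx
  have hql := hsq.length_le
  -- As q stands below s, its entry in column |a|, if any, exceeds x, so x lands in a column of
  -- index at most |a|. The entries further right are unchanged and exceed p.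
  have key : ∀ i < (rowInsert q x).1.length,
      (i < a.length → a.getD i 0 < (rowInsert q x).1.getD i 0) ∧
      (i = a.length → y < (rowInsert q x).1.getD i 0) ∧
      (a.length + 1 ≤ i → p < (rowInsert q x).1.getD i 0) := by
    have hqi : ∀ i < q.length, (i < a.length → a.getD i 0 < q.getD i 0) ∧
      (i = a.length → y < q.getD i 0) ∧ (a.length + 1 ≤ i → p < q.getD i 0) := by
      intro i hi
      have h1 := hsq.getD_lt i hi
      refine ⟨fun h => ?_, fun h => ?_, fun h => ?_⟩
      · rwa [hsg i h] at h1
      · subst h; rw [hsx] at h1; omega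
      · exact (hsp i (by omega) h).trans_lt h1
    have hxi : ∀ i ≤ a.length, (i < a.length → a.getD i 0 < x) ∧ (i = a.length → y < x) ∧
        (a.length + 1 ≤ i → p < x) := by
      intro i hi
      refine ⟨fun h => ?_, fun _ => hyx, fun h => by omega⟩
      rw [List.getD_eq_getElem _ _ h]
      exact hax _ (List.getElem_mem h)
    rcases rowInsert_cases hq hxq with ⟨e, hv⟩ | ⟨A, w, B, rfl, e, hxw, hv⟩
    · have hqa : q.length ≤ a.length := by
        by_contra! h
        have h1 := hsq.getD_lt _ h
        rw [hsx, List.getD_eq_getElem _ _ h] at h1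
        have := hv _ (List.getElem_mem h)
        omega
      rw [e]
      intro i hi
      simp only [List.length_append, List.length_singleton] at hi
      by_cases hiq : i < q.length
      · rw [List.getD_append _ _ _ _ hiq]
        exact hqi i hiq
      · have : i = q.length := by omega
        subst this
        rw [List.getD_append_right _ _ _ _ le_rfl]
        simpa using hxi _ hqa
    · have hAa : A.length ≤ a.length := by
        by_contra! h
        have h1 := hsq.getD_lt a.length (by simp; omega)
        rw [hsx, List.getD_append _ _ _ _ h, List.getD_eq_getElem _ _ h] at h1
        have := hv _ (List.getElem_mem h)
        omega
      rw [e]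
      intro i hi
      simp only [List.length_append, List.length_cons] at hi
      rcases lt_trichotomy i A.length with h | h | h
      · have := hqi i (by simp; omega)
        rw [List.getD_append _ _ _ _ h] at this ⊢
        exact this
      · subst h
        rw [List.getD_append_right _ _ _ _ le_rfl]
        simpa using hxi _ hAa
      · have := hqi i (by simp; omega)
        rw [List.getD_append_right _ _ _ _ (by omega)] at this ⊢
        obtain ⟨j, rfl⟩ : ∃ j, i = A.length + (j + 1) := ⟨i - A.length - 1, by omega⟩
        simpa using this
  have hsy : (a ++ [y]).Pairwise (· < ·) := by
    rw [List.pairwise_append] at hs ⊢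
    exact ⟨hs.1, by simp, by simpa using hay⟩
  have hb : b.Pairwise (· < ·) ∧ ∀ v ∈ b, p < v := by
    rw [List.pairwise_append, List.pairwise_cons, List.pairwise_cons] at hs
    exact ⟨hs.2.1.2.2, hs.2.1.2.1⟩
  have hpx : x < p := by
    rw [List.pairwise_append, List.pairwise_cons, List.pairwise_cons] at hs
    exact hs.2.1.1 p (by simp)
  have e1 := rowPass_of_lt (c := a ++ [y]) (l := (rowInsert q x).1) hsy (by
    intro i hi hj
    obtain ⟨k1, k2, -⟩ := key i hj
    simp only [List.length_append, List.length_singleton] at hi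
    by_cases h : i < a.length
    · rw [List.getD_append _ _ _ _ h]
      exact k1 h
    · have : i = a.length := by omega
      subst this
      rw [List.getD_append_right _ _ _ _ le_rfl]
      simpa using k2 rfl)
  set D := (rowInsert q x).1.drop (a ++ [y]).length with hD
  have e2 : rowPass ((a ++ [y]) ++ D) b = ((a ++ [y]) ++ (rowPass D b).1, (rowPass D b).2) := by
    refine rowPass_prefix fun v hv w hw => ?_
    have := hb.2 w hw
    simp only [List.mem_append, List.mem_singleton] at hv
    rcases hv with hv | rfl
    · have := hay v hv; omega
    · omega
  refine ⟨(rowPass D b).1, ?_, ?_⟩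
  · have : x :: (a ++ y :: b) = [x] ++ ((a ++ [y]) ++ b) := by simp
    rw [this, rowPass_append, rowPass_append]
    simp only [rowPass, e1, e2]
    simp
  · intro v hv
    have h1 := (rowPass_perm D b).mem_iff (a := v)
    simp only [List.mem_append, hv, or_true, true_iff] at h1
    rcases h1 with h | h
    · exact hb.2 v h
    · obtain ⟨j, hj, rfl⟩ := List.mem_iff_getElem.1 h
      have hj' := hj
      rw [hD, List.length_drop, List.length_append, List.length_singleton] at hj'
      have h2 := (key (a.length + 1 + j) (by omega)).2.2 (by omega)
      rw [List.getD_eq_getElem _ _ (by omega)] at h2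
      simpa [hD] using h2


/-! ### Ranks of letters, and words violating containment invariance -/

theorem countP_le_lt_countP_le {u : List ℕ} {p q : ℕ} (hpq : p < q) (hq : q ∈ u) :
    u.countP (· ≤ p) < u.countP (· ≤ q) := by
  have h := List.perm_cons_erase hq
  rw [h.countP_eq, h.countP_eq, List.countP_cons, List.countP_cons]
  have h1 : (u.erase q).countP (· ≤ p) ≤ (u.erase q).countP (· ≤ q) :=
    List.countP_mono_left fun x _ hx => by simp at hx ⊢; omega
  simp [hpq.not_ge]
  omega

theorem countP_le_of_forall_le {u : List ℕ} {p : ℕ} (h : ∀ v ∈ u, v ≤ p) :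
    u.countP (· ≤ p) = u.length := by
  simpa [List.countP_eq_length] using h

theorem countP_le_of_forall_lt {u : List ℕ} {p : ℕ} (h : ∀ v ∈ u, p < v) :
    u.countP (· ≤ p) = 0 := by
  simpa [List.countP_eq_zero] using h

theorem IsTableau.lt_of_mem_flatten {a : ℕ} {R : List ℕ} {T : List (List ℕ)}
    (h : IsTableau ((a :: R) :: T)) : ∀ v ∈ T.flatten, a < v := by
  induction T generalizing a R with
  | nil => simp
  | cons S T ih =>
    obtain ⟨-, -, h1, h2⟩ := h
    cases S with
    | nil => exact absurd rfl h2.1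
    | cons b S =>
      have hab : a < b := by
        cases h1 with
        | cons hab _ => exact hab
      intro v hv
      simp only [List.flatten_cons, List.mem_append, List.mem_cons] at hv
      rcases hv with (rfl | hv) | hv
      · exact hab
      · exact hab.trans ((List.pairwise_cons.1 h2.2.1).1 v hv)
      · exact hab.trans (ih h2 v hv)

/-- Let u be the reading word of the lower rows and let y be a new letter just below x. The word u ·
a x · c · y p b · z d · d₂ contains the class: delete y. It is equivalent to u · x a y b · c z p d
d₂. The last block there is increasing and has one letter more than the first row of the tableau, so
a subsequence in the class must lose its letter in that block. The second row is then a y ρ with all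
of ρ above p, and the letter relabelled to p has too large a rank. -/
theorem not_containmentInvariant_of_shift {a b c d d₂ : List ℕ} {x p z : ℕ}
    {rest : List (List ℕ)}
    (hD : IsTableau ((c ++ z :: (d ++ d₂)) :: (a ++ x :: p :: b) :: rest))
    (hn : ((c ++ z :: (d ++ d₂)) :: (a ++ x :: p :: b) :: rest).flatten.Nodup)
    (heven : ∀ v ∈ ((c ++ z :: (d ++ d₂)) :: (a ++ x :: p :: b) :: rest).flatten, v % 2 = 0)
    (hzx : z < x) (hpd : ∀ v ∈ d ++ d₂, p < v) (hac : a.length + 1 ≤ c.length)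
    (hdl : d.length = b.length) (hdb : ∀ i, i < d.length → d.getD i 0 < b.getD i 0) :
    ¬ ContainmentInvariant
      (readingWord ((c ++ z :: (d ++ d₂)) :: (a ++ x :: p :: b) :: rest)) := by
  intro hinv
  have hr := hD.2.1
  have hA := hD.2.2.1
  have hS := hD.2.2.2
  have hs := hS.2.1
  have hsq := hS.2.2.1
  have hrest := hS.2.2.2
  simp only [List.headD_cons] at hA
  have hes : a ++ x :: p :: b = (a ++ [x]) ++ p :: b := by simp
  have hsx := List.pairwise_append.1 hs
  have hx2 := heven x (by simp)
  have hz2 := heven z (by simp)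
  -- As all labels are even, y = x - 1 is a new letter, still above z and above all of a.
  obtain ⟨y, rfl⟩ : ∃ y, x = y + 1 := ⟨x - 1, by omega⟩
  have hzy : z < y := by omega
  have hay : ∀ v ∈ a, v < y := by
    intro v hv
    have h1 := hsx.2.2 v hv (y + 1) (by simp)
    have h2 := heven v (by simp [hv])
    omega
  have hxp : y + 1 < p := (List.pairwise_cons.1 hsx.2.1).1 p (by simp)
  have hpb : (p :: b).Pairwise (· < ·) := (List.pairwise_cons.1 hsx.2.1).2
  have he : (a ++ [y + 1]).Pairwise (· < ·) := by
    rw [hes, List.pairwise_append] at hs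
    exact hs.1
  have hce : ∀ i, i < (a ++ [y + 1]).length → c.getD i 0 < (a ++ [y + 1]).getD i 0 := by
    intro i hi
    have h1 := hA.getD_lt i (by rw [hes, List.length_append]; omega)
    simp only [List.length_append, List.length_singleton] at hi
    rw [hes, List.getD_append (a ++ [y + 1]) _ _ _ (by simpa using hi),
      List.getD_append c _ _ _ (by omega)] at h1
    exact h1
  have hec : (a ++ [y + 1]).length ≤ c.length := by simpa using hac
  have hr' : (c ++ z :: p :: (d ++ d₂)).Pairwise (· < ·) := by
    rw [List.pairwise_append, List.pairwise_cons] at hr ⊢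
    refine ⟨hr.1, ⟨?_, List.pairwise_cons.2 ⟨hpd, hr.2.1.2⟩⟩, ?_⟩
    · intro v hv
      rcases List.mem_cons.1 hv with rfl | hv
      · omega
      · exact hr.2.1.1 v hv
    · intro v hv w hw
      have h1 := hr.2.2 v hv z (by simp)
      simp only [List.mem_cons] at hw
      rcases hw with rfl | rfl | hw
      · exact h1
      · omega
      · exact hr.2.2 v hv w (by simp [hw])
  have hyD : y ∉ ((c ++ z :: (d ++ d₂)) :: (a ++ (y + 1) :: p :: b) :: rest).flatten := by
    intro h
    have := heven y h
    omega
  have k0 := rowPass_shuffle he hr hpb (by omega) hec hce hdl hdb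
  have k1 := rowPass_shuffle_insert he hr' hpb hzy (by omega) hec hce hdl hdb
  set W₀ := (a ++ [y + 1]) ++ c ++ (p :: b) ++ (z :: d) ++ d₂ with hW₀
  set W₁ := (a ++ [y + 1]) ++ c ++ (y :: p :: b) ++ (z :: d) ++ d₂ with hW₁
  set u := readingWord rest with hu
  have hup : u.Perm rest.flatten := readingWord_perm rest
  have hn1 : (y :: ((c ++ z :: (d ++ d₂)) :: (a ++ (y + 1) :: p :: b) :: rest).flatten).Nodup :=
    List.nodup_cons.2 ⟨hyD, hn⟩
  have hσ : (u ++ W₁).Nodup := by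
    refine (List.Perm.nodup_iff ?_).2 hn1
    refine (hup.append_right _).trans ?_
    rw [hW₁, List.perm_iff_count]
    intro v
    simp only [List.count_append, List.count_cons, List.flatten_cons]
    simp
    omega
  have hW₁n : W₁.Nodup := hσ.sublist (List.sublist_append_right _ _)
  have hW₀₁ : W₀.Sublist W₁ := by
    rw [hW₀, hW₁]
    exact ((List.Sublist.append (List.Sublist.refl _) (List.sublist_cons_self _ _)).append
      (List.Sublist.refl _)).append (List.Sublist.refl _)
  -- Without y the word has the two given rows as its tableau.
  have t0 : KnuthEquiv W₀ ((a ++ (y + 1) :: p :: b) ++ (c ++ z :: (d ++ d₂))) := by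
    have h1 := knuthEquiv_readingWord_wordTableau (hW₁n.sublist hW₀₁)
    have h2 : wordTableau W₀ = [c ++ z :: (d ++ d₂), a ++ (y + 1) :: p :: b] := by
      have h3 := wordTableau_of_pairwise hs (by simp)
      rw [wordTableau] at h3
      rw [wordTableau, foldl_tableauInsert_nil (by simp [hW₀]), k0, ← hes]
      simp only
      rw [h3]
    rw [h2] at h1
    simpa [readingWord] using h1
  -- With y the tableau has three rows: p has moved to the first row, and y has pushed x from the
  -- second row to the third.
  have t1 : KnuthEquiv W₁ (((y + 1) :: (a ++ y :: b)) ++ (c ++ z :: p :: (d ++ d₂))) := by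
    have h1 := knuthEquiv_readingWord_wordTableau hW₁n
    have h2 : wordTableau W₁ = [c ++ z :: p :: (d ++ d₂), a ++ y :: b, [y + 1]] := by
      have h3 : rowPass [] ((a ++ [y + 1]) ++ y :: b) = (a ++ y :: b, [y + 1]) := by
        have e1 : rowPass [] (a ++ [y + 1]) = (a ++ [y + 1], []) := by
          simpa using rowPass_of_lt (l := []) he (by simp)
        have e2 : rowPass (a ++ [y]) b = (a ++ y :: b, []) := by
          rw [rowPass_of_gt (List.pairwise_cons.1 hpb).2]
          · simp
          · intro v hv w hw
            have h4 := (List.pairwise_cons.1 hpb).1 w hw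
            simp only [List.mem_append, List.mem_singleton] at hv
            rcases hv with hv | rfl
            · have := hay v hv; omega
            · omega
        rw [rowPass_append, e1]
        simp [rowPass, rowInsert_append hay, rowInsert, e2]
      rw [wordTableau, foldl_tableauInsert_nil (by simp [hW₁]), k1]
      simp only
      rw [foldl_tableauInsert_nil (by simp), h3]
      simp [tableauInsert]
    rw [h2] at h1
    simpa [readingWord] using h1
  have hcont : ContainsClass
      (readingWord ((c ++ z :: (d ++ d₂)) :: (a ++ (y + 1) :: p :: b) :: rest)) (u ++ W₁) := by
    refine ⟨u ++ W₀, (List.Sublist.refl _).append hW₀₁, id, strictMonoOn_id, ?_⟩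
    simpa [readingWord] using t0.append_left u
  have t2 : KnuthEquiv (u ++ W₁)
      ((u ++ (y + 1) :: (a ++ y :: b)) ++ (c ++ z :: p :: (d ++ d₂))) := by
    rw [List.append_assoc]
    exact t1.append_left u
  have hσ' := t2.perm.nodup_iff.1 hσ
  obtain ⟨l, hl, f, hf, hk, hm⟩ := (hinv _ _ hσ t2 hcont).exists_of_readingWord hD hn hσ'
  have hlen := hk.perm.length_eq
  obtain ⟨l₁, l₂, rfl, hl₁, hl₂⟩ := List.sublist_append_iff.1 hl
  obtain ⟨R, T, hRT, hR, hT⟩ := List.map_eq_cons_iff.1 hm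
  have hl₁l := hl₁.length_le
  have hl₂l := hl₂.length_le
  simp only [readingWord, ← hu, List.length_map, List.length_append, List.length_cons]
    at hlen hl₁l hl₂l
  have hRl := congrArg List.length hR
  simp only [List.length_map, List.length_append, List.length_cons] at hRl
  have hl₂ne : l₂ ≠ [] := by
    rintro rfl
    simp at hlen
    omega
  obtain ⟨w1, w2⟩ := wordTableau_append (hσ'.sublist hl) (hr'.sublist hl₂) hl₂ne hRT
  -- By `wordTableau_append`, l₂ is no longer than the first row, hence shorter than the block it
  -- comes from. Only one letter is missing in all, so l₁ is complete, l₂ is the first row, and l₁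
  -- alone determines the remaining rows.
  have hl₁e : l₁ = u ++ (y + 1) :: (a ++ y :: b) := by
    refine hl₁.eq_of_length ?_
    simp only [List.length_append, List.length_cons]
    omega
  obtain ⟨-, hTe⟩ := w2 (by omega)
  have hxq : y + 1 ∉ rest.headD [] := by
    intro h
    have h1 : y + 1 ∈ rest.flatten := by
      cases rest with
      | nil => simp at h
      | cons q rest => simp at h ⊢; exact Or.inl h
    have h2 : ((a ++ (y + 1) :: p :: b) ++ rest.flatten).Nodup :=
      hn.sublist (List.sublist_append_right _ _)
    exact (List.nodup_append.1 h2).2.2 _ (by simp) _ h1 rfl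
  have hqs : (rest.headD []).Pairwise (· < ·) := by
    cases rest with
    | nil => simp
    | cons q rest => exact hrest.2.1
  obtain ⟨ρ, hρ, hρp⟩ := exists_rowPass_eq hs hqs hsq hay (by omega) hxq
  have hTr := wordTableau_readingWord_append hrest (W := (y + 1) :: (a ++ y :: b)) (by simp)
  rw [← hu, ← hl₁e, ← hTe, hρ] at hTr
  have hTf : (l₁.map f).Perm ((a ++ (y + 1) :: p :: b) :: rest).flatten := by
    rw [← hT, hTe, ← List.map_flatten]
    exact ((wordTableau_perm l₁).map f).symm
  rw [hTr, List.map_cons, List.cons.injEq] at hT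
  have hTa := hT.1
  rw [List.map_append, List.map_cons] at hTa
  have hTb := (List.append_inj hTa (by simp)).2
  simp only [List.cons.injEq] at hTb
  obtain ⟨q, ρ', rfl, hq, -⟩ := List.map_eq_cons_iff.1 hTb.2
  have hpq : p < q := hρp q (by simp)
  have hql : q ∈ l₁ := by
    have h1 := (wordTableau_perm l₁).mem_iff (a := q)
    rw [← hTe, hTr] at h1
    exact h1.1 (by simp)
  -- Compare ranks of q and of its image p. In the target, a, x, p and the letters of the lower rows
  -- up to p are counted. In l₁, a, y, x and the letters of the lower rows and of b up to q are
  -- counted. Since q > p is a letter of the lower rows or of b, the second count is strictly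
  -- larger.
  have hcount := countP_le_of_map_perm (hf.mono fun v hv => by simp at hv ⊢; exact Or.inl hv) hTf hql
  have ca : ∀ m, p ≤ m → a.countP (· ≤ m) = a.length := fun m hm =>
    countP_le_of_forall_le fun v hv => by have := hay v hv; omega
  have cb : b.countP (· ≤ p) = 0 := countP_le_of_forall_lt (List.pairwise_cons.1 hpb).1
  rw [hq, hl₁e, List.flatten_cons] at hcount
  simp only [List.countP_append, List.countP_cons, hup.countP_eq, ca p le_rfl, ca q hpq.le, cb]
    at hcount
  have d1 : y ≤ q := by omega
  have d2 : y + 1 ≤ q := by omega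
  have d3 : y + 1 ≤ p := by omega
  simp [d1, d2, d3, -List.countP_flatten] at hcount
  have hmono : rest.flatten.countP (· ≤ p) ≤ rest.flatten.countP (· ≤ q) :=
    List.countP_mono_left fun x _ hx => by simp at hx ⊢; omega
  rw [hl₁e] at hql
  simp only [List.mem_append, List.mem_cons] at hql
  rcases hql with h | rfl | h | rfl | h
  · have := countP_le_lt_countP_le hpq (hup.mem_iff.1 h)
    omega
  · omega
  · have := hay q h; omega
  · omega
  · have := countP_le_lt_countP_le hpq h
    omega


/-- Let u be the reading word of the lower rows, r and s the first two rows, and y a new letter just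
above z. The word u · s · r · y contains the class: delete y. It is equivalent to u · s · g · c z y
h, since y bumps g. A subsequence with n letters either keeps c z y, and then y takes the rank of x
while standing after z, although x precedes z in the reading word; or it loses a letter of c z y,
and then its first row is too short. -/
theorem not_containmentInvariant_of_lt {c h s₁ : List ℕ} {x z g : ℕ} {rest : List (List ℕ)}
    (hD : IsTableau ((c ++ z :: g :: h) :: (x :: s₁) :: rest))
    (hn : ((c ++ z :: g :: h) :: (x :: s₁) :: rest).flatten.Nodup)
    (heven : ∀ v ∈ ((c ++ z :: g :: h) :: (x :: s₁) :: rest).flatten, v % 2 = 0)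
    (hc : c ≠ []) (hzx : z < x) (hxg : x < g) (hgs : ∀ v ∈ s₁, g < v)
    (hshift : ∀ j < (x :: s₁).length, j + 1 < (c ++ z :: g :: h).length ∧
      (c ++ z :: g :: h).getD (j + 1) 0 < (x :: s₁).getD j 0) :
    ¬ ContainmentInvariant (readingWord ((c ++ z :: g :: h) :: (x :: s₁) :: rest)) := by
  intro hinv
  have hr := hD.2.1
  have hS := hD.2.2.2
  have hrs := List.pairwise_append.1 hr
  have hx2 := heven x (by simp)
  have hz2 := heven z (by simp)
  have hcl : 0 < c.length := List.length_pos_iff.2 hc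
  -- By evenness of the labels, z + 1 is a new letter and still smaller than x.
  obtain ⟨y, hy⟩ : ∃ y, y = z + 1 := ⟨_, rfl⟩
  have hyx : y < x := by omega
  have hcz : ∀ v ∈ c, v < z := fun v hv => hrs.2.2 v hv z (by simp)
  have hgh : ∀ v ∈ h, g < v :=
    (List.pairwise_cons.1 (List.pairwise_cons.1 hrs.2.1).2).1
  have hs₁x : ∀ v ∈ s₁, x < v := fun v hv => hxg.trans (hgs v hv)
  have hrx : ∀ v ∈ rest.flatten, x < v := hS.lt_of_mem_flatten
  have hyD : y ∉ ((c ++ z :: g :: h) :: (x :: s₁) :: rest).flatten := by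
    intro h
    have := heven y h
    omega
  have hr' : (c ++ z :: y :: h).Pairwise (· < ·) := by
    rw [List.pairwise_append, List.pairwise_cons, List.pairwise_cons]
    refine ⟨hrs.1, ⟨?_, ?_, ?_⟩, ?_⟩
    · intro v hv
      rcases List.mem_cons.1 hv with rfl | hv
      · omega
      · have := hgh v hv; omega
    · intro v hv
      have := hgh v hv; omega
    · exact (List.pairwise_cons.1 (List.pairwise_cons.1 hrs.2.1).2).2
    · intro v hv w hw
      have := hcz v hv
      simp only [List.mem_cons] at hw
      rcases hw with rfl | rfl | hw
      · exact this
      · omega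
      · have := hgh w hw; omega
  set u := readingWord rest with hu
  set s := x :: s₁ with hs
  have hup : u.Perm rest.flatten := readingWord_perm rest
  have hn1 : (y :: ((c ++ z :: g :: h) :: s :: rest).flatten).Nodup :=
    List.nodup_cons.2 ⟨hyD, hn⟩
  have hσ : ((u ++ s) ++ ((c ++ z :: g :: h) ++ [y])).Nodup := by
    refine (List.Perm.nodup_iff ?_).2 hn1
    refine ((hup.append_right _).append_right _).trans ?_
    rw [List.perm_iff_count]
    intro v
    simp only [List.count_append, List.count_cons, List.flatten_cons, List.count_nil]
    omega
  have t1 : KnuthEquiv ((c ++ z :: g :: h) ++ [y]) (g :: (c ++ z :: y :: h)) := by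
    have h1 := knuthEquiv_tableauInsert (T := [c ++ z :: g :: h]) (x := y) (by simpa using hr)
      (by
        refine hn1.sublist (List.Sublist.cons_cons _ ?_)
        simp only [List.flatten_cons, List.flatten_nil, List.append_nil]
        exact List.sublist_append_left _ _)
    have h2 : rowInsert ((c ++ [z]) ++ g :: h) y = ((c ++ [z]) ++ y :: h, some g) := by
      rw [rowInsert_append]
      · simp [rowInsert, show y < g by omega]
      · intro v hv
        simp only [List.mem_append, List.mem_singleton] at hv
        rcases hv with hv | rfl
        · have := hcz v hv; omega
        · omega
    simp only [List.append_assoc, List.singleton_append] at h2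
    simpa [readingWord, tableauInsert, h2] using h1
  have hcont : ContainsClass (readingWord ((c ++ z :: g :: h) :: s :: rest))
      ((u ++ s) ++ ((c ++ z :: g :: h) ++ [y])) := by
    refine ⟨(u ++ s) ++ (c ++ z :: g :: h), ?_, id, strictMonoOn_id, ?_⟩
    · exact (List.Sublist.refl _).append (List.sublist_append_left _ _)
    · simpa [readingWord] using KnuthEquiv.refl _
  have t2 : KnuthEquiv ((u ++ s) ++ ((c ++ z :: g :: h) ++ [y]))
      (((u ++ s) ++ [g]) ++ (((c ++ [z]) ++ [y]) ++ h)) := by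
    simpa using t1.append_left (u ++ s)
  have hσ' := t2.perm.nodup_iff.1 hσ
  obtain ⟨l, hl, f, hf, hk, hm⟩ := (hinv _ _ hσ t2 hcont).exists_of_readingWord hD hn hσ'
  have hln := hσ'.sublist hl
  have hlen := hk.perm.length_eq
  have hP : (l.map f).Perm ((c ++ [z]) ++ x :: (g :: h ++ s₁ ++ rest.flatten)) := by
    refine (hk.perm.trans (readingWord_perm _)).trans ?_
    rw [List.perm_iff_count]
    intro v
    simp only [List.count_append, List.count_cons, List.flatten_cons, List.count_nil, hs]
    omega
  obtain ⟨l₁, l₂, rfl, hl₁, hl₂⟩ := List.sublist_append_iff.1 hl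
  obtain ⟨m, h', rfl, hm₁, hh'⟩ := List.sublist_append_iff.1 hl₂
  -- The single missing letter either lies outside the block c z y or inside it.
  by_cases hme : m = (c ++ [z]) ++ [y]
  · subst hme
    have hbig : ∀ v ∈ g :: h ++ s₁ ++ rest.flatten, x < v := by
      intro v hv
      simp only [List.cons_append, List.mem_append, List.mem_cons] at hv
      rcases hv with rfl | (hv | hv) | hv
      · exact hxg
      · exact hxg.trans (hgh v hv)
      · exact hs₁x v hv
      · exact hrx v hv
    have hcz' : ∀ v ∈ c ++ [z], v ≤ z := by
      intro v hv
      simp only [List.mem_append, List.mem_singleton] at hv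
      rcases hv with hv | rfl
      · exact (hcz v hv).le
      · exact le_rfl
    have hzl : z ∈ l₁ ++ (((c ++ [z]) ++ [y]) ++ h') := by simp
    have hyl : y ∈ l₁ ++ (((c ++ [z]) ++ [y]) ++ h') := by simp
    -- Exactly c, z and y are at most y in the subsequence, so y has rank |c| + 2, which in the
    -- target is the rank of x.
    have hfy : f y = x := by
      have hcount := countP_le_of_map_perm hf hP hyl
      have c1 : l₁.countP (· ≤ y) = 0 := countP_le_of_forall_lt fun v hv => by
        have h1 := hl₁.subset hv
        simp only [List.mem_append, hs, List.mem_cons, List.not_mem_nil, or_false] at h1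
        rcases h1 with (h1 | rfl | h1) | rfl
        · exact hyx.trans (hrx v (hup.mem_iff.1 h1))
        · exact hyx
        · exact hyx.trans (hs₁x v h1)
        · exact hyx.trans hxg
      have c2 : h'.countP (· ≤ y) = 0 := countP_le_of_forall_lt fun v hv =>
        (hyx.trans hxg).trans (hgh v (hh'.subset hv))
      have c3 : (c ++ [z]).countP (· ≤ y) = (c ++ [z]).length :=
        countP_le_of_forall_le fun v hv => by have := hcz' v hv; omega
      have c0 : (l₁ ++ (((c ++ [z]) ++ [y]) ++ h')).countP (· ≤ y) = (c ++ [z]).length + 1 := by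
        rw [List.countP_append, List.countP_append (l₁ := (c ++ [z]) ++ [y]),
          List.countP_append (l₁ := c ++ [z]), c1, c2, c3]
        simp
      rw [c0, List.countP_append (l₁ := c ++ [z]), List.countP_cons] at hcount
      have c4 : (c ++ [z]).countP (· ≤ f y) ≤ (c ++ [z]).length := List.countP_le_length
      have hfm := hP.mem_iff.1 (List.mem_map_of_mem (f := f) hyl)
      rcases List.mem_append.1 hfm with h1 | h1
      · have h2 := hcz' _ h1
        have c5 : (g :: h ++ s₁ ++ rest.flatten).countP (· ≤ f y) = 0 :=
          countP_le_of_forall_lt fun v hv => by have := hbig v hv; omega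
        simp only [c5, show ¬ x ≤ f y by omega, decide_false] at hcount
        simp at hcount c4
        omega
      · rcases List.mem_cons.1 h1 with h1 | h1
        · exact h1
        · have h2 := hbig _ h1
          have c5 : 0 < (g :: h ++ s₁ ++ rest.flatten).countP (· ≤ f y) :=
            List.countP_pos_iff.2 ⟨_, h1, by simp⟩
          have c6 : (c ++ [z]).countP (· ≤ f y) = (c ++ [z]).length :=
            countP_le_of_forall_le fun v hv => by have := hcz' v hv; omega
          rw [c6] at hcount
          simp only [h2.le, decide_true, if_true] at hcount
          omega
    have hfzx : f z < x := by
      rw [← hfy]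
      exact hf hzl hyl (by omega)
    have hfz : f z = z := by
      have h1 : f z ≤ z := by
        rcases List.mem_append.1 (hP.mem_iff.1 (List.mem_map_of_mem (f := f) hzl)) with h1 | h1
        · exact hcz' _ h1
        · rcases List.mem_cons.1 h1 with h1 | h1
          · omega
          · have := hbig _ h1; omega
      by_contra! h2
      have h3 : f z < z := by omega
      obtain ⟨v, hv, hvz⟩ := List.mem_map.1 (hP.mem_iff.2 (show z ∈ _ by simp))
      have h4 : z < v := (hf.lt_iff_lt hzl hv).1 (by omega)
      have h5 : v < y := (hf.lt_iff_lt hv hyl).1 (by omega)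
      omega
    -- The relabelled word has z before x. These are consecutive among the labels, so their order is
    -- a Knuth invariant; in the reading word x, from the second row, comes first.
    have hsub : [z, x].Sublist ((l₁ ++ (((c ++ [z]) ++ [y]) ++ h')).map f) := by
      have : [z, y].Sublist (l₁ ++ (((c ++ [z]) ++ [y]) ++ h')) := by
        refine List.Sublist.trans ?_ (List.sublist_append_right _ _)
        refine List.Sublist.trans ?_ (List.sublist_append_left _ _)
        exact List.Sublist.append (l₁ := [z]) (by simp) (List.Sublist.refl _)
      have := this.map f
      rwa [List.map_cons, List.map_cons, List.map_nil, hfz, hfy] at this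
    have hnm := hk.perm.nodup_iff.2 ((readingWord_perm _).nodup_iff.2 hn)
    rw [hk.pair_sublist_iff hnm] at hsub
    · refine pair_sublist_asymm (hk.perm.nodup_iff.1 hnm) (by omega) hsub ?_
      simp only [readingWord]
      refine List.Sublist.append (l₁ := [x]) ?_ ?_
      · simp [hs]
      · simp
    · intro v hv
      rw [min_eq_left hzx.le, max_eq_right hzx.le]
      rcases List.mem_append.1 (hP.mem_iff.1 hv) with h1 | h1
      · exact Or.inl (hcz' _ h1)
      · rcases List.mem_cons.1 h1 with h1 | h1
        · exact Or.inr h1.ge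
        · exact Or.inr (hbig _ h1).le
  · have hml : m.length < ((c ++ [z]) ++ [y]).length :=
      lt_of_le_of_ne hm₁.length_le fun h => hme (hm₁.eq_of_length h)
    have hl₁l := hl₁.length_le
    have hh'l := hh'.length_le
    simp only [readingWord, ← hu, List.length_map, List.length_append, List.length_cons,
      List.length_nil] at hlen hl₁l hml
    have hl₁e : l₁ = (u ++ s) ++ [g] := hl₁.eq_of_length (by
      simp only [List.length_append, List.length_cons, List.length_nil]; omega)
    have hhe : h' = h := hh'.eq_of_length (by omega)
    subst hhe
    have hmc : m.length = c.length + 1 := by omega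
    have hmx : ∀ v ∈ m, v < x := by
      intro v hv
      have h1 := hm₁.subset hv
      simp only [List.mem_append, List.mem_singleton] at h1
      rcases h1 with (h1 | rfl) | rfl
      · exact (hcz v h1).trans hzx
      · exact hzx
      · exact hyx
    have hv : (m ++ h').Pairwise (· < ·) := by
      refine hr'.sublist (hl₂.trans ?_)
      simp
    have hsl : s.length < (c ++ z :: g :: h').length := by
      have := (hshift s₁.length (by simp [hs])).1
      simpa [hs] using this
    obtain ⟨R, T, hRT, hR, -⟩ := List.map_eq_cons_iff.1 hm
    have e1 : rowInsert s g = (x :: g :: s₁.tail, s₁.head?) := by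
      rw [hs]
      cases s₁ with
      | nil => simp [rowInsert, hxg.not_gt]
      | cons s₂ s₁ => simp [rowInsert, hxg.not_gt, hgs s₂ (by simp)]
    -- The inserted g has replaced the first letter of s₁. The increasing word m h lies below this
    -- row column by column: m covers at least two columns because c is nonempty, and from column 2
    -- on the row is that of s, where `hshift` compares. So m h replaces the whole row, leaving a
    -- first row one cell shorter than that of the tableau.
    have e2 := rowPass_of_lt (l := x :: g :: s₁.tail) hv (by
      intro i hi hj
      by_cases him : i < m.length
      · rw [List.getD_append _ _ _ _ him, List.getD_eq_getElem _ _ him]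
        have h1 := hmx _ (List.getElem_mem him)
        refine h1.trans_le ?_
        rw [List.getD_eq_getElem _ _ hj]
        have h2 := List.getElem_mem hj
        simp only [List.mem_cons] at h2
        rcases h2 with h2 | h2 | h2
        · exact h2.ge
        · rw [h2]; exact hxg.le
        · exact (hs₁x _ (List.mem_of_mem_tail h2)).le
      · rw [List.getD_append_right _ _ _ _ (by omega)]
        simp only [List.length_append] at hi
        obtain ⟨j, rfl⟩ : ∃ j, i = j + 2 := ⟨i - 2, by omega⟩
        simp only [List.length_cons, List.length_tail] at hj
        have h1 := (hshift (j + 2) (by simp [hs]; omega)).2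
        rw [List.getD_append_right _ _ _ _ (by omega)] at h1
        have h3 : j + 2 + 1 - c.length = (j + 2 - m.length) + 2 := by omega
        rw [h3] at h1
        cases s₁ with
        | nil => simp at hj
        | cons s₂ s₁ => simpa [hs] using h1)
    have e3 := wordTableau_readingWord_append hS (W := g :: (m ++ h')) (by simp)
    have e4 : l₁ ++ (m ++ h') = readingWord (s :: rest) ++ g :: (m ++ h') := by
      simp [hl₁e, readingWord, hu]
    rw [e4, e3, List.cons.injEq] at hRT
    simp only [List.headD_cons, rowPass, e1, e2] at hRT
    have h5 : (x :: g :: s₁.tail).drop (m ++ h').length = [] := by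
      refine List.drop_eq_nil_of_le ?_
      simp only [List.length_append, List.length_cons, List.length_tail, hs] at hsl ⊢
      omega
    rw [h5, List.append_nil] at hRT
    have h6 := congrArg List.length hR
    rw [← hRT.1] at h6
    simp only [List.length_map, List.length_append, List.length_cons] at h6
    omega

/-- If the Knuth class of a tableau with even entries is containment invariant and the second
smallest entry of its first two rows lies in the first row, then the tableau is a hook whose first
row consists of the smallest entries. -/
theorem IsTableau.hook_of_containmentInvariant {r s : List ℕ} {rest : List (List ℕ)}
    (hD : IsTableau (r :: s :: rest)) (hn : (r :: s :: rest).flatten.Nodup)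
    (heven : ∀ v ∈ (r :: s :: rest).flatten, v % 2 = 0) (hr : 1 < r.length)
    (hrs : r.getD 1 0 < s.getD 0 0) (hinv : ContainmentInvariant (readingWord (r :: s :: rest))) :
    s.length = 1 ∧ ∀ v ∈ r, v < s.getD 0 0 := by
  have hrp := hD.2.1
  have hA := hD.2.2.1
  have hsp := hD.2.2.2.2.1
  have hs0 : 0 < s.length := List.length_pos_iff.2 hD.2.2.2.1
  simp only [List.headD_cons] at hA
  have hmr : ∀ i j, i < j → j < r.length → r.getD i 0 < r.getD j 0 := by
    intro i j hij hj
    rw [List.getD_eq_getElem _ _ hj, List.getD_eq_getElem _ _ (hij.trans hj)]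
    exact List.pairwise_iff_getElem.1 hrp i j _ _ hij
  have hms : ∀ i j, i < j → j < s.length → s.getD i 0 < s.getD j 0 := by
    intro i j hij hj
    rw [List.getD_eq_getElem _ _ hj, List.getD_eq_getElem _ _ (hij.trans hj)]
    exact List.pairwise_iff_getElem.1 hsp i j _ _ hij
  have hne : ∀ i j, i < r.length → j < s.length → r.getD i 0 ≠ s.getD j 0 := by
    intro i j hi hj h
    rw [List.getD_eq_getElem _ _ hi, List.getD_eq_getElem _ _ hj] at h
    have h1 : (r ++ s).Nodup := hn.sublist (by simp)
    exact (List.nodup_append.1 h1).2.2 _ (List.getElem_mem hi) _ (List.getElem_mem hj) h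
  -- The row s, slid d cells to the right, still fits below r with increasing columns.
  let Q : ℕ → Prop := fun d => ∀ t < s.length, d + t < r.length ∧ r.getD (d + t) 0 < s.getD t 0
  have hQ0 : Q 0 := fun t ht => by
    rw [Nat.zero_add]
    exact ⟨ht.trans_le hA.length_le, hA.getD_lt t ht⟩
  have hex : ∃ d, ¬ Q d := ⟨r.length, fun h => by have := (h 0 hs0).1; omega⟩
  classical
  obtain ⟨d, hd, hQd⟩ : ∃ d, ¬ Q (d + 1) ∧ Q d := by
    have h1 := Nat.find_spec hex
    have h2 : Nat.find hex ≠ 0 := fun h => by rw [h] at h1; exact h1 hQ0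
    obtain ⟨d, hd⟩ := Nat.exists_eq_succ_of_ne_zero h2
    rw [hd] at h1
    exact ⟨d, h1, not_not.1 (Nat.find_min hex (by omega))⟩
  -- From here on t is the first column of s that obstructs the slide from d to d + 1.
  have hd' : ∃ t, t < s.length ∧ ¬ (d + 1 + t < r.length ∧ r.getD (d + 1 + t) 0 < s.getD t 0) := by
    by_contra! h
    exact hd fun t ht => h t ht
  obtain ⟨ht, htf⟩ := Nat.find_spec hd'
  have htmin := fun m => Nat.find_min hd' (m := m)
  revert ht htf htmin
  generalize Nat.find hd' = t
  intro ht htf htmin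
  have hQt := hQd t ht
  have hQl := hQd (s.length - 1) (by omega)
  have hp : ∀ i, d + t < i → i < r.length → s.getD t 0 < r.getD i 0 := by
    intro i hi hil
    have h1 : ¬ r.getD (d + 1 + t) 0 < s.getD t 0 := fun h => htf ⟨by omega, h⟩
    have h2 := hne (d + 1 + t) t (by omega) ht
    rcases Nat.lt_or_ge (d + 1 + t) i with h | h
    · have := hmr _ _ h hil; omega
    · have : i = d + 1 + t := by omega
      subst this; omega
  rcases Nat.eq_zero_or_pos t with rfl | ht0
  · have hd1 : 0 < d := by
      rcases Nat.eq_zero_or_pos d with rfl | h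
      · exact absurd ⟨by omega, by simpa using hrs⟩ htf
      · exact h
    -- If cell d + 1 of r exists, its entry g exceeds x, the first entry of s, and z = r_d < x < g
    -- is the second obstruction. If it does not, s has been slid to the end of r, so it has a
    -- single cell, which exceeds the last entry of r.
    by_cases hg : d + 1 < r.length
    · exfalso
      have er : r = r.take d ++ r.getD d 0 :: r.getD (d + 1) 0 :: r.drop (d + 2) := by
        rw [List.getD_eq_getElem _ _ hg, List.getD_eq_getElem _ _ (by omega : d < r.length),
          ← List.drop_eq_getElem_cons hg, ← List.drop_eq_getElem_cons (by omega),
          List.take_append_drop]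
      have es : s = s.getD 0 0 :: s.drop 1 := by
        rw [List.getD_eq_getElem _ _ hs0, ← List.drop_eq_getElem_cons hs0, List.drop_zero]
      have hshift : ∀ j < s.length, j + 1 < r.length ∧ r.getD (j + 1) 0 < s.getD j 0 := by
        intro j hj
        obtain ⟨h1, h2⟩ := hQd j hj
        refine ⟨by omega, ?_⟩
        rcases Nat.lt_or_ge (j + 1) (d + j) with h | h
        · exact (hmr _ _ h h1).trans h2
        · have : j + 1 = d + j := by omega
          rw [this]; exact h2
      have hgs : ∀ v ∈ s.drop 1, r.getD (d + 1) 0 < v := by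
        intro v hv
        obtain ⟨j, hj, rfl⟩ := List.mem_iff_getElem.1 hv
        simp only [List.length_drop] at hj
        rw [List.getElem_drop, ← List.getD_eq_getElem s 0]
        have h1 := hQd (1 + j) (by omega)
        rcases Nat.eq_zero_or_pos j with rfl | hj0
        · exact h1.2
        · exact (hmr (d + 1) (d + (1 + j)) (by omega) h1.1).trans h1.2
      have hlt := hQt.2
      have hgt := hp (d + 1) (by omega) hg
      rw [Nat.add_zero] at hlt
      have hcne : r.take d ≠ [] := by
        rw [← List.length_pos_iff, List.length_take]; omega
      revert hD hn heven hinv hshift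
      generalize r.getD d 0 = z at *
      generalize r.getD (d + 1) 0 = g at *
      generalize s.getD 0 0 = x at *
      generalize r.take d = c at *
      generalize r.drop (d + 2) = h at *
      generalize s.drop 1 = s₁ at *
      subst er es
      intro hD hn heven hinv hshift
      exact not_containmentInvariant_of_lt hD hn heven hcne hlt hgt hgs hshift hinv
    · refine ⟨by omega, fun v hv => ?_⟩
      obtain ⟨j, hj, rfl⟩ := List.mem_iff_getElem.1 hv
      rw [← List.getD_eq_getElem r 0]
      have hlt := hQt.2
      rw [Nat.add_zero] at hlt
      rcases Nat.lt_or_ge j d with h | h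
      · exact (hmr j d h (by omega)).trans hlt
      · have : j = d := by omega
        subst this; exact hlt
  · exfalso
    -- Column t - 1 does not obstruct the slide, by minimality of t. With z = r_{d+t}, x = s_{t-1}
    -- and p = s_t this is the situation of the first obstruction; the slid row bounds the entries
    -- of r after z by those of s after p.
    have hzx : r.getD (d + t) 0 < s.getD (t - 1) 0 := by
      have := htmin (t - 1) (by omega)
      push Not at this
      have h1 := (this (by omega)).2
      rwa [show d + 1 + (t - 1) = d + t by omega] at h1
    have er : r = r.take (d + t) ++ r.getD (d + t) 0 ::
        ((r.drop (d + t + 1)).take (s.length - (t + 1)) ++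
          (r.drop (d + t + 1)).drop (s.length - (t + 1))) := by
      rw [List.take_append_drop, List.getD_eq_getElem _ _ hQt.1, ← List.drop_eq_getElem_cons hQt.1,
        List.take_append_drop]
    have es : s = s.take (t - 1) ++ s.getD (t - 1) 0 :: s.getD t 0 :: s.drop (t + 1) := by
      have h1 := List.drop_eq_getElem_cons (l := s) (i := t - 1) (by omega)
      rw [show t - 1 + 1 = t by omega] at h1
      rw [List.getD_eq_getElem _ _ ht, List.getD_eq_getElem _ _ (by omega : t - 1 < s.length),
        ← List.drop_eq_getElem_cons ht, ← h1, List.take_append_drop]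
    have hpd : ∀ v ∈ (r.drop (d + t + 1)).take (s.length - (t + 1)) ++
          (r.drop (d + t + 1)).drop (s.length - (t + 1)), s.getD t 0 < v := by
      rw [List.take_append_drop]
      intro v hv
      obtain ⟨j, hj, rfl⟩ := List.mem_iff_getElem.1 hv
      simp only [List.length_drop] at hj
      rw [List.getElem_drop, ← List.getD_eq_getElem r 0]
      exact hp _ (by omega) (by omega)
    have hdl : ((r.drop (d + t + 1)).take (s.length - (t + 1))).length =
        (s.drop (t + 1)).length := by
      simp only [List.length_take, List.length_drop]
      omega
    have hdb : ∀ i, i < ((r.drop (d + t + 1)).take (s.length - (t + 1))).length →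
        ((r.drop (d + t + 1)).take (s.length - (t + 1))).getD i 0 < (s.drop (t + 1)).getD i 0 := by
      intro i hi
      have hi' := hdl ▸ hi
      simp only [List.length_drop] at hi'
      have h1 := hQd (t + 1 + i) (by omega)
      rw [List.getD_eq_getElem _ _ hi, List.getD_eq_getElem _ _ (hdl ▸ hi), List.getElem_take,
        List.getElem_drop, List.getElem_drop, ← List.getD_eq_getElem r 0,
        ← List.getD_eq_getElem s 0]
      rw [show d + t + 1 + i = d + (t + 1 + i) by omega]
      exact h1.2
    have hac : (s.take (t - 1)).length + 1 ≤ (r.take (d + t)).length := by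
      simp only [List.length_take]
      omega
    revert hD hn heven hinv
    generalize r.getD (d + t) 0 = z at *
    generalize s.getD (t - 1) 0 = x at *
    generalize s.getD t 0 = p at *
    generalize r.take (d + t) = c at *
    generalize (r.drop (d + t + 1)).take (s.length - (t + 1)) = e at *
    generalize (r.drop (d + t + 1)).drop (s.length - (t + 1)) = e₂ at *
    generalize s.take (t - 1) = a at *
    generalize s.drop (t + 1) = b at *
    subst er es
    intro hD hn heven hinv
    exact not_containmentInvariant_of_shift hD hn heven hzx hpd hac hdl hdb hinv


/-! ### Words of hooks -/

theorem pair_sublist_iff_idxOf {w : List ℕ} (hw : w.Nodup) {a b : ℕ} :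
    [a, b].Sublist w ↔ b ∈ w ∧ w.idxOf a < w.idxOf b := by
  induction w with
  | nil => simp
  | cons c w ih =>
    have hc := (List.nodup_cons.1 hw).1
    rw [List.idxOf_cons, List.idxOf_cons]
    by_cases hca : c = a
    · subst hca
      rw [List.cons_sublist_cons, List.singleton_sublist]
      by_cases hcb : c = b
      · subst hcb
        simpa using hc
      · simp [hcb, Ne.symm hcb, Bool.cond_eq_ite]
    · have h1 : [a, b].Sublist (c :: w) ↔ [a, b].Sublist w := by
        refine ⟨fun h => ?_, fun h => h.cons c⟩
        cases h with
        | cons _ h => exact h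
        | cons_cons _ h => exact absurd rfl hca
      rw [h1, ih (List.nodup_cons.1 hw).2]
      by_cases hcb : c = b
      · subst hcb
        simp [hc]
      · simp [hca, hcb, Ne.symm hcb, Bool.cond_eq_ite]

theorem pair_sublist_trans {w : List ℕ} (hw : w.Nodup) {a b c : ℕ} (h : [a, b].Sublist w)
    (h' : [b, c].Sublist w) : [a, c].Sublist w := by
  rw [pair_sublist_iff_idxOf hw] at *
  exact ⟨h'.1, h.2.trans h'.2⟩

theorem pair_sublist_total {w : List ℕ} (hw : w.Nodup) {a b : ℕ} (ha : a ∈ w) (hb : b ∈ w)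
    (hab : a ≠ b) : [a, b].Sublist w ∨ [b, a].Sublist w := by
  rw [pair_sublist_iff_idxOf hw, pair_sublist_iff_idxOf hw]
  rcases lt_trichotomy (w.idxOf a) (w.idxOf b) with h | h | h
  · exact Or.inl ⟨hb, h⟩
  · exact absurd ((List.idxOf_inj ha).1 h) hab
  · exact Or.inr ⟨ha, h⟩

theorem pair_sublist_of_pairwise_of_mem {r : List ℕ} (hr : r.Pairwise (· < ·)) {a b : ℕ}
    (ha : a ∈ r) (hb : b ∈ r) (hab : a < b) : [a, b].Sublist r := by
  refine (pair_sublist_total (hr.imp ne_of_lt) ha hb hab.ne).resolve_right fun h => ?_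
  have := hr.sublist h
  simp only [List.pairwise_cons, List.mem_singleton, forall_eq] at this
  omega

theorem readingWord_sublist_of_mem {T : List (List ℕ)} {r : List ℕ} (hr : r ∈ T) :
    r.Sublist (readingWord T) := by
  induction T with
  | nil => simp at hr
  | cons R T ih =>
    rcases List.mem_cons.1 hr with rfl | h
    · exact List.sublist_append_right _ _
    · exact (ih h).trans (List.sublist_append_left _ _)

/-! ### Superstandard hooks as lists of rows -/

/-- The rows of the row superstandard hook with `n` cells and first row of length `k`. -/
def hookRow (k n : ℕ) : List (List ℕ) :=
  List.range' 1 k :: (List.range' (k + 1) (n - k)).map ([·])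

/-- The rows of the column superstandard hook with `n` cells and first column of length `k`. -/
def hookCol (k n : ℕ) : List (List ℕ) :=
  (1 :: List.range' (k + 1) (n - k)) :: (List.range' 2 (k - 1)).map ([·])

theorem readingWord_map_singleton (l : List ℕ) : readingWord (l.map ([·])) = l.reverse := by
  induction l with
  | nil => rfl
  | cons a l ih => simp [readingWord, ih]

theorem readingWord_hookRow (k n : ℕ) :
    readingWord (hookRow k n) = (List.range' (k + 1) (n - k)).reverse ++ List.range' 1 k := by
  rw [hookRow, readingWord, readingWord_map_singleton]

/-- Together with `KnuthEquiv.reverse` this carries statements about row hooks over to column hooks.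
-/
theorem readingWord_hookCol {k n : ℕ} (hk : 1 ≤ k) :
    (readingWord (hookCol k n)).reverse = readingWord (hookRow k n) := by
  obtain ⟨k, rfl⟩ := Nat.exists_eq_add_of_le' hk
  rw [readingWord_hookRow, hookCol, readingWord, readingWord_map_singleton]
  simp [List.range'_succ]

theorem isTableau_map_singleton {l : List ℕ} (h : l.Pairwise (· < ·)) :
    IsTableau (l.map ([·])) := by
  induction l with
  | nil => trivial
  | cons a l ih =>
    refine ⟨by simp, by simp, ?_, ih (List.pairwise_cons.1 h).2⟩
    cases l with
    | nil => exact .nil _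
    | cons b l => exact .cons ((List.pairwise_cons.1 h).1 b (by simp)) (.nil _)

theorem isTableau_hookCol {k n : ℕ} (hk : 1 ≤ k) : IsTableau (hookCol k n) := by
  obtain ⟨k, rfl⟩ := Nat.exists_eq_add_of_le' hk
  refine ⟨by simp, ?_, ?_, isTableau_map_singleton List.pairwise_lt_range'⟩
  · refine List.pairwise_cons.2 ⟨fun v hv => ?_, List.pairwise_lt_range'⟩
    rw [List.mem_range'_1] at hv
    omega
  · cases k with
    | zero => exact .nil _
    | succ k => exact .cons (by omega) (.nil _)

theorem isTableau_hookRow {k n : ℕ} (hk : 1 ≤ k) : IsTableau (hookRow k n) := by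
  obtain ⟨k, rfl⟩ := Nat.exists_eq_add_of_le' hk
  refine ⟨by simp [List.range'_succ], List.pairwise_lt_range', ?_,
    isTableau_map_singleton List.pairwise_lt_range'⟩
  rcases n - (k + 1) with _ | m
  · exact .nil _
  · simp only [List.range'_succ, List.map_cons, List.headD_cons]
    exact .cons (by omega) (.nil _)

theorem IsTableau.exists_eq_map_singleton {T : List (List ℕ)} (h : IsTableau T)
    (h1 : ∀ R ∈ T, R.length = 1) : ∃ l : List ℕ, T = l.map ([·]) ∧ l.Pairwise (· < ·) := by
  induction T with
  | nil => exact ⟨[], rfl, .nil⟩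
  | cons R T ih =>
    obtain ⟨a, rfl⟩ := List.length_eq_one_iff.1 (h1 R (by simp))
    obtain ⟨l, rfl, hl⟩ := ih h.2.2.2 fun R hR => h1 R (by simp [hR])
    refine ⟨a :: l, rfl, List.pairwise_cons.2 ⟨fun v hv => h.lt_of_mem_flatten v ?_, hl⟩⟩
    exact List.mem_flatten.2 ⟨[v], by simpa using hv, by simp⟩

theorem IsTableau.eq_hookRow {r : List ℕ} {T : List (List ℕ)} {n : ℕ} (h : IsTableau (r :: T))
    (hp : (r :: T).flatten.Perm (List.range' 1 n)) (h1 : ∀ R ∈ T, R.length = 1)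
    (hlt : ∀ a ∈ r, ∀ b ∈ T.flatten, a < b) :
    1 ≤ r.length ∧ r.length ≤ n ∧ r :: T = hookRow r.length n := by
  obtain ⟨l, rfl, hl⟩ := h.2.2.2.exists_eq_map_singleton h1
  have hfl : (l.map ([·])).flatten = l := by
    rw [← List.flatMap_def, List.flatMap_singleton']
  rw [List.flatten_cons] at hp
  rw [hfl] at hp hlt
  have hpw : (r ++ l).Pairwise (· < ·) := List.pairwise_append.2 ⟨h.2.1, hl, hlt⟩
  have he : r ++ l = List.range' 1 n := by
    refine hp.eq_of_pairwise (le := (· < ·)) ?_ hpw List.pairwise_lt_range'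
    intro a b _ _ hab hba
    omega
  have hlen := congrArg List.length he
  rw [List.length_append, List.length_range'] at hlen
  have hsplit : List.range' 1 n = List.range' 1 r.length ++ List.range' (r.length + 1) (n - r.length) := by
    rw [add_comm r.length 1, List.range'_append_1]
    congr 1
    omega
  rw [hsplit] at he
  obtain ⟨e1, e2⟩ := List.append_inj he (by simp)
  refine ⟨List.length_pos_iff.2 h.1, by omega, ?_⟩
  rw [hookRow, ← e1, ← e2]

/-! ### Words whose inverse descents form a final interval -/

/-- The word `l` is a rearrangement of `1, …, n` whose inverse has the descents `k, …, n - 1` and no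
others. -/
def FinalWord (k n : ℕ) (l : List ℕ) : Prop :=
  l.Perm (List.range' 1 n) ∧ (∀ i, 1 ≤ i → i < k → [i, i + 1].Sublist l) ∧
    ∀ i, k ≤ i → i < n → [i + 1, i].Sublist l

theorem FinalWord.nodup {k n : ℕ} {l : List ℕ} (h : FinalWord k n l) : l.Nodup :=
  h.1.nodup_iff.2 (List.nodup_range' ..)

theorem FinalWord.of_knuthEquiv {k n : ℕ} {l l' : List ℕ} (h : FinalWord k n l)
    (hl : KnuthEquiv l l') : FinalWord k n l' := by
  refine ⟨hl.perm.symm.trans h.1, fun i h1 h2 => ?_, fun i h1 h2 => ?_⟩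
  · exact (hl.pair_sublist_iff h.nodup (by intros; omega)).1 (h.2.1 i h1 h2)
  · exact (hl.pair_sublist_iff h.nodup (by intros; omega)).1 (h.2.2 i h1 h2)

theorem FinalWord.asc {k n : ℕ} {l : List ℕ} (h : FinalWord k n l) {a b : ℕ} (ha : 1 ≤ a)
    (hab : a < b) (hb : b ≤ k) : [a, b].Sublist l := by
  induction b, hab using Nat.le_induction with
  | base => exact h.2.1 a ha hb
  | succ b hb' ih =>
    exact pair_sublist_trans h.nodup (ih (by omega)) (h.2.1 b (by omega) hb)

theorem FinalWord.desc {k n : ℕ} {l : List ℕ} (h : FinalWord k n l) {a b : ℕ} (ha : k ≤ a)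
    (hab : a < b) (hb : b ≤ n) : [b, a].Sublist l := by
  induction b, hab using Nat.le_induction with
  | base => exact h.2.2 a ha hb
  | succ b hb' ih =>
    exact pair_sublist_trans h.nodup (h.2.2 b (by omega) hb) (ih (by omega))

theorem hookRow_flatten {k n : ℕ} (hk : k ≤ n) : (hookRow k n).flatten = List.range' 1 n := by
  rw [hookRow, List.flatten_cons, ← List.flatMap_def, List.flatMap_singleton', add_comm k 1,
    List.range'_append_1]
  congr 1
  omega

theorem finalWord_hookRow {k n : ℕ} (hk : 1 ≤ k) (hkn : k ≤ n) :
    FinalWord k n (readingWord (hookRow k n)) := by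
  refine ⟨(readingWord_perm _).trans (hookRow_flatten hkn ▸ .refl _), fun i h1 h2 => ?_,
    fun i h1 h2 => ?_⟩
  · rw [readingWord_hookRow]
    refine (pair_sublist_of_pairwise_of_mem List.pairwise_lt_range' ?_ ?_ (by omega)).trans
      (List.sublist_append_right _ _) <;> rw [List.mem_range'_1] <;> omega
  · rw [readingWord_hookRow]
    rcases h1.eq_or_lt with rfl | h1
    · refine List.Sublist.append (l₁ := [k + 1]) (r₁ := [k]) ?_ ?_ <;>
        simp only [List.singleton_sublist, List.mem_reverse, List.mem_range'_1] <;> omega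
    · refine List.Sublist.trans (l₂ := (List.range' (k + 1) (n - k)).reverse) ?_
        (List.sublist_append_left _ _)
      have := pair_sublist_of_pairwise_of_mem (List.pairwise_lt_range' (s := k + 1) (n := n - k))
        (a := i) (b := i + 1) (by rw [List.mem_range'_1]; omega) (by rw [List.mem_range'_1]; omega)
        (by omega)
      simpa using this.reverse

/-- The order of consecutive values is a Knuth invariant, so it may be read off the reading word of
the tableau, where lower rows come first and each row increases. Letters up to k must then lie in
the first row, and no row holds two letters that are at least k. -/
theorem FinalWord.wordTableau_eq {k n : ℕ} {l : List ℕ} (h : FinalWord k n l) (hk : 1 ≤ k)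
    (hkn : k ≤ n) : wordTableau l = hookRow k n := by
  have hf := h.of_knuthEquiv (knuthEquiv_readingWord_wordTableau h.nodup)
  have hT := isTableau_wordTableau h.nodup
  have hp := (wordTableau_perm l).trans h.1
  generalize wordTableau l = T at *
  cases T with
  | nil => have := hp.length_eq; simp at this; omega
  | cons r T =>
  have hmem : ∀ v, v ∈ r ∨ v ∈ T.flatten ↔ 1 ≤ v ∧ v ≤ n := by
    intro v
    have := hp.mem_iff (a := v)
    rw [List.mem_range'_1, List.flatten_cons, List.mem_append] at this
    rw [this]
    omega
  have h1r : 1 ∈ r := by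
    refine ((hmem 1).2 (by omega)).resolve_right fun h1 => ?_
    obtain ⟨a, r, rfl⟩ := List.exists_cons_of_ne_nil hT.1
    have := hT.lt_of_mem_flatten 1 h1
    have := ((hmem a).1 (by simp)).1
    omega
  -- The letter 1 is in the first row, which is read last; a letter v ≤ k of a lower row would be
  -- read before it.
  have hfirst : ∀ v ∈ T.flatten, k < v := by
    intro v hv
    by_contra hvk
    have h1 := (hmem v).1 (Or.inr hv)
    have hd : 1 ≠ v := by
      rintro rfl
      have := hp.nodup_iff.2 (List.nodup_range' ..)
      rw [List.flatten_cons] at this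
      exact (List.disjoint_of_nodup_append this) h1r hv
    refine pair_sublist_asymm hf.nodup hd (hf.asc (le_refl 1) (by omega) (by omega)) ?_
    exact List.Sublist.append (l₁ := [v]) (r₁ := [1])
      (List.singleton_sublist.2 ((readingWord_perm T).mem_iff.2 hv)) (List.singleton_sublist.2 h1r)
  -- Two letters of one row are read in increasing order, whereas letters that are at least k occur
  -- in decreasing order.
  have hrow : ∀ R ∈ r :: T, ∀ a ∈ R, ∀ b ∈ R, k ≤ a → a < b → False := by
    intro R hR a ha b hb hka hab
    have hb' := (hmem b).1 (by
      rw [← List.mem_append, ← List.flatten_cons]; exact List.mem_flatten.2 ⟨R, hR, hb⟩)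
    refine pair_sublist_asymm hf.nodup hab.ne ?_ (hf.desc hka hab hb'.2)
    exact (pair_sublist_of_pairwise_of_mem (hT.pairwise R hR) ha hb hab).trans
      (readingWord_sublist_of_mem hR)
  have hkr : k ∈ r := ((hmem k).2 ⟨hk, hkn⟩).resolve_right fun h => (hfirst k h).false
  have hrk : ∀ v ∈ r, v ≤ k := fun v hv => by
    by_contra hv'
    exact hrow r (by simp) k hkr v hv le_rfl (by omega)
  have hsing : ∀ R ∈ T, R.length = 1 := by
    intro R hR
    have hR' : ∀ a ∈ R, k ≤ a := fun a ha => (hfirst a (List.mem_flatten.2 ⟨R, hR, ha⟩)).le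
    have hpw := hT.pairwise R (by simp [hR])
    have hne := hT.ne_nil R (by simp [hR])
    match R, hne, hpw with
    | [a], _, _ => rfl
    | a :: b :: R, _, hpw =>
      exact (hrow _ (List.mem_cons_of_mem _ hR) a (by simp) b (by simp) (hR' a (by simp))
        ((List.pairwise_cons.1 hpw).1 b (by simp))).elim
  obtain ⟨-, -, he⟩ := hT.eq_hookRow hp hsing fun a ha b hb =>
    (hrk a ha).trans_lt (hfirst b hb)
  rw [he]
  congr 1
  have hr : r = List.range' 1 r.length := (List.cons.inj he).1
  have h1 := hrk
  have h2 := hkr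
  rw [hr, List.mem_range'_1] at h2
  -- The first row is 1, …, |r|; its last entry is at most k and it contains k, so |r| = k.
  have h3 := hrk r.length (by rw [hr]; simp [List.mem_range'_1]; omega)
  omega

theorem FinalWord.wordTableau_eq_hookCol {k n : ℕ} {l : List ℕ} (h : FinalWord k n l.reverse)
    (hk : 1 ≤ k) (hkn : k ≤ n) : wordTableau l = hookCol k n := by
  have h1 := h.wordTableau_eq hk hkn
  have hn := List.nodup_reverse.1 h.nodup
  rw [← (isTableau_hookRow hk).wordTableau_readingWord,
    wordTableau_eq_iff h.nodup (finalWord_hookRow hk hkn).nodup, ← readingWord_hookCol hk] at h1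
  have h2 := h1.reverse
  rw [List.reverse_reverse, List.reverse_reverse] at h2
  rw [h2.wordTableau_eq hn, (isTableau_hookCol hk).wordTableau_readingWord]

theorem finalWord_iff {k n : ℕ} {l : List ℕ} (hk : 1 ≤ k) (hkn : k ≤ n) (hl : l.Nodup) :
    FinalWord k n l ↔ wordTableau l = hookRow k n := by
  refine ⟨fun h => h.wordTableau_eq hk hkn, fun h => ?_⟩
  have := knuthEquiv_readingWord_wordTableau hl
  rw [h] at this
  exact (finalWord_hookRow hk hkn).of_knuthEquiv this.symm

theorem finalWord_reverse_iff {k n : ℕ} {l : List ℕ} (hk : 1 ≤ k) (hkn : k ≤ n) (hl : l.Nodup) :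
    FinalWord k n l.reverse ↔ wordTableau l = hookCol k n := by
  refine ⟨fun h => h.wordTableau_eq_hookCol hk hkn, fun h => ?_⟩
  have := (knuthEquiv_readingWord_wordTableau hl).reverse
  rw [h, readingWord_hookCol hk] at this
  exact (finalWord_hookRow hk hkn).of_knuthEquiv this.symm

/-- That 1 precedes 2 in the reading word means that 2 lies in the first row, which is what
`IsTableau.hook_of_containmentInvariant` needs. Its conclusion about the first two rows extends to
the rest: row lengths decrease weakly and columns increase. -/
theorem IsTableau.eq_hookRow_of_containmentInvariant {T : List (List ℕ)} {n : ℕ} (hT : IsTableau T)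
    (hp : T.flatten.Perm (List.range' 1 n)) (hn : 1 ≤ n)
    (h12 : 2 ≤ n → [1, 2].Sublist (readingWord T))
    (hinv : ContainmentInvariant (readingWord T)) : ∃ k, 1 ≤ k ∧ k ≤ n ∧ T = hookRow k n := by
  have hnd : T.flatten.Nodup := hp.nodup_iff.2 (List.nodup_range' ..)
  match T, hT with
  | [], _ => have := hp.length_eq; simp at this; omega
  | [r], hT => exact ⟨_, hT.eq_hookRow hp (by simp) (by simp)⟩
  | (a :: r) :: s :: T, hT =>
  have hmem : ∀ v, (v = a ∨ v ∈ r) ∨ v ∈ (s :: T).flatten ↔ 1 ≤ v ∧ v ≤ n := by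
    intro v
    have := hp.mem_iff (a := v)
    rw [List.mem_range'_1, List.flatten_cons, List.mem_append, List.mem_cons] at this
    rw [this]
    omega
  have hlater := hT.lt_of_mem_flatten
  have hs0 : s.getD 0 0 ∈ (s :: T).flatten := by
    obtain ⟨x, s, rfl⟩ := List.exists_cons_of_ne_nil hT.2.2.2.1
    simp
  have ha : a = 1 := by
    have h1 := (hmem 1).2 (by omega)
    have h2 := (hmem a).1 (by simp)
    rcases h1 with (h | h) | h
    · exact h.symm
    · have := (List.pairwise_cons.1 hT.2.1).1 1 h
      omega
    · have := hlater 1 h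
      omega
  subst ha
  have h2n : 2 ≤ n := by
    have := hlater _ hs0
    have := (hmem _).1 (Or.inr hs0)
    omega
  have hrd : (readingWord ((1 :: r) :: s :: T)).Nodup := (readingWord_perm _).nodup_iff.2 hnd
  have h2r : 2 ∈ r := by
    rcases (hmem 2).2 (by omega) with (h | h) | h
    · omega
    · exact h
    · refine absurd ?_ (pair_sublist_asymm hrd (by omega) (h12 h2n))
      exact List.Sublist.append (l₁ := [2]) (r₁ := [1])
        (List.singleton_sublist.2 ((readingWord_perm _).mem_iff.2 h))
        (List.singleton_sublist.2 (by simp))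
  have hdisj : 2 ∉ (s :: T).flatten := by
    rw [List.flatten_cons] at hnd
    exact (List.disjoint_of_nodup_append hnd) (by simp [h2r])
  match r, h2r with
  | b :: r, h2r =>
  have hb : b = 2 := by
    rcases List.mem_cons.1 h2r with h | h
    · exact h.symm
    · have := hT.2.1
      simp only [List.pairwise_cons] at this
      have h1 := this.1 b (by simp)
      have h2 := this.2.1 2 h
      omega
  subst hb
  have hs0' : 2 < s.getD 0 0 := by
    have := hlater _ hs0
    have : s.getD 0 0 ≠ 2 := fun h => hdisj (h ▸ hs0)
    omega
  -- The labels are doubled to satisfy the evenness hypothesis, which makes room for the extra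
  -- letter.
  have hD := hT.map (f := (2 * ·)) (fun a _ b _ hab => by simp only; omega)
  have hfl : (((1 :: 2 :: r) :: s :: T).map (List.map (2 * ·))).flatten =
      ((1 :: 2 :: r) :: s :: T).flatten.map (2 * ·) := by rw [List.map_flatten]
  have hgetD : (s.map (2 * ·)).getD 0 0 = 2 * s.getD 0 0 := by cases s <;> simp
  obtain ⟨hl, hlt⟩ := hD.hook_of_containmentInvariant
    (hfl ▸ hnd.map fun a b hab => Nat.mul_left_cancel two_pos hab)
    (by
      intro v hv
      change v ∈ (List.map (List.map (2 * ·)) ((1 :: 2 :: r) :: s :: T)).flatten at hv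
      rw [hfl, List.mem_map] at hv
      obtain ⟨a, -, rfl⟩ := hv
      omega) (by simp) (by rw [hgetD, List.map_cons, List.map_cons, List.getD_cons_succ, List.getD_cons_zero]; omega)
    (by
      have := hinv.map_two_mul
      rw [← readingWord_map] at this
      exact this)
  rw [List.length_map] at hl
  have hrow : ∀ R ∈ s :: T, R.length = 1 := by
    have hT' := hT.2.2.2
    clear * - hT' hl
    revert hl
    induction T generalizing s with
    | nil => simp
    | cons t T ih =>
      intro hl R hR
      rcases List.mem_cons.1 hR with rfl | hR
      · exact hl
      · refine ih t hT'.2.2.2 ?_ R hR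
        have := hT'.2.2.1.length_le
        have := List.length_pos_iff.2 hT'.2.2.2.1
        simp only [List.headD_cons] at *
        omega
  refine ⟨_, hT.eq_hookRow hp hrow fun v hv w hw => ?_⟩
  have h1 := hlt (2 * v) (List.mem_map_of_mem hv)
  rw [hgetD] at h1
  obtain ⟨x, rfl⟩ := List.length_eq_one_iff.1 hl
  simp only [List.getD_cons_zero] at h1
  rcases List.mem_append.1 (by simpa using hw : w ∈ [x] ++ T.flatten) with h | h
  · rw [List.mem_singleton.1 h]
    omega
  · have := hT.2.2.2.lt_of_mem_flatten w h
    omega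

/-- A tableau whose class has a Knuth-invariant containment relation is a superstandard hook. -/
theorem IsTableau.eq_hook_of_containmentInvariant {T : List (List ℕ)} {n : ℕ} (hT : IsTableau T)
    (hp : T.flatten.Perm (List.range' 1 n)) (hn : 1 ≤ n)
    (hinv : ContainmentInvariant (readingWord T)) :
    ∃ k, 1 ≤ k ∧ k ≤ n ∧ (T = hookRow k n ∨ T = hookCol k n) := by
  have hrd := (readingWord_perm T).trans hp
  have hnd : (readingWord T).Nodup := hrd.nodup_iff.2 (List.nodup_range' ..)
  by_cases h12 : 2 ≤ n → [1, 2].Sublist (readingWord T)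
  · obtain ⟨k, h1, h2, h3⟩ := hT.eq_hookRow_of_containmentInvariant hp hn h12 hinv
    exact ⟨k, h1, h2, Or.inl h3⟩
  · push Not at h12
    have h21 : [2, 1].Sublist (readingWord T) := by
      refine (pair_sublist_total hnd ?_ ?_ (by omega)).resolve_right h12.2 <;>
        rw [hrd.mem_iff, List.mem_range'_1] <;> omega
    -- When 2 precedes 1, the reversed reading word is used. Its tableau inherits containment
    -- invariance and has 1 before 2.
    have hr := List.nodup_reverse.2 hnd
    have hk := knuthEquiv_readingWord_wordTableau hr
    obtain ⟨k, h1, h2, h3⟩ := (isTableau_wordTableau hr).eq_hookRow_of_containmentInvariant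
      ((wordTableau_perm _).trans ((List.reverse_perm _).trans hrd)) hn
      (fun _ => (hk.pair_sublist_iff hr (by intros; omega)).1 (by simpa using h21.reverse))
      (hinv.reverse.congr hk)
    refine ⟨k, h1, h2, Or.inr ?_⟩
    have := ((finalWord_iff h1 h2 hr).2 h3).wordTableau_eq_hookCol h1 h2
    rwa [hT.wordTableau_readingWord] at this


/-! ### Standard Young tableaux as lists of rows -/

theorem isTableau_iff_getD {T : List (List ℕ)} :
    IsTableau T ↔ (∀ R ∈ T, R ≠ []) ∧ (∀ i, (T.getD i []).Pairwise (· < ·)) ∧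
      ∀ i, Above (T.getD i []) (T.getD (i + 1) []) := by
  induction T with
  | nil => simp [IsTableau, Above.nil]
  | cons R T ih =>
    rw [IsTableau, ih]
    have h0 : T.headD [] = T.getD 0 [] := by cases T <;> rfl
    rw [h0]
    constructor
    · rintro ⟨h1, h2, h3, h4, h5, h6⟩
      refine ⟨by simpa using ⟨h1, h4⟩, ?_, ?_⟩ <;> rintro (_ | i)
      · exact h2
      · exact h5 i
      · exact h3
      · exact h6 i
    · rintro ⟨h1, h2, h3⟩
      exact ⟨h1 R (by simp), h2 0, h3 0, fun R hR => h1 R (by simp [hR]), fun i => h2 (i + 1),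
        fun i => h3 (i + 1)⟩

/-- The cells of a list of rows, row by row. -/
def rowCells (T : List (List ℕ)) : List (ℕ × ℕ) :=
  (List.range T.length).flatMap fun i => (List.range (T.getD i []).length).map fun j => (i, j)

theorem mem_rowCells {T : List (List ℕ)} {c : ℕ × ℕ} :
    c ∈ rowCells T ↔ c.2 < (T.getD c.1 []).length := by
  obtain ⟨i, j⟩ := c
  simp only [rowCells, List.mem_flatMap, List.mem_range, List.mem_map, Prod.mk.injEq]
  constructor
  · rintro ⟨a, -, b, hb, rfl, rfl⟩
    exact hb
  · intro h
    refine ⟨i, ?_, j, h, rfl, rfl⟩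
    by_contra hi
    rw [List.getD_eq_default _ _ (not_lt.1 hi)] at h
    simp at h

theorem nodup_rowCells (T : List (List ℕ)) : (rowCells T).Nodup := by
  refine List.nodup_flatMap.2 ⟨fun i _ => List.nodup_range.map fun a b h => by simpa using h, ?_⟩
  refine List.nodup_range.imp fun {a b} hab => ?_
  rw [Function.onFun, List.disjoint_left]
  rintro c h1 h2
  obtain ⟨_, _, rfl⟩ := List.mem_map.1 h1
  obtain ⟨_, _, h⟩ := List.mem_map.1 h2
  exact hab (Prod.ext_iff.1 h).1.symm

theorem map_range_getD (R : List ℕ) : (List.range R.length).map (fun j => R.getD j 0) = R := by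
  refine List.ext_getElem (by simp) fun i h1 h2 => ?_
  simp [h2]

theorem flatten_eq_map_rowCells (T : List (List ℕ)) :
    T.flatten = (rowCells T).map fun c => (T.getD c.1 []).getD c.2 0 := by
  rw [rowCells, List.map_flatMap, List.flatMap_def]
  congr 1
  refine List.ext_getElem (by simp) fun i h1 h2 => ?_
  have := map_range_getD T[i]
  simp only [List.getElem_map, List.getElem_range, List.map_map, Function.comp_def,
    List.getD_eq_getElem _ _ h1]
  exact this.symm

theorem flatten_perm_range'_iff {T : List (List ℕ)} {n : ℕ} :
    T.flatten.Perm (List.range' 1 n) ↔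
      Set.BijOn (fun c : ℕ × ℕ => (T.getD c.1 []).getD c.2 0)
        {c | c.2 < (T.getD c.1 []).length} (Set.Icc 1 n) := by
  have hset : {c : ℕ × ℕ | c.2 < (T.getD c.1 []).length} = {c | c ∈ rowCells T} := by
    ext c
    exact mem_rowCells.symm
  rw [hset, flatten_eq_map_rowCells]
  generalize (fun c : ℕ × ℕ => (T.getD c.1 []).getD c.2 0) = f
  have hrange : ∀ v, v ∈ List.range' 1 n ↔ v ∈ Set.Icc 1 n := by
    intro v
    rw [List.mem_range'_1, Set.mem_Icc]
    omega
  constructor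
  · intro h
    have hinj : ∀ x ∈ rowCells T, ∀ y ∈ rowCells T, f x = f y → x = y :=
      (List.nodup_map_iff_inj_on (nodup_rowCells T)).1 (h.nodup_iff.2 (List.nodup_range' ..))
    refine ⟨fun c hc => (hrange _).1 (h.mem_iff.1 (List.mem_map_of_mem hc)),
      fun x hx y hy => hinj x hx y hy, fun v hv => ?_⟩
    simpa using h.mem_iff.2 ((hrange v).2 hv)
  · rintro ⟨h1, h2, h3⟩
    refine (List.perm_ext_iff_of_nodup
      ((List.nodup_map_iff_inj_on (nodup_rowCells T)).2 fun x hx y hy => h2 hx hy)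
      (List.nodup_range' ..)).2 fun v => ?_
    rw [hrange, List.mem_map]
    constructor
    · rintro ⟨c, hc, rfl⟩
      exact h1 hc
    · exact fun hv => h3 hv

namespace StandardYoungTableau

variable {n : ℕ} (S : StandardYoungTableau n)

theorem rows_getD (i : ℕ) :
    S.rows.getD i [] = (List.range (S.shape.rowLen i)).map fun j => S.filling i j := by
  by_cases hi : i < S.shape.colLen 0
  · rw [rows, List.getD_eq_getElem _ _ (by simpa using hi)]
    simp
  · have : S.shape.rowLen i = 0 := by
      rw [← YoungDiagram.mem_iff_lt_colLen, YoungDiagram.mem_iff_lt_rowLen] at hi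
      omega
    rw [List.getD_eq_default _ _ (by simpa [rows] using hi), this]
    rfl

theorem length_rows_getD (i : ℕ) : (S.rows.getD i []).length = S.shape.rowLen i := by
  rw [rows_getD, List.length_map, List.length_range]

theorem rows_getD_getD (i j : ℕ) : (S.rows.getD i []).getD j 0 = S.filling i j := by
  by_cases hj : j < S.shape.rowLen i
  · rw [List.getD_eq_getElem _ _ (by rwa [length_rows_getD])]
    simp only [rows_getD]
    simp
  · rw [List.getD_eq_default _ _ (by rw [length_rows_getD]; omega)]
    rw [← YoungDiagram.mem_iff_lt_rowLen] at hj
    exact (S.filling.zeros hj).symm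

theorem rows_flatten_perm : S.rows.flatten.Perm (List.range' 1 n) := by
  rw [flatten_perm_range'_iff]
  simp only [rows_getD_getD, length_rows_getD]
  have h : {c : ℕ × ℕ | c.2 < S.shape.rowLen c.1} = {c | c ∈ S.shape} := by
    ext c
    exact YoungDiagram.mem_iff_lt_rowLen.symm
  rw [h]
  exact S.bijOn

theorem isTableau_rows : IsTableau S.rows := by
  refine isTableau_iff_getD.2 ⟨fun R hR => ?_, fun i => ?_, fun i => ?_⟩
  · obtain ⟨i, hi, rfl⟩ := List.mem_map.1 hR
    rw [List.mem_range, ← YoungDiagram.mem_iff_lt_colLen, YoungDiagram.mem_iff_lt_rowLen] at hi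
    simp [hi.ne']
  · rw [rows_getD, List.pairwise_map]
    refine List.Pairwise.imp_of_mem (fun {a b} ha hb hab => ?_) List.pairwise_lt_range
    rw [List.mem_range, ← YoungDiagram.mem_iff_lt_rowLen] at ha hb
    refine (S.filling.row_weak hab hb).lt_of_ne fun h => ?_
    have : (i, a) = (i, b) := S.bijOn.injOn ha hb h
    exact hab.ne (Prod.ext_iff.1 this).2
  · refine Above.of_getD_lt ?_ fun j hj => ?_
    · rw [length_rows_getD, length_rows_getD]
      exact S.shape.rowLen_anti _ _ (by omega)
    · rw [rows_getD_getD, rows_getD_getD]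
      rw [length_rows_getD, ← YoungDiagram.mem_iff_lt_rowLen] at hj
      exact S.filling.col_strict (by omega) hj

/-- Needed for insertion tableaux: it makes every P(π) the list of rows of a standard Young tableau,
so that sets closed under Knuth equivalence are unions of the classes `knuthClass T`. -/
theorem exists_rows_eq {T : List (List ℕ)} (hT : IsTableau T)
    (hp : T.flatten.Perm (List.range' 1 n)) : ∃ S : StandardYoungTableau n, S.rows = T := by
  obtain ⟨hne, hrow, hcol⟩ := isTableau_iff_getD.1 hT
  have hlen : Antitone fun i => (T.getD i []).length :=
    antitone_nat_of_succ_le fun i => (hcol i).length_le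
  let μ : YoungDiagram := ⟨(rowCells T).toFinset, by
    rintro ⟨i, j⟩ ⟨i', j'⟩ ⟨h1, h2⟩ h
    simp only [List.coe_toFinset, Set.mem_ofPred_eq, mem_rowCells] at h ⊢
    have := hlen h1
    simp only at *
    omega⟩
  have hμ : ∀ c, c ∈ μ ↔ c.2 < (T.getD c.1 []).length := fun c => by
    rw [← mem_rowCells, ← List.mem_toFinset]
    rfl
  have hrl : ∀ i, μ.rowLen i = (T.getD i []).length := fun i => by
    have h : ∀ j, j < μ.rowLen i ↔ j < (T.getD i []).length := fun j => by
      rw [← YoungDiagram.mem_iff_lt_rowLen, hμ]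
    have := h (μ.rowLen i)
    have := h (T.getD i []).length
    omega
  have hcl : μ.colLen 0 = T.length := by
    have h : ∀ i, i < μ.colLen 0 ↔ i < T.length := fun i => by
      rw [← YoungDiagram.mem_iff_lt_colLen, hμ]
      constructor
      · intro h
        by_contra hi
        rw [List.getD_eq_default _ _ (not_lt.1 hi)] at h
        simp at h
      · intro h
        rw [List.getD_eq_getElem _ _ h]
        exact List.length_pos_iff.2 (hne _ (List.getElem_mem h))
    have := h (μ.colLen 0)
    have := h T.length
    omega
  let U : SemistandardYoungTableau μ :=
    { entry := fun i j => (T.getD i []).getD j 0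
      row_weak' := by
        intro i j₁ j₂ hj hm
        have hm' := (hμ _).1 hm
        simp only at hm'
        rw [List.getD_eq_getElem _ _ hm', List.getD_eq_getElem _ _ (hj.trans hm')]
        exact (List.pairwise_iff_getElem.1 (hrow i) _ _ _ _ hj).le
      col_strict' := by
        intro i₁ i₂ j hi hm
        induction i₂, hi using Nat.le_induction with
        | base => exact (hcol i₁).getD_lt j ((hμ _).1 hm)
        | succ i₂ hi ih =>
          exact (ih (μ.up_left_mem (Nat.le_succ i₂) le_rfl hm)).trans
            ((hcol i₂).getD_lt j ((hμ _).1 hm))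
      zeros' := by
        intro i j hm
        exact List.getD_eq_default _ _ (not_lt.1 fun h => hm ((hμ _).2 h)) }
  refine ⟨⟨μ, U, ?_⟩, ?_⟩
  · have := flatten_perm_range'_iff.1 hp
    simp only [← hμ] at this
    exact this
  · refine List.ext_getElem (by simpa [rows] using hcl) fun i h1 h2 => ?_
    simp only [rows, List.getElem_map, List.getElem_range, hrl]
    rw [List.getD_eq_getElem _ _ h2]
    have h3 : ∀ j, U i j = T[i].getD j 0 := fun j =>
      (by rw [← List.getD_eq_getElem T [] h2] : T[i].getD j 0 = _) ▸ rfl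
    simp only [h3]
    exact map_range_getD _

end StandardYoungTableau

/-! ### Superstandard hooks as standard Young tableaux -/

theorem IsTableau.eq_hookCol {r : List ℕ} {T : List (List ℕ)} {n : ℕ} (h : IsTableau ((1 :: r) :: T))
    (hp : ((1 :: r) :: T).flatten.Perm (List.range' 1 n)) (h1 : ∀ R ∈ T, R.length = 1)
    (hlt : ∀ a ∈ r, ∀ b ∈ T.flatten, b < a) :
    1 ≤ T.length + 1 ∧ T.length + 1 ≤ n ∧ (1 :: r) :: T = hookCol (T.length + 1) n := by
  have h0 := h.lt_of_mem_flatten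
  obtain ⟨l, rfl, hl⟩ := h.2.2.2.exists_eq_map_singleton h1
  have hfl : (l.map ([·])).flatten = l := by
    rw [← List.flatMap_def, List.flatMap_singleton']
  rw [List.flatten_cons] at hp
  rw [hfl] at hp hlt h0
  have hpw : (1 :: (l ++ r)).Pairwise (· < ·) := by
    refine List.pairwise_cons.2 ⟨fun v hv => ?_, List.pairwise_append.2
      ⟨hl, (List.pairwise_cons.1 h.2.1).2, fun a ha b hb => hlt b hb a ha⟩⟩
    rcases List.mem_append.1 hv with hv | hv
    · exact h0 v hv
    · exact (List.pairwise_cons.1 h.2.1).1 v hv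
  have he : 1 :: (l ++ r) = List.range' 1 n := by
    refine ((List.perm_append_comm.cons 1).trans hp).eq_of_pairwise (le := (· < ·)) ?_ hpw
      List.pairwise_lt_range'
    intro a b _ _ hab hba
    omega
  have hlen := congrArg List.length he
  simp only [List.length_cons, List.length_append, List.length_range'] at hlen
  have hsplit : List.range' 1 n =
      1 :: (List.range' 2 l.length ++ List.range' (2 + l.length) (n - (l.length + 1))) := by
    rw [List.range'_append_1, show n = l.length + (n - (l.length + 1)) + 1 by omega,
      List.range'_succ]
    congr 2
    omega
  rw [hsplit] at he
  obtain ⟨e1, e2⟩ := List.append_inj (List.cons.inj he).2 (by simp)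
  refine ⟨by omega, by simp; omega, ?_⟩
  rw [hookCol, List.length_map, Nat.add_sub_cancel, ← e1, show l.length + 1 + 1 = 2 + l.length by omega,
    ← e2]

namespace StandardYoungTableau

variable {n : ℕ} (S : StandardYoungTableau n)

theorem mem_shape_iff (i j : ℕ) : (i, j) ∈ S.shape ↔ j < (S.rows.getD i []).length := by
  rw [YoungDiagram.mem_iff_lt_rowLen, length_rows_getD]

theorem hookRow_getD_succ (k n i : ℕ) :
    (hookRow k n).getD (i + 1) [] = if i < n - k then [k + 1 + i] else [] := by
  rw [hookRow, List.getD_cons_succ]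
  split_ifs with h
  · rw [List.getD_eq_getElem _ _ (by simpa using h)]
    simp
  · rw [List.getD_eq_default _ _ (by simpa using h)]

theorem hookCol_getD_succ (k n i : ℕ) :
    (hookCol k n).getD (i + 1) [] = if i < k - 1 then [2 + i] else [] := by
  rw [hookCol, List.getD_cons_succ]
  split_ifs with h
  · rw [List.getD_eq_getElem _ _ (by simpa using h)]
    simp
  · rw [List.getD_eq_default _ _ (by simpa using h)]

theorem isSuperstandardHook_of_rows_eq_hookRow {k : ℕ} (h : S.rows = hookRow k n) :
    S.IsSuperstandardHook := by
  have hmem : ∀ i j, (i + 1, j) ∈ S.shape ↔ i < n - k ∧ j = 0 := fun i j => by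
    rw [mem_shape_iff, h, hookRow_getD_succ]
    split_ifs with hi <;> simp [hi]
  have hrow : ∀ i, i < n - k → S.shape.rowLen (i + 1) = 1 := fun i hi => by
    rw [← length_rows_getD, h, hookRow_getD_succ, if_pos hi, List.length_singleton]
  refine ⟨Or.inl fun i j hij => ?_, fun i j hij => ?_⟩
  · rw [← rows_getD_getD, h]
    cases i with
    | zero =>
      rw [mem_shape_iff, h] at hij
      rw [List.getD_eq_getElem _ _ hij]
      simp [hookRow, add_comm]
    | succ i =>
      obtain ⟨hi, rfl⟩ := (hmem i j).1 hij
      rw [hookRow_getD_succ, if_pos hi, Finset.sum_range_succ',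
        Finset.sum_congr rfl fun a ha => hrow a ((Finset.mem_range.1 ha).trans hi),
        ← length_rows_getD, h]
      simp [hookRow]
      omega
  · cases i with
    | zero => exact Or.inl rfl
    | succ i => exact Or.inr ((hmem i j).1 hij).2

theorem isSuperstandardHook_of_rows_eq_hookCol {k : ℕ} (hk : 1 ≤ k) (h : S.rows = hookCol k n) :
    S.IsSuperstandardHook := by
  have hmem : ∀ i j, (i + 1, j) ∈ S.shape ↔ i < k - 1 ∧ j = 0 := fun i j => by
    rw [mem_shape_iff, h, hookCol_getD_succ]
    split_ifs with hi <;> simp [hi]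
  have hhook : S.IsHook := fun i j hij => by
    cases i with
    | zero => exact Or.inl rfl
    | succ i => exact Or.inr ((hmem i j).1 hij).2
  have hcol0 : S.shape.colLen 0 = k := by
    have := congrArg List.length h
    simp only [rows, List.length_map, List.length_range, hookCol, List.length_cons,
      List.length_range'] at this
    omega
  have hcol : ∀ j, (0, j + 1) ∈ S.shape → S.shape.colLen (j + 1) = 1 := fun j hj => by
    rw [YoungDiagram.mem_iff_lt_colLen] at hj
    by_contra hne
    have h1 : (1, j + 1) ∈ S.shape := YoungDiagram.mem_iff_lt_colLen.2 (by omega)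
    have := hhook _ _ h1
    omega
  refine ⟨Or.inr fun i j hij => ?_, hhook⟩
  rw [← rows_getD_getD, h]
  cases i with
  | succ i =>
    obtain ⟨hi, rfl⟩ := (hmem i j).1 hij
    rw [hookCol_getD_succ, if_pos hi]
    simp
    omega
  | zero =>
    cases j with
    | zero => simp [hookCol]
    | succ j =>
      have hij' := hij
      rw [mem_shape_iff, h] at hij'
      rw [List.getD_eq_getElem _ _ hij', Finset.sum_range_succ',
        Finset.sum_congr rfl fun b hb =>
          hcol b (S.shape.up_left_mem le_rfl (by have := Finset.mem_range.1 hb; omega) hij), hcol0]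
      simp [hookCol]
      omega

/-- In a row superstandard hook every entry below the first row exceeds the length of that row and
hence all its entries. In a column superstandard hook every entry of the first row after the corner
exceeds the whole first column. Either comparison determines the list of rows. -/
theorem exists_rows_eq_hook (hn : 1 ≤ n) (h : S.IsSuperstandardHook) :
    ∃ k, 1 ≤ k ∧ k ≤ n ∧ (S.rows = hookRow k n ∨ S.rows = hookCol k n) := by
  obtain ⟨hs, hhook⟩ := h
  have hT := S.isTableau_rows
  have hp := S.rows_flatten_perm
  obtain ⟨R, T, hRT⟩ : ∃ R T, S.rows = R :: T := by
    refine List.exists_cons_of_ne_nil fun h0 => ?_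
    rw [h0] at hp
    have := hp.length_eq
    simp at this
    omega
  have hR : R = S.rows.getD 0 [] := by rw [hRT, List.getD_cons_zero]
  have hTi : ∀ i, T.getD i [] = S.rows.getD (i + 1) [] := fun i => by rw [hRT, List.getD_cons_succ]
  have hfirst : ∀ j, (hj : j < R.length) → (0, j) ∈ S.shape ∧ R[j] = S.filling 0 j := fun j hj => by
    rw [mem_shape_iff, ← hR, ← rows_getD_getD, ← hR, List.getD_eq_getElem _ _ hj]
    exact ⟨hj, rfl⟩
  have hrest : ∀ v ∈ T.flatten, ∃ i, (i + 1, 0) ∈ S.shape ∧ v = S.filling (i + 1) 0 := by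
    intro v hv
    rw [flatten_eq_map_rowCells] at hv
    obtain ⟨⟨i, j⟩, h1, rfl⟩ := List.mem_map.1 hv
    rw [mem_rowCells] at h1
    simp only [hTi, rows_getD_getD] at h1 ⊢
    rw [← mem_shape_iff] at h1
    obtain rfl : j = 0 := (hhook _ _ h1).resolve_left (by omega)
    exact ⟨i, h1, rfl⟩
  have hlen : ∀ Q ∈ T, Q.length = 1 := by
    intro Q hQ
    obtain ⟨i, hi, rfl⟩ := List.getElem_of_mem hQ
    have h1 := List.length_pos_iff.2 (hT.ne_nil T[i] (by simp [hRT, hQ]))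
    rw [← List.getD_eq_getElem T [] hi, hTi, length_rows_getD] at h1 ⊢
    by_contra hne
    have := hhook (i + 1) 1 (YoungDiagram.mem_iff_lt_rowLen.2 (by omega))
    omega
  rw [hRT] at hT hp ⊢
  rcases hs with hs | hs
  · obtain ⟨h1, h2, h3⟩ := hT.eq_hookRow hp hlen (by
      intro a ha b hb
      obtain ⟨j, hj, rfl⟩ := List.getElem_of_mem ha
      obtain ⟨i, hi, rfl⟩ := hrest b hb
      obtain ⟨hm, hj⟩ := hfirst j hj
      rw [hj, hs _ _ hm, hs _ _ hi, Finset.sum_range_succ']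
      rw [YoungDiagram.mem_iff_lt_rowLen] at hm
      simp only [Finset.range_zero, Finset.sum_empty]
      omega)
    exact ⟨_, h1, h2, Or.inl h3⟩
  · obtain ⟨b, r, rfl⟩ := List.exists_cons_of_ne_nil hT.1
    obtain rfl : b = 1 := by
      obtain ⟨hm, hb⟩ := hfirst 0 (by simp)
      rw [hs _ _ hm] at hb
      simpa using hb
    obtain ⟨h1, h2, h3⟩ := hT.eq_hookCol hp hlen (by
      intro a ha b hb
      obtain ⟨j, hj, rfl⟩ := List.getElem_of_mem ha
      obtain ⟨i, hi, rfl⟩ := hrest b hb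
      obtain ⟨hm, hj⟩ := hfirst (j + 1) (by simpa using hj)
      rw [List.getElem_cons_succ] at hj
      rw [hj, hs _ _ hm, hs _ _ hi, Finset.sum_range_succ']
      rw [YoungDiagram.mem_iff_lt_colLen] at hi
      simp only [Finset.range_zero, Finset.sum_empty]
      omega)
    exact ⟨_, h1, h2, Or.inr h3⟩

end StandardYoungTableau


/-! ### One-line notation -/

section OneLine

variable {n : ℕ}

theorem oneLine_eq_map (π : Equiv.Perm (Fin n)) :
    oneLine π = (List.finRange n).map fun i => (π i : ℕ) + 1 := by
  rw [oneLine, List.ofFn_eq_map]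

theorem length_oneLine (π : Equiv.Perm (Fin n)) : (oneLine π).length = n := by
  simp [oneLine]

theorem getElem_oneLine (π : Equiv.Perm (Fin n)) (i : ℕ) (h : i < (oneLine π).length) :
    (oneLine π)[i] = (π ⟨i, by rwa [length_oneLine] at h⟩ : ℕ) + 1 := by
  simp [oneLine]

theorem nodup_oneLine (π : Equiv.Perm (Fin n)) : (oneLine π).Nodup := by
  rw [oneLine_eq_map]
  refine (List.nodup_finRange n).map fun a b hab => π.injective (Fin.ext ?_)
  simpa using hab

theorem oneLine_perm (π : Equiv.Perm (Fin n)) : (oneLine π).Perm (List.range' 1 n) := by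
  refine (List.perm_ext_iff_of_nodup (nodup_oneLine π) (List.nodup_range' ..)).2 fun v => ?_
  rw [oneLine_eq_map, List.mem_map, List.mem_range'_1]
  constructor
  · rintro ⟨i, -, rfl⟩
    have := (π i).isLt
    omega
  · intro h
    refine ⟨π.symm ⟨v - 1, by omega⟩, List.mem_finRange _, ?_⟩
    simp
    omega

theorem exists_oneLine_eq {l : List ℕ} (h : l.Perm (List.range' 1 n)) :
    ∃ π : Equiv.Perm (Fin n), oneLine π = l := by
  have hlen : l.length = n := by simpa using h.length_eq
  have hnd : l.Nodup := h.nodup_iff.2 (List.nodup_range' ..)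
  have hmem : ∀ i (hi : i < l.length), 1 ≤ l[i] ∧ l[i] - 1 < n := fun i hi => by
    have := h.mem_iff.1 (List.getElem_mem hi)
    rw [List.mem_range'_1] at this
    omega
  have hinj : Function.Injective
      fun i : Fin n => (⟨l[(i : ℕ)] - 1, (hmem i (by omega)).2⟩ : Fin n) := by
    intro a b hab
    have h1 := (hmem a (by omega)).1
    have h2 := (hmem b (by omega)).1
    have h3 := congrArg Fin.val hab
    simp only at h3
    exact Fin.ext ((hnd.getElem_inj_iff).1 (by omega : l[(a : ℕ)] = l[(b : ℕ)]))
  refine ⟨Equiv.ofBijective _ (Finite.injective_iff_bijective.1 hinj), ?_⟩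
  refine List.ext_getElem (by rw [length_oneLine, hlen]) fun i h1 h2 => ?_
  rw [getElem_oneLine]
  simp only [Equiv.ofBijective_apply]
  have := (hmem i h2).1
  omega

theorem sublist_finRange_iff {l : List (Fin n)} :
    l.Sublist (List.finRange n) ↔ l.Pairwise (· < ·) := by
  refine ⟨fun h => (List.pairwise_lt_finRange n).sublist h, fun h => ?_⟩
  refine List.sublist_of_subperm_of_pairwise (r := (· ≤ ·)) ?_ (h.imp le_of_lt)
    ((List.pairwise_lt_finRange n).imp le_of_lt)
  exact List.subperm_of_subset (h.imp ne_of_lt) fun i _ => List.mem_finRange i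

theorem pair_sublist_oneLine_iff (π : Equiv.Perm (Fin n)) (a b : Fin n) :
    [(a : ℕ) + 1, (b : ℕ) + 1].Sublist (oneLine π) ↔ π⁻¹ a < π⁻¹ b := by
  rw [oneLine_eq_map]
  constructor
  · intro h
    obtain ⟨l, hl, he⟩ := List.sublist_map_iff.1 h
    rw [sublist_finRange_iff] at hl
    obtain ⟨i, j, rfl⟩ := List.length_eq_two.1 (by simpa using (congrArg List.length he).symm)
    simp only [List.map_cons, List.map_nil, List.cons.injEq, and_true, add_left_inj,
      Fin.val_inj] at he
    rw [he.1, he.2]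
    simpa using hl
  · intro h
    have h1 : [π⁻¹ a, π⁻¹ b].Sublist (List.finRange n) := sublist_finRange_iff.2 (by simpa using h)
    simpa using h1.map fun i => (π i : ℕ) + 1

/-- Translates pattern containment into words: the subsequence is a sublist, and standardization is
an order-preserving relabelling. The relabelling of the values used is extended arbitrarily to all
naturals. -/
theorem contains_iff {m : ℕ} {σ : Equiv.Perm (Fin m)} {π : Equiv.Perm (Fin n)} :
    Contains σ π ↔ ∃ l : List ℕ, l.Sublist (oneLine σ) ∧
      ∃ f : ℕ → ℕ, StrictMonoOn f {v | v ∈ l} ∧ l.map f = oneLine π := by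
  constructor
  · rintro ⟨e, he⟩
    have hinj : Function.Injective fun i : Fin n => (σ (e i) : ℕ) + 1 := fun a b hab =>
      e.injective (σ.injective (Fin.ext (by simpa using hab)))
    refine ⟨(List.finRange n).map fun i => (σ (e i) : ℕ) + 1, ?_,
      Function.extend (fun i : Fin n => (σ (e i) : ℕ) + 1) (fun i => (π i : ℕ) + 1) 0, ?_, ?_⟩
    · have h1 : ((List.finRange n).map e).Sublist (List.finRange m) := by
        rw [sublist_finRange_iff, List.pairwise_map]
        exact (List.pairwise_lt_finRange n).imp fun h => e.strictMono h
      have := h1.map fun i => (σ i : ℕ) + 1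
      rw [List.map_map] at this
      rwa [oneLine_eq_map]
    · intro a ha b hb hab
      obtain ⟨i, -, rfl⟩ := List.mem_map.1 ha
      obtain ⟨j, -, rfl⟩ := List.mem_map.1 hb
      rw [hinj.extend_apply, hinj.extend_apply]
      have h1 := (he i j).1 (Fin.lt_def.2 (by omega))
      have := Fin.lt_def.1 h1
      omega
    · rw [List.map_map, oneLine_eq_map]
      exact List.map_congr_left fun i _ => hinj.extend_apply _ _ i
  · rintro ⟨l, hl, f, hf, he⟩
    rw [oneLine_eq_map] at hl
    obtain ⟨l', hl', rfl⟩ := List.sublist_map_iff.1 hl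
    rw [sublist_finRange_iff] at hl'
    have hlen : l'.length = n := by
      have := congrArg List.length he
      simpa [length_oneLine] using this
    have hπ : ∀ i : Fin n, f ((σ l'[(i : ℕ)] : ℕ) + 1) = (π i : ℕ) + 1 := by
      intro i
      have h1 : i < (oneLine π).length := by rw [length_oneLine]; exact i.isLt
      have h2 := getElem_oneLine π i h1
      rw [← h2]
      simp only [← he]
      simp
    have hmono : StrictMono fun i : Fin n => l'[(i : ℕ)] := fun i j hij =>
      List.pairwise_iff_getElem.1 hl' _ _ _ _ hij
    refine ⟨OrderEmbedding.ofStrictMono _ hmono, fun i j => ?_⟩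
    change σ l'[(i : ℕ)] < σ l'[(j : ℕ)] ↔ _
    have h := hf.lt_iff_lt (a := (σ l'[(i : ℕ)] : ℕ) + 1) (b := (σ l'[(j : ℕ)] : ℕ) + 1)
      (List.mem_map_of_mem (f := fun i => (σ i : ℕ) + 1) (List.getElem_mem _))
      (List.mem_map_of_mem (f := fun i => (σ i : ℕ) + 1) (List.getElem_mem _))
    rw [hπ, hπ] at h
    rw [Fin.lt_def, Fin.lt_def]
    omega

/-- Every word without repeated letters has a standardization. -/
theorem exists_standardization {w : List ℕ} (hw : w.Nodup) :
    ∃ g : ℕ → ℕ, StrictMonoOn g {v | v ∈ w} ∧ (w.map g).Perm (List.range' 1 w.length) := by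
  have hmono : StrictMonoOn (fun v => w.countP (· ≤ v)) {v | v ∈ w} := by
    intro a ha b hb hab
    simp only [List.countP_eq_length_filter]
    have hsub : (w.filter (· ≤ a)).Sublist (w.filter (· ≤ b)) := by
      refine List.monotone_filter_right w fun v hv => ?_
      simp only [decide_eq_true_eq] at hv ⊢
      omega
    refine hsub.length_le.lt_of_ne fun h => ?_
    have := hsub.eq_of_length h
    have h1 : b ∈ w.filter (· ≤ b) := by simpa using hb
    rw [← this] at h1
    simp at h1
    omega
  refine ⟨_, hmono, ?_⟩
  have hnd : (w.map fun v => w.countP (· ≤ v)).Nodup :=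
    (List.nodup_map_iff_inj_on hw).2 fun a ha b hb => hmono.injOn ha hb
  refine (List.subperm_of_subset hnd fun v hv => ?_).perm_of_length_le (by simp)
  obtain ⟨a, ha, rfl⟩ := List.mem_map.1 hv
  rw [List.mem_range'_1]
  have h1 : 0 < w.countP (· ≤ a) := List.countP_pos_iff.2 ⟨a, ha, by simp⟩
  have h2 : w.countP (· ≤ a) ≤ w.length := List.countP_le_length
  omega

theorem knuthEquiv_iff_insertionTableau_eq {σ τ : Equiv.Perm (Fin n)} :
    KnuthEquiv (oneLine σ) (oneLine τ) ↔ insertionTableau σ = insertionTableau τ :=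
  (wordTableau_eq_iff (nodup_oneLine σ) (nodup_oneLine τ)).symm

theorem mem_knuthClass_iff {S : StandardYoungTableau n} {π : Equiv.Perm (Fin n)} :
    π ∈ knuthClass S ↔ KnuthEquiv (oneLine π) (readingWord S.rows) := by
  have h := (readingWord_perm S.rows).trans S.rows_flatten_perm
  rw [← wordTableau_eq_iff (nodup_oneLine π) (h.nodup_iff.2 (List.nodup_range' ..)),
    S.isTableau_rows.wordTableau_readingWord]
  rfl

theorem exists_mem_knuthClass (S : StandardYoungTableau n) :
    ∃ π ∈ knuthClass S, oneLine π = readingWord S.rows := by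
  obtain ⟨π, hπ⟩ := exists_oneLine_eq ((readingWord_perm S.rows).trans S.rows_flatten_perm)
  exact ⟨π, mem_knuthClass_iff.2 (hπ ▸ .refl _), hπ⟩

theorem exists_rows_eq_insertionTableau (π : Equiv.Perm (Fin n)) :
    ∃ S : StandardYoungTableau n, S.rows = insertionTableau π :=
  StandardYoungTableau.exists_rows_eq (isTableau_wordTableau (nodup_oneLine π))
    ((wordTableau_perm _).trans (oneLine_perm π))

/-- Being a union of Knuth classes means being closed under Knuth equivalence. -/
theorem isUnionOfKnuthClasses_iff {B : Set (Equiv.Perm (Fin n))} :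
    IsUnionOfKnuthClasses B ↔
      ∀ σ τ, KnuthEquiv (oneLine σ) (oneLine τ) → σ ∈ B → τ ∈ B := by
  simp only [knuthEquiv_iff_insertionTableau_eq]
  constructor
  · rintro ⟨𝒯, rfl⟩ σ τ h hσ
    obtain ⟨T, hT, hσT⟩ := Set.mem_iUnion₂.1 hσ
    exact Set.mem_iUnion₂.2 ⟨T, hT, h.symm.trans hσT⟩
  · intro h
    refine ⟨{T | ∃ σ ∈ B, insertionTableau σ = T.rows}, ?_⟩
    ext τ
    rw [Set.mem_iUnion₂]
    constructor
    · intro hτ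
      obtain ⟨T, hT⟩ := exists_rows_eq_insertionTableau τ
      exact ⟨T, ⟨τ, hτ, hT.symm⟩, hT.symm⟩
    · rintro ⟨T, ⟨σ, hσ, hσT⟩, hτ⟩
      exact h σ τ (hσT.trans hτ.symm) hσ

theorem exists_contains_knuthClass_iff {m : ℕ} {S : StandardYoungTableau n}
    {σ : Equiv.Perm (Fin m)} :
    (∃ π ∈ knuthClass S, Contains σ π) ↔ ContainsClass (readingWord S.rows) (oneLine σ) := by
  constructor
  · rintro ⟨π, hπ, h⟩
    obtain ⟨l, hl, f, hf, he⟩ := contains_iff.1 h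
    exact ⟨l, hl, f, hf, he ▸ mem_knuthClass_iff.1 hπ⟩
  · rintro ⟨l, hl, f, hf, hk⟩
    obtain ⟨π, hπ⟩ := exists_oneLine_eq
      (hk.perm.trans ((readingWord_perm S.rows).trans S.rows_flatten_perm))
    exact ⟨π, mem_knuthClass_iff.2 (hπ ▸ hk), contains_iff.2 ⟨l, hl, f, hf, hπ.symm⟩⟩

theorem exists_leftInverse_of_strictMonoOn {g : ℕ → ℕ} {s : Set ℕ} (hg : StrictMonoOn g s) :
    ∃ g' : ℕ → ℕ, (∀ v ∈ s, g' (g v) = v) ∧ StrictMonoOn g' (g '' s) := by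
  have h : ∀ v ∈ s, Function.invFunOn g s (g v) = v := hg.injOn.leftInvOn_invFunOn
  refine ⟨Function.invFunOn g s, h, ?_⟩
  rintro _ ⟨a, ha, rfl⟩ _ ⟨b, hb, rfl⟩ hab
  rw [h a ha, h b hb]
  exact (hg.lt_iff_lt ha hb).1 hab

theorem containsClass_map_iff {c w : List ℕ} {g : ℕ → ℕ} (hg : StrictMonoOn g {v | v ∈ w}) :
    ContainsClass c (w.map g) ↔ ContainsClass c w := by
  constructor
  · rintro ⟨l, hl, f, hf, hk⟩
    obtain ⟨l', hl', rfl⟩ := List.sublist_map_iff.1 hl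
    refine ⟨l', hl', f ∘ g, fun a ha b hb hab => ?_, by rwa [← List.map_map]⟩
    exact hf (List.mem_map_of_mem ha) (List.mem_map_of_mem hb)
      (hg (hl'.subset ha) (hl'.subset hb) hab)
  · rintro ⟨l, hl, f, hf, hk⟩
    obtain ⟨g', h1, h2⟩ := exists_leftInverse_of_strictMonoOn
      (hg.mono fun v (hv : v ∈ l) => hl.subset hv)
    refine ⟨l.map g, hl.map g, f ∘ g', fun a ha b hb hab => ?_, ?_⟩
    · obtain ⟨a, ha', rfl⟩ := List.mem_map.1 ha
      obtain ⟨b, hb', rfl⟩ := List.mem_map.1 hb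
      have := h2 ⟨a, ha', rfl⟩ ⟨b, hb', rfl⟩ hab
      simp only [Function.comp]
      rw [h1 a ha', h1 b hb'] at this ⊢
      exact hf ha' hb' this
    · have : (l.map g).map (f ∘ g') = l.map f := by
        rw [List.map_map]
        exact List.map_congr_left fun v hv => congrArg f (h1 v hv)
      rwa [this]

/-- Standardizing one of two equivalent words standardizes the other by the same relabelling, since
they have the same letters. This reduces arbitrary words to permutations, to which closure of the
avoiders applies in contrapositive form. -/
theorem PatternKnuthClosed.containmentInvariant {S : StandardYoungTableau n}
    (h : PatternKnuthClosed (knuthClass S)) : ContainmentInvariant (readingWord S.rows) := by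
  intro w w' hw hk hc
  obtain ⟨g, hg, hp⟩ := exists_standardization hw
  have hg' : StrictMonoOn g {v | v ∈ w'} := hg.mono fun v hv => hk.perm.mem_iff.2 hv
  have hk' := hk.map hg
  obtain ⟨σ, hσ⟩ := exists_oneLine_eq hp
  obtain ⟨τ, hτ⟩ := exists_oneLine_eq (hk'.perm.symm.trans hp)
  rw [← containsClass_map_iff hg', ← hτ, ← exists_contains_knuthClass_iff]
  rw [← containsClass_map_iff hg, ← hσ, ← exists_contains_knuthClass_iff] at hc
  by_contra hτ'
  obtain ⟨π, hπ, hσπ⟩ := hc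
  refine isUnionOfKnuthClasses_iff.1 (h w.length) τ σ ?_ ?_ π hπ hσπ
  · rw [hσ, hτ]
    exact hk'.symm
  · exact fun π hπ h => hτ' ⟨π, hπ, h⟩

end OneLine


/-! ### Swaps -/

section Swap

variable {n : ℕ}

theorem exists_isSwap_of_oneLine_eq {π : Equiv.Perm (Fin n)} {u v : List ℕ} {a b : ℕ}
    (h : oneLine π = u ++ [a, b] ++ v) (hab : a + 1 < b ∨ b + 1 < a) :
    ∃ σ, IsSwap π σ ∧ oneLine σ = u ++ [b, a] ++ v := by
  have hlen := congrArg List.length h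
  simp only [length_oneLine, List.length_append, List.length_cons, List.length_nil] at hlen
  have hval : ∀ t (ht : t < n), (π ⟨t, ht⟩ : ℕ) + 1 = (u ++ [a, b] ++ v)[t]'(by
      rw [← h, length_oneLine]; exact ht) := fun t ht => by
    rw [← getElem_oneLine π t (by rwa [length_oneLine])]
    simp only [h]
  let i : Fin n := ⟨u.length, by omega⟩
  let j : Fin n := ⟨u.length + 1, by omega⟩
  have hi : (π i : ℕ) + 1 = a := by rw [hval]; simp
  have hj : (π j : ℕ) + 1 = b := by rw [hval]; simp
  refine ⟨π * Equiv.swap i j, ⟨i, j, rfl, ?_, rfl⟩, ?_⟩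
  · rw [lt_abs]
    omega
  · refine List.ext_getElem (by simp [length_oneLine]; omega) fun t h1 h2 => ?_
    rw [getElem_oneLine, Equiv.Perm.mul_apply]
    by_cases hti : t = u.length
    · subst hti
      rw [show (⟨u.length, _⟩ : Fin n) = i from rfl, Equiv.swap_apply_left, hj]
      simp
    · by_cases htj : t = u.length + 1
      · subst htj
        rw [show (⟨u.length + 1, _⟩ : Fin n) = j from rfl, Equiv.swap_apply_right, hi]
        simp
      · rw [Equiv.swap_apply_of_ne_of_ne (by simpa [i] using hti) (by simpa [j] using htj), hval]
        by_cases htu : t < u.length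
        · simp [htu]
        · obtain ⟨s, rfl⟩ : ∃ s, t = u.length + (s + 2) := ⟨t - u.length - 2, by omega⟩
          simp

/-- The word `l` is order isomorphic to an element of `A`. -/
def IsPatternOf (A : Set (Equiv.Perm (Fin n))) (l : List ℕ) : Prop :=
  ∃ f : ℕ → ℕ, StrictMonoOn f {v | v ∈ l} ∧ ∃ π ∈ A, l.map f = oneLine π

theorem IsPatternOf.of_map {A : Set (Equiv.Perm (Fin n))} {l : List ℕ} {g : ℕ → ℕ}
    (h : IsPatternOf A l) (hg : StrictMonoOn g {v | v ∈ l}) : IsPatternOf A (l.map g) := by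
  obtain ⟨f, hf, π, hπ, he⟩ := h
  obtain ⟨g', h1, h2⟩ := exists_leftInverse_of_strictMonoOn hg
  refine ⟨f ∘ g', fun a ha b hb hab => ?_, π, hπ, ?_⟩
  · obtain ⟨a, ha', rfl⟩ := List.mem_map.1 ha
    obtain ⟨b, hb', rfl⟩ := List.mem_map.1 hb
    have := h2 ⟨a, ha', rfl⟩ ⟨b, hb', rfl⟩ hab
    simp only [Function.comp]
    rw [h1 a ha', h1 b hb'] at this ⊢
    exact hf ha' hb' this
  · rw [← he, List.map_map]
    exact List.map_congr_left fun v hv => congrArg f (h1 v hv)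

/-- A letter of value strictly between a and b makes their images under standardization differ by
more than 1, so exchanging them is a swap. -/
theorem IsPatternOf.swap {A : Set (Equiv.Perm (Fin n))} (hA : SwapClosed A) {u v : List ℕ}
    {a b c : ℕ} (h : IsPatternOf A (u ++ [a, b] ++ v)) (hc : c ∈ u ++ [a, b] ++ v)
    (hac : a < c ∧ c < b ∨ b < c ∧ c < a) : IsPatternOf A (u ++ [b, a] ++ v) := by
  obtain ⟨f, hf, π, hπ, he⟩ := h
  have hfab : f a + 1 < f b ∨ f b + 1 < f a := by
    rcases hac with ⟨h1, h2⟩ | ⟨h1, h2⟩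
    · have := hf (by simp) hc h1
      have := hf hc (by simp) h2
      omega
    · have := hf (by simp) hc h1
      have := hf hc (by simp) h2
      omega
  obtain ⟨σ, hσ, hσe⟩ := exists_isSwap_of_oneLine_eq (π := π) (u := u.map f) (v := v.map f)
    (a := f a) (b := f b) (by rw [← he]; simp) hfab
  refine ⟨f, hf.mono fun w hw => ?_, σ, hA π hπ σ (.single hσ), by rw [hσe]; simp⟩
  simp only [Set.mem_ofPred_eq, List.mem_append, List.mem_cons, List.not_mem_nil, or_false] at hw ⊢
  tauto

/-- The core of the step from swap closure to pattern-Knuth closure. Either some letter of the word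
separates a and b in value and a swap is possible, or none does and y can stand in for either of
them without changing the relative order. -/
theorem IsPatternOf.swap_or_replace {A : Set (Equiv.Perm (Fin n))} (hA : SwapClosed A)
    {u v : List ℕ} {a b y : ℕ} (h : IsPatternOf A (u ++ [a, b] ++ v))
    (hn : (u ++ [a, b] ++ v).Nodup) (hy : a < y ∧ y < b ∨ b < y ∧ y < a) :
    IsPatternOf A (u ++ [b, a] ++ v) ∨
      IsPatternOf A (u ++ [y, b] ++ v) ∧ IsPatternOf A (u ++ [a, y] ++ v) := by
  by_cases hc : ∃ c ∈ u ++ [a, b] ++ v, a < c ∧ c < b ∨ b < c ∧ c < a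
  · obtain ⟨c, hc, hac⟩ := hc
    exact Or.inl (h.swap hA hc hac)
  push Not at hc
  -- No letter of the word lies strictly between a and b in value, so moving one of them to y is
  -- order-preserving.
  have key : ∀ d ∈ [a, b], IsPatternOf A
      ((u ++ [a, b] ++ v).map (Function.update id d y)) := by
    intro d hd
    refine h.of_map fun p hp q hq hpq => ?_
    have h1 := hc p hp
    have h2 := hc q hq
    simp only [List.mem_cons, List.not_mem_nil, or_false] at hd
    simp only [Function.update_apply, id]
    split_ifs <;> omega
  have hid : ∀ d, ∀ l : List ℕ, d ∉ l → l.map (Function.update id d y) = l := by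
    intro d l hd
    conv_rhs => rw [← List.map_id l]
    refine List.map_congr_left fun x hx => Function.update_of_ne ?_ _ _
    rintro rfl
    exact hd hx
  have hab : a ≠ b := by omega
  rw [List.append_assoc, List.nodup_append] at hn
  have hn2 := hn.2.1
  simp only [List.cons_append, List.nil_append, List.nodup_cons, List.mem_cons, not_or] at hn2
  have hu : ∀ d ∈ [a, b], d ∉ u := fun d hd hdu => hn.2.2 d hdu d (by
    rw [List.mem_append]; exact Or.inl hd) rfl
  refine Or.inr ⟨?_, ?_⟩
  · have := key a (by simp)
    rw [List.map_append, List.map_append, hid a u (hu a (by simp)), hid a v hn2.1.2] at this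
    simpa [Function.update_apply, hab.symm] using this
  · have := key b (by simp)
    rw [List.map_append, List.map_append, hid b u (hu b (by simp)), hid b v hn2.2.1] at this
    simpa [Function.update_apply, hab] using this

theorem sublist_triple {t : List ℕ} {a b c : ℕ} (h : t.Sublist [a, b, c]) :
    t = [] ∨ t = [a] ∨ t = [b] ∨ t = [a, b] ∨ t = [c] ∨ t = [a, c] ∨ t = [b, c] ∨
      t = [a, b, c] := by
  simpa [List.sublists] using List.mem_sublists.2 h

theorem exists_isPatternOf_of_triple {A : Set (Equiv.Perm (Fin n))} (hA : SwapClosed A)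
    {u v l p q : List ℕ} (hpq : KnuthTriple p q ∨ KnuthTriple q p) (hn : (u ++ p ++ v).Nodup)
    (hl : l.Sublist (u ++ p ++ v)) (h : IsPatternOf A l) :
    ∃ l', l'.Sublist (u ++ q ++ v) ∧ IsPatternOf A l' := by
  obtain ⟨l₁, v', rfl, hl₁, hv⟩ := List.sublist_append_iff.1 hl
  obtain ⟨u', t, rfl, hu, ht⟩ := List.sublist_append_iff.1 hl₁
  have hnd := hn.sublist hl
  have keep : ∀ t', t' ∈ q.sublists → IsPatternOf A (u' ++ t' ++ v') →
      ∃ l', l'.Sublist (u ++ q ++ v) ∧ IsPatternOf A l' := fun t' h1 h2 =>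
    ⟨_, (hu.append (List.mem_sublists.1 h1)).append hv, h2⟩
  -- When the subsequence uses only the two exchanged letters of the triple, the witness c can
  -- replace one of them: it stays at the same end of the triple, so it forms a correctly ordered
  -- pair in q with b if it is first and with a if it is last.
  have swap : ∀ a b c, t = [a, b] → a < c ∧ c < b ∨ b < c ∧ c < a →
      [b, a] ∈ q.sublists → [c, b] ∈ q.sublists ∨ [a, c] ∈ q.sublists →
      ∃ l', l'.Sublist (u ++ q ++ v) ∧ IsPatternOf A l' := by
    rintro a b c rfl hc h1 h2
    rcases h.swap_or_replace hA hnd hc with h | ⟨h3, h4⟩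
    · exact keep _ h1 h
    · exact h2.elim (keep _ · h3) (keep _ · h4)
  rcases hpq with hpq | hpq
  · cases hpq with
    | @left x y z hxy hyz =>
      rcases sublist_triple ht with rfl | rfl | rfl | rfl | rfl | rfl | rfl | rfl
      -- The subsequence uses the whole triple, so y itself separates x and z and the move is a swap
      -- of the pattern. All remaining subsequences without both x and z also occur in q.
      on_goal 8 =>
        have := IsPatternOf.swap hA (u := u' ++ [y]) (v := v') (a := x) (b := z) (c := y)
          (by simpa using h) (by simp) (by omega)
        exact keep [y, z, x] (by simp [List.sublists]) (by simpa using this)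
      all_goals first
        | refine keep _ ?_ h; simp [List.sublists]; done
        | exact swap _ _ y rfl (by omega) (by simp [List.sublists]) (by simp [List.sublists])
    | @right x y z hxy hyz =>
      rcases sublist_triple ht with rfl | rfl | rfl | rfl | rfl | rfl | rfl | rfl
      on_goal 8 =>
        have := IsPatternOf.swap hA (u := u') (v := y :: v') (a := x) (b := z) (c := y)
          (by simpa using h) (by simp) (by omega)
        exact keep [z, x, y] (by simp [List.sublists]) (by simpa using this)
      all_goals first
        | refine keep _ ?_ h; simp [List.sublists]; done
        | exact swap _ _ y rfl (by omega) (by simp [List.sublists]) (by simp [List.sublists])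
  · cases hpq with
    | @left x y z hxy hyz =>
      rcases sublist_triple ht with rfl | rfl | rfl | rfl | rfl | rfl | rfl | rfl
      on_goal 8 =>
        have := IsPatternOf.swap hA (u := u' ++ [y]) (v := v') (a := z) (b := x) (c := y)
          (by simpa using h) (by simp) (by omega)
        exact keep [y, x, z] (by simp [List.sublists]) (by simpa using this)
      all_goals first
        | refine keep _ ?_ h; simp [List.sublists]; done
        | exact swap _ _ y rfl (by omega) (by simp [List.sublists]) (by simp [List.sublists])
    | @right x y z hxy hyz =>
      rcases sublist_triple ht with rfl | rfl | rfl | rfl | rfl | rfl | rfl | rfl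
      on_goal 8 =>
        have := IsPatternOf.swap hA (u := u') (v := y :: v') (a := z) (b := x) (c := y)
          (by simpa using h) (by simp) (by omega)
        exact keep [x, z, y] (by simp [List.sublists]) (by simpa using this)
      all_goals first
        | refine keep _ ?_ h; simp [List.sublists]; done
        | exact swap _ _ y rfl (by omega) (by simp [List.sublists]) (by simp [List.sublists])

theorem SwapClosed.patternKnuthClosed {A : Set (Equiv.Perm (Fin n))} (hA : SwapClosed A) :
    PatternKnuthClosed A := by
  intro m
  have key : ∀ w w', w.Nodup → KnuthEquiv w w' →
      ((∃ l, l.Sublist w ∧ IsPatternOf A l) ↔ ∃ l, l.Sublist w' ∧ IsPatternOf A l) := by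
    intro w w' hw h
    refine h.iff_of_step (p := fun w => ∃ l, l.Sublist w ∧ IsPatternOf A l) ?_ hw
    intro w w' hw hs
    have hw' := hs.perm.nodup_iff.1 hw
    obtain ⟨u, v, p, q, hpq, rfl, rfl⟩ := hs
    constructor
    · rintro ⟨l, hl, h⟩
      exact exists_isPatternOf_of_triple hA (Or.inl hpq) hw hl h
    · rintro ⟨l, hl, h⟩
      exact exists_isPatternOf_of_triple hA (Or.inr hpq) hw' hl h
  have hmem : ∀ σ, σ ∈ avoiders A m ↔ ¬ ∃ l, l.Sublist (oneLine σ) ∧ IsPatternOf A l := by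
    intro σ
    rw [not_iff_not.symm, not_not]
    constructor
    · intro h
      by_contra h'
      refine h fun π hπ hc => h' ?_
      obtain ⟨l, hl, f, hf, he⟩ := contains_iff.1 hc
      exact ⟨l, hl, f, hf, π, hπ, he⟩
    · rintro ⟨l, hl, f, hf, π, hπ, he⟩ h
      exact h π hπ (contains_iff.2 ⟨l, hl, f, hf, he⟩)
  rw [isUnionOfKnuthClasses_iff]
  intro σ τ h hσ
  rw [hmem] at hσ ⊢
  rwa [← key _ _ (nodup_oneLine σ) h]

end Swap

/-! ### Descents of the inverse -/

section Descent

variable {n : ℕ}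

theorem mem_descentSet_inv_iff {π : Equiv.Perm (Fin n)} {d : ℕ} :
    d ∈ descentSet π⁻¹ ↔ 1 ≤ d ∧ d < n ∧ [d + 1, d].Sublist (oneLine π) := by
  constructor
  · rintro ⟨i, j, hi, hj, hij⟩
    rw [← pair_sublist_oneLine_iff, hi, hj] at hij
    exact ⟨by omega, by omega, hij⟩
  · rintro ⟨h1, h2, h3⟩
    refine ⟨⟨d - 1, by omega⟩, ⟨d, h2⟩, by simp; omega, rfl, ?_⟩
    rw [← pair_sublist_oneLine_iff]
    simpa [Nat.sub_add_cancel h1] using h3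

theorem mem_invDescentClass_iff {J : Set ℕ} {π : Equiv.Perm (Fin n)} :
    π ∈ invDescentClass n J ↔ descentSet π⁻¹ = J := by
  constructor
  · rintro ⟨σ, hσ, rfl⟩
    rw [inv_inv]
    exact hσ
  · intro h
    exact ⟨π⁻¹, h, inv_inv π⟩

theorem asc_iff_not_desc (π : Equiv.Perm (Fin n)) {i : ℕ} (h1 : 1 ≤ i) (h2 : i < n) :
    [i, i + 1].Sublist (oneLine π) ↔ ¬ [i + 1, i].Sublist (oneLine π) := by
  have hmem : ∀ v, 1 ≤ v → v ≤ n → v ∈ oneLine π := fun v hv hv' => by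
    rw [(oneLine_perm π).mem_iff, List.mem_range'_1]
    omega
  refine ⟨pair_sublist_asymm (nodup_oneLine π) (by omega), fun h => ?_⟩
  exact (pair_sublist_total (nodup_oneLine π) (hmem i h1 h2.le) (hmem (i + 1) (by omega) h2)
    (by omega)).resolve_right h

theorem descentSet_inv_eq_Icc_iff {π : Equiv.Perm (Fin n)} {k : ℕ} (hk : 1 ≤ k) (hkn : k ≤ n) :
    descentSet π⁻¹ = Set.Icc k (n - 1) ↔ FinalWord k n (oneLine π) := by
  simp only [Set.ext_iff, mem_descentSet_inv_iff, Set.mem_Icc]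
  constructor
  · intro h
    refine ⟨oneLine_perm π, fun i h1 h2 => ?_, fun i h1 h2 => ((h i).2 (by omega)).2.2⟩
    rw [asc_iff_not_desc π h1 (by omega)]
    intro hd
    have := (h i).1 ⟨h1, by omega, hd⟩
    omega
  · rintro ⟨-, h1, h2⟩ i
    constructor
    · rintro ⟨h3, h4, h5⟩
      refine ⟨?_, by omega⟩
      by_contra hik
      exact (asc_iff_not_desc π h3 h4).1 (h1 i h3 (by omega)) h5
    · exact fun ⟨h3, h4⟩ => ⟨by omega, by omega, h2 i h3 (by omega)⟩

/-- Reversing a word exchanges ascents and descents of the inverse, so the initial interval up to k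
becomes the final interval from k + 1. -/
theorem descentSet_inv_eq_Icc_one_iff {π : Equiv.Perm (Fin n)} {k : ℕ} (hk : k < n) :
    descentSet π⁻¹ = Set.Icc 1 k ↔ FinalWord (k + 1) n (oneLine π).reverse := by
  have hrev : ∀ a b, [a, b].Sublist (oneLine π).reverse ↔ [b, a].Sublist (oneLine π) := fun a b => by
    rw [← List.reverse_sublist (l₁ := [b, a])]
    rfl
  simp only [Set.ext_iff, mem_descentSet_inv_iff, Set.mem_Icc, FinalWord, hrev]
  constructor
  · intro h
    refine ⟨(List.reverse_perm _).trans (oneLine_perm π),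
      fun i h1 h2 => ((h i).2 (by omega)).2.2, fun i h1 h2 => ?_⟩
    rw [asc_iff_not_desc π (by omega) h2]
    intro hd
    have := (h i).1 ⟨by omega, h2, hd⟩
    omega
  · rintro ⟨-, h1, h2⟩ i
    constructor
    · rintro ⟨h3, h4, h5⟩
      refine ⟨h3, ?_⟩
      by_contra hik
      exact (asc_iff_not_desc π h3 h4).1 (h2 i (by omega) h4) h5
    · exact fun ⟨h3, h4⟩ => ⟨h3, by omega, h1 i h3 (by omega)⟩

/-- An inclusion suffices because swaps are symmetric. The relative order of two values can change
only if they are the two exchanged ones, and a swap never exchanges consecutive values. -/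
theorem descentSet_inv_subset_of_isSwap {π σ : Equiv.Perm (Fin n)} (h : IsSwap π σ) :
    descentSet π⁻¹ ⊆ descentSet σ⁻¹ := by
  obtain ⟨i, j, hij, hd, rfl⟩ := h
  rintro d ⟨a, b, ha, hb, hab⟩
  refine ⟨a, b, ha, hb, ?_⟩
  rw [mul_inv_rev, Equiv.swap_inv, Equiv.Perm.mul_apply, Equiv.Perm.mul_apply]
  -- With b before a, this is the only arrangement in which transposing the neighbouring positions i
  -- and j reverses their order.
  have hne : ¬ (π⁻¹ b = i ∧ π⁻¹ a = j) := by
    rintro ⟨h1, h2⟩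
    rw [Equiv.Perm.inv_eq_iff_eq] at h1 h2
    rw [← h1, ← h2, lt_abs] at hd
    omega
  rw [Equiv.swap_apply_def, Equiv.swap_apply_def]
  generalize π⁻¹ a = p at *
  generalize π⁻¹ b = q at *
  simp only [Fin.lt_def, Fin.ext_iff] at *
  split_ifs <;> omega

theorem IsSwap.symm {π σ : Equiv.Perm (Fin n)} (h : IsSwap π σ) : IsSwap σ π := by
  obtain ⟨i, j, hij, hd, rfl⟩ := h
  refine ⟨i, j, hij, ?_, by rw [mul_assoc, Equiv.swap_mul_self, mul_one]⟩
  rw [Equiv.Perm.mul_apply, Equiv.Perm.mul_apply, Equiv.swap_apply_left, Equiv.swap_apply_right,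
    abs_sub_comm]
  exact hd

theorem swapClosed_invDescentClass (J : Set ℕ) : SwapClosed (invDescentClass n J) := by
  intro π hπ σ h
  induction h with
  | refl => exact hπ
  | tail _ hs ih =>
    rw [mem_invDescentClass_iff] at ih ⊢
    rw [← ih]
    exact (descentSet_inv_subset_of_isSwap hs.symm).antisymm (descentSet_inv_subset_of_isSwap hs)

end Descent


/-! ### The equivalence -/

namespace StandardYoungTableau

variable {n : ℕ} (S : StandardYoungTableau n)

theorem not_mem_shape_of_eq_zero (hn : n = 0) (i j : ℕ) : (i, j) ∉ S.shape := by
  intro h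
  have := S.bijOn.mapsTo h
  rw [Set.mem_Icc] at this
  omega

theorem isSuperstandardHook_of_eq_zero (hn : n = 0) : S.IsSuperstandardHook :=
  ⟨Or.inl fun i j h => (S.not_mem_shape_of_eq_zero hn i j h).elim,
    fun i j h => (S.not_mem_shape_of_eq_zero hn i j h).elim⟩

theorem knuthClass_eq_invDescentClass_of_rows_eq_hookRow {k : ℕ} (hk : 1 ≤ k) (hkn : k ≤ n)
    (h : S.rows = hookRow k n) : knuthClass S = invDescentClass n (Set.Icc k (n - 1)) := by
  ext π
  rw [mem_invDescentClass_iff, descentSet_inv_eq_Icc_iff hk hkn,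
    finalWord_iff hk hkn (nodup_oneLine π), ← h]
  rfl

theorem knuthClass_eq_invDescentClass_of_rows_eq_hookCol {k : ℕ} (hkn : k < n)
    (h : S.rows = hookCol (k + 1) n) : knuthClass S = invDescentClass n (Set.Icc 1 k) := by
  ext π
  rw [mem_invDescentClass_iff, descentSet_inv_eq_Icc_one_iff hkn,
    finalWord_reverse_iff (by omega) hkn (nodup_oneLine π), ← h]
  rfl

theorem exists_interval_of_isSuperstandardHook (h : S.IsSuperstandardHook) :
    ∃ J : Set ℕ, J ⊆ Set.Icc 1 (n - 1) ∧ (∃ k : ℕ, J = Set.Icc 1 k ∨ J = Set.Icc k (n - 1)) ∧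
      knuthClass S = invDescentClass n J := by
  rcases Nat.eq_zero_or_pos n with hn | hn
  · refine ⟨∅, Set.empty_subset _, ⟨0, Or.inl (by simp)⟩, ?_⟩
    obtain ⟨π₀, hπ₀, -⟩ := exists_mem_knuthClass S
    subst hn
    ext π
    rw [Subsingleton.elim π π₀, mem_invDescentClass_iff]
    refine iff_of_true hπ₀ (Set.eq_empty_of_forall_notMem ?_)
    rintro d ⟨i, -⟩
    exact i.elim0
  · obtain ⟨k, h1, h2, h | h⟩ := S.exists_rows_eq_hook hn h
    · exact ⟨Set.Icc k (n - 1), Set.Icc_subset_Icc_left h1, ⟨k, Or.inr rfl⟩,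
        S.knuthClass_eq_invDescentClass_of_rows_eq_hookRow h1 h2 h⟩
    · obtain ⟨k, rfl⟩ := Nat.exists_eq_add_of_le' h1
      exact ⟨Set.Icc 1 k, Set.Icc_subset_Icc_right (by omega), ⟨k, Or.inl rfl⟩,
        S.knuthClass_eq_invDescentClass_of_rows_eq_hookCol h2 h⟩

theorem isSuperstandardHook_of_exists_interval
    (h : ∃ J : Set ℕ, J ⊆ Set.Icc 1 (n - 1) ∧
      (∃ k : ℕ, J = Set.Icc 1 k ∨ J = Set.Icc k (n - 1)) ∧ knuthClass S = invDescentClass n J) :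
    S.IsSuperstandardHook := by
  rcases Nat.eq_zero_or_pos n with hn | hn
  · exact S.isSuperstandardHook_of_eq_zero hn
  obtain ⟨J, hJ, ⟨k, hk⟩, hS⟩ := h
  obtain ⟨π, hπ, -⟩ := exists_mem_knuthClass S
  have hd := mem_invDescentClass_iff.1 (hS ▸ hπ)
  have hrows : wordTableau (oneLine π) = S.rows := hπ
  rcases hk with rfl | rfl
  · have hkn : k < n := by
      by_contra hkn
      have := (hJ (Set.mem_Icc.2 ⟨by omega, le_refl k⟩)).2
      omega
    rw [descentSet_inv_eq_Icc_one_iff hkn,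
      finalWord_reverse_iff (by omega) hkn (nodup_oneLine π), hrows] at hd
    exact S.isSuperstandardHook_of_rows_eq_hookCol (by omega) hd
  · obtain ⟨k, hk, hkn, hd⟩ : ∃ k, 1 ≤ k ∧ k ≤ n ∧ descentSet π⁻¹ = Set.Icc k (n - 1) := by
      by_cases hkn : k ≤ n - 1
      · exact ⟨k, (hJ (Set.mem_Icc.2 ⟨le_rfl, hkn⟩)).1, by omega, hd⟩
      -- Any k > n - 1 gives the empty interval, which is normalised to k = n: the one-row tableau.
      · refine ⟨n, hn, le_rfl, hd.trans ?_⟩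
        rw [Set.Icc_eq_empty hkn, Set.Icc_eq_empty (by omega)]
    rw [descentSet_inv_eq_Icc_iff hk hkn, finalWord_iff hk hkn (nodup_oneLine π), hrows] at hd
    exact S.isSuperstandardHook_of_rows_eq_hookRow hd

theorem isSuperstandardHook_of_patternKnuthClosed (h : PatternKnuthClosed (knuthClass S)) :
    S.IsSuperstandardHook := by
  rcases Nat.eq_zero_or_pos n with hn | hn
  · exact S.isSuperstandardHook_of_eq_zero hn
  obtain ⟨k, hk, -, h | h⟩ := S.isTableau_rows.eq_hook_of_containmentInvariant
    S.rows_flatten_perm hn h.containmentInvariant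
  · exact S.isSuperstandardHook_of_rows_eq_hookRow h
  · exact S.isSuperstandardHook_of_rows_eq_hookCol hk h

end StandardYoungTableau

end PatternKnuth

/-! ### The main theorem -/

theorem mainTheorem4 (n : ℕ) (S : PatternKnuth.StandardYoungTableau n)
    (A : Set (Equiv.Perm (Fin n))) (hA : A = PatternKnuth.knuthClass S) :
    List.TFAE [
      PatternKnuth.PatternKnuthClosed A,
      PatternKnuth.SwapClosed A,
      ∃ J : Set ℕ, J ⊆ Set.Icc 1 (n - 1) ∧
        (∃ k : ℕ, J = Set.Icc 1 k ∨ J = Set.Icc k (n - 1)) ∧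
        A = PatternKnuth.invDescentClass n J,
      S.IsSuperstandardHook] := by
  subst hA
  have h32 : (∃ J : Set ℕ, J ⊆ Set.Icc 1 (n - 1) ∧
      (∃ k : ℕ, J = Set.Icc 1 k ∨ J = Set.Icc k (n - 1)) ∧
        PatternKnuth.knuthClass S = PatternKnuth.invDescentClass n J) →
      PatternKnuth.SwapClosed (PatternKnuth.knuthClass S) := by
    rintro ⟨J, -, -, h⟩
    exact h ▸ PatternKnuth.swapClosed_invDescentClass J
  tfae_have 1 → 4 := S.isSuperstandardHook_of_patternKnuthClosed
  tfae_have 4 → 3 := S.exists_interval_of_isSuperstandardHook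
  tfae_have 3 → 2 := h32
  tfae_have 2 → 1 := PatternKnuth.SwapClosed.patternKnuthClosed
  tfae_have 3 → 4 := S.isSuperstandardHook_of_exists_interval
  tfae_finish
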